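/- **Setting.** Let $G\subset\mathbb R^3$ be a bounded open set with $C^\infty$ boundary (i.e. $\overline G$ is a $C^\infty$ submanifold of $\mathbb R^3$ with boundary, with interior $G$) and strictly convex closure; let $\nu$ be the outward unit normal on $\partial G$, $S\subset\mathbb R^3$ the unit sphere with surface measure $d\omega$ ($S'$ denotes a copy of $S$ with variable $\omega'$), and $I=[E_0,E_m]$ with $0\le E_0<E_m<\infty$, $I^\circ=\,]E_0,E_m[$. Put $\Gamma_-=\{(y,\omega,E)\in\partial G\times S\times I:\omega\cdot\nu(y)<0\}$ and $\Gamma_0=\{(y,\omega,E)\in\partial G\times S\times I:\omega\cdot\nu(y)=0\}$. All functions are real valued, and $m\in\mathbb N_0$. For $k\in\mathbb N\cup\{\infty\}$ and a Banach space $X$, let $C^{(k,0,0)}(\overline G\times S\times I,X)$ be the set of restrictions to $G\times S\times I^\circ$ of compactly supported functions $\mathbb R^3\times S\times\mathbb R\to X$ all of whose derivatives $\partial_x^\alpha$, $|\alpha|\le k$, exist and are continuous in $(x,\omega,E)$; $X=\mathbb R$ is omitted. Let $C_0^{(k,0,0)}(\overline G\times S\times I,X,\Gamma_-)$ be the subset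 of those whose support (closed in $\overline G\times S\times I$) does not meet $\Gamma_-\cup\Gamma_0$. * $H_0^{(m,0,0)}=H_0^{(m,0,0)}(G\times S\times I,\Gamma_-)$ is the completion of $\mathcal D:=\bigcap_{k\ge1}C_0^{(k,0,0)}(\overline G\times S\times I,\Gamma_-)$ for $\langle\psi,v\rangle=\sum_{|\alpha|\le m}\langle\partial_x^\alpha\psi,\partial_x^\alpha v\rangle_{L^2(G\times S\times I)}$. * $\|\Sigma\|_{W^{\infty,(m,0,0)}}=\max_{|\alpha|\le m}\|\partial_x^\alpha\Sigma\|_{L^\infty(G\times S\times I)}$ (weak derivatives), and $\mathcal W^{\infty,(m,0,0)}$ is the completion of $C^{(\infty,0,0)}(\overline G\times S\times I)$ for this norm. * For $\sigma^2=\sigma^2(x,\omega',\omega,E)$, the norms of $W^{\infty,(m,0,0)}(G\times S\times I,L^1(S'))$ and $W^{\infty,(m,0,0)}(G\times S'\times I,L^1(S))$ are $\max_{|\alpha|\le m}\operatorname{ess\,sup}_{(x,\omega,E)}\int_{S'}|\partial_x^\alpha\sigma^2|\,d\omega'$ and $\max_{|\alpha|\le m}\operatorname{ess\,sup}_{(x,\omega',E)}\int_{S}|\partial_x^\alpha\sigma^2|\,d\omega$.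 $\mathcal W_0^{\infty,(m,0,0)}(G\times S\times I,L^1(S'),\Gamma_-)$ is the completion of $C_0^{(\infty,0,0)}(\overline G\times S\times I,L^1(S'),\Gamma_-)\cap W^{\infty,(m,0,0)}(G\times S'\times I,L^1(S))$ for the sum of the two norms. * $(K_r\psi)(x,\omega,E)=\int_{S'}\sigma^2(x,\omega',\omega,E)\,\psi(x,\omega',E)\,d\omega'$. * $c(m)$ denotes any constant $c(m)>0$ with $\|\Sigma\psi\|_{H_0^{(m,0,0)}}\le c(m)\,\|\Sigma\|_{W^{\infty,(m,0,0)}}\|\psi\|_{H_0^{(m,0,0)}}$ for all $\Sigma\in\mathcal W^{\infty,(m,0,0)}$ and $\psi\in\mathcal D$. **Theorem 3.10.** A constant $c(m)$ exists that depends only on $m$. Let $\Sigma\in\mathcal W^{\infty,(m,0,0)}$ and $\sigma^2\in\mathcal W_0^{\infty,(m,0,0)}(G\times S\times I,L^1(S'),\Gamma_-)$. Then $K_r$ is a bounded operator on $H_0^{(m,0,0)}$, with norm denoted $\|K_r\|_m$; the formula $Q_m\psi=\omega\cdot\nabla_x\psi+\Sigma\psi-K_r\psi$, $D(Q_m)=\mathcal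 D$, defines an operator in $H_0^{(m,0,0)}$; and $Q_m$ is closable. Let $\widetilde Q_m$ be its closure. For every admissible constant $c(m)$ and every $C>c(m)\|\Sigma\|_{W^{\infty,(m,0,0)}}+\|K_r\|_m$, $$R(\widetilde Q_m+C\,\mathcal I)=H_0^{(m,0,0)}(G\times S\times I,\Gamma_-).$$ Hence for every $f\in H_0^{(m,0,0)}$ the problem $$\omega\cdot\nabla_x\psi+\Sigma\psi-K_r\psi+C\psi=f,\qquad \psi|_{\Gamma_-}=0,$$ has a unique strong solution $\psi\in H_0^{(m,0,0)}$, i.e. there is a unique $\psi\in D(\widetilde Q_m)$ with $(\widetilde Q_m+C\,\mathcal I)\psi=f$. This $\psi$ has a weak derivative $\omega\cdot\nabla_x\psi\in L^2(G\times S\times I)$, satisfies the equation almost everywhere, and has inflow trace zero on $\Gamma_-$. Here the inflow trace is the continuous extension of $\psi\mapsto\psi|_{\Gamma_-}$ from $C^{(1,0,0)}(\overline G\times S\times I)$, with the norm $(\|\psi\|_{L^2}^2+\|\omega\cdot\nabla_x\psi\|_{L^2}^2)^{1/2}$, to $L^2(\Gamma_-,\tau_-|\omega\cdot\nu|\,d\sigma\,d\omega\,dE)$,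 where $d\sigma$ is the surface measure on $\partial G$ and $\tau_-(y,\omega)=\inf\{s>0: y+s\omega\notin G\}$. -/

import Mathlib

open MeasureTheory Set Filter Topology
open scoped ENNReal NNReal

noncomputable section

namespace Transport

/-- Euclidean three-space. -/
abbrev E3 : Type := EuclideanSpace ℝ (Fin 3)

/-- The unit sphere of velocity directions. -/
abbrev S2 : Type := Metric.sphere (0 : E3) 1

/-- The ambient phase space `ℝ³ × S × ℝ`, with points `(x, ω, E)`. -/
abbrev Phase : Type := E3 × S2 × ℝ

/-- The ambient space of cross-sections, with points `(x, ω', ω, E)`. -/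
abbrev KPhase : Type := E3 × S2 × S2 × ℝ

/-- The surface measure of the unit sphere. -/
abbrev sphereMeasure : Measure S2 := (volume : Measure E3).toSphere

/-! ### The spatial domain and the energy interval -/

/-- `φ` is a smooth chart of `ℝ³` around `y` which straightens `G`: in it, `G` is the set where the
last coordinate is negative. -/
def IsBoundaryChart (G : Set E3) (y : E3) (φ : OpenPartialHomeomorph E3 E3) : Prop :=
  y ∈ φ.source ∧ ContDiffOn ℝ (⊤ : ℕ∞) φ φ.source ∧ ContDiffOn ℝ (⊤ : ℕ∞) φ.symm φ.target ∧
    ∀ x ∈ φ.source, x ∈ G ↔ φ x 2 < 0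

/-- A bounded open set `G ⊂ ℝ³` with smooth boundary (the closure of `G` is a smooth submanifold with
boundary, and `G` is its interior) and strictly convex closure, and an energy interval
`I = [E₀, Eₘ]` with `0 ≤ E₀ < Eₘ`. -/
structure Domain where
  /-- The spatial domain. -/
  G : Set E3
  /-- The lower end of the energy interval. -/
  E₀ : ℝ
  /-- The upper end of the energy interval. -/
  Em : ℝ
  isOpen : IsOpen G
  isBounded : Bornology.IsBounded G
  smooth_boundary : ∀ y ∈ frontier G, ∃ φ, IsBoundaryChart G y φ
  strictConvex : StrictConvex ℝ (closure G)
  E₀_nonneg : 0 ≤ E₀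
  E₀_lt_Em : E₀ < Em

/-- `n` is an outward pointing unit normal of `G` at `y`: a unit vector that is a positive multiple
of the gradient at `y` of the last coordinate of a boundary chart. -/
def IsOutwardNormal (G : Set E3) (y n : E3) : Prop :=
  ‖n‖ = 1 ∧ ∃ φ, IsBoundaryChart G y φ ∧ ∃ a : ℝ, 0 < a ∧
    ∀ v : E3, fderiv ℝ (fun x => φ x 2) y v = a * inner ℝ n v

/-- The outward unit normal `ν(y)` at a boundary point `y`. -/
def outwardNormal (G : Set E3) (y : E3) : E3 :=
  Classical.epsilon (IsOutwardNormal G y)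

namespace Domain

variable (D : Domain)

/-- The open phase space `G × S × I°`. -/
def phase : Set Phase := D.G ×ˢ (univ ×ˢ Ioo D.E₀ D.Em)

/-- The measure `dx dω dE` on `G × S × I`; the two end points of `I` form a null set. -/
def μ : Measure Phase :=
  ((volume : Measure E3).prod (sphereMeasure.prod (volume : Measure ℝ))).restrict D.phase

/-- The open set `G × S' × S × I°`. -/
def kphase : Set KPhase := D.G ×ˢ (univ ×ˢ (univ ×ˢ Ioo D.E₀ D.Em))

/-- The measure `dx dω' dω dE` on `G × S' × S × I`. -/
def κ : Measure KPhase :=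
  ((volume : Measure E3).prod
    (sphereMeasure.prod (sphereMeasure.prod (volume : Measure ℝ)))).restrict D.kphase

/-- The set `Γ₋ ∪ Γ₀` of boundary points `(y, ω, E)` with `ω · ν(y) ≤ 0`. -/
def inflowOrTangent : Set Phase :=
  {p | p.1 ∈ frontier D.G ∧ p.2.2 ∈ Icc D.E₀ D.Em ∧
    inner ℝ (p.2.1 : E3) (outwardNormal D.G p.1) ≤ 0}

end Domain

/-! ### Partial derivatives in the spatial variable -/

section Derivatives

variable {F : Type*} [NormedAddCommGroup F] [NormedSpace ℝ F]

/-- The partial derivative `∂/∂xᵢ` of a function on `ℝ³`. -/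
def partialD (i : Fin 3) (h : E3 → F) : E3 → F :=
  fun x => fderiv ℝ h x (EuclideanSpace.single i 1)

/-- The order `|α|` of a multi-index. -/
def order (α : Fin 3 → ℕ) : ℕ := α 0 + α 1 + α 2

/-- The partial derivative `∂^α` of a function on `ℝ³`. -/
def iterD (α : Fin 3 → ℕ) (h : E3 → F) : E3 → F :=
  (partialD 0)^[α 0] ((partialD 1)^[α 1] ((partialD 2)^[α 2] h))

/-- The partial derivative `∂ₓ^α f` of a function of `x ∈ ℝ³` and further variables `q`. -/
def dx {Q : Type*} (α : Fin 3 → ℕ) (f : E3 × Q → F) : E3 × Q → F :=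
  fun p => iterD α (fun x => f (x, p.2)) p.1

/-- The class `C₀^{(k,0,0)}` on the whole ambient space: all derivatives `∂ₓ^α f`, `|α| ≤ k`, exist
and are continuous in all variables together, and `f` has compact support. -/
structure IsCx {Q : Type*} [TopologicalSpace Q] (k : ℕ∞) (f : E3 × Q → F) : Prop where
  contDiff : ∀ q, ContDiff ℝ k (fun x => f (x, q))
  continuous_dx : ∀ α : Fin 3 → ℕ, (order α : ℕ∞) ≤ k → Continuous (dx α f)
  compact : HasCompactSupport f

/-- `ψ` belongs to `C^{(k,0,0)}(closure G × S × I)`: on `G × S × I°` it is the restriction of a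
function of class `C₀^{(k,0,0)}` on `ℝ³ × S × ℝ`. -/
def IsCxBar (D : Domain) (k : ℕ∞) (ψ : Phase → F) : Prop :=
  ∃ f : Phase → F, IsCx k f ∧ EqOn ψ f D.phase

/-- `supp ψ ∩ (Γ₋ ∪ Γ₀) = ∅`, where `supp ψ` is the closure of the set of points of `G × S × I°` at
which `ψ` does not vanish. -/
def AvoidsInflow (D : Domain) (ψ : Phase → F) : Prop :=
  Disjoint (closure (Function.support ψ ∩ D.phase)) D.inflowOrTangent

lemma partialD_add {i : Fin 3} {f g : E3 → F} (hf : ContDiff ℝ 1 f) (hg : ContDiff ℝ 1 g) :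
    partialD i (f + g) = partialD i f + partialD i g := by
  funext x
  have h1 := hf.differentiable (by norm_num) x
  have h2 := hg.differentiable (by norm_num) x
  simp [partialD, fderiv_add h1 h2]

lemma partialD_smul {i : Fin 3} {f : E3 → F} (c : ℝ) (hf : ContDiff ℝ 1 f) :
    partialD i (c • f) = c • partialD i f := by
  funext x
  have h1 := hf.differentiable (by norm_num) x
  simp [partialD, fderiv_const_smul h1]

lemma contDiff_partialD {i : Fin 3} {f : E3 → F} {n : ℕ}
    (hf : ContDiff ℝ ((n + 1 : ℕ) : WithTop ℕ∞) f) : ContDiff ℝ (n : WithTop ℕ∞) (partialD i f) := by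
  have : ContDiff ℝ (n : WithTop ℕ∞) (fderiv ℝ f) :=
    hf.fderiv_right (by push_cast; exact le_rfl)
  exact this.clm_apply contDiff_const

lemma iterate_partialD (i : Fin 3) (a : ℕ) : ∀ (n : ℕ) (f g : E3 → F) (c : ℝ),
    ContDiff ℝ ((n + a : ℕ) : WithTop ℕ∞) f → ContDiff ℝ ((n + a : ℕ) : WithTop ℕ∞) g →
    ContDiff ℝ (n : WithTop ℕ∞) ((partialD i)^[a] f) ∧
    (partialD i)^[a] (f + g) = (partialD i)^[a] f + (partialD i)^[a] g ∧
    (partialD i)^[a] (c • f) = c • (partialD i)^[a] f := by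
  induction a with
  | zero => intro n f g c hf hg; exact ⟨by simpa using hf, rfl, rfl⟩
  | succ a ih =>
    intro n f g c hf hg
    have one_le : ((1 : ℕ∞) : WithTop ℕ∞) ≤ ((n + (a + 1) : ℕ) : WithTop ℕ∞) := by
      norm_cast; omega
    have hf1 : ContDiff ℝ 1 f := hf.of_le (by exact_mod_cast one_le)
    have hg1 : ContDiff ℝ 1 g := hg.of_le (by exact_mod_cast one_le)
    have e : n + (a + 1) = (n + a) + 1 := by ring
    rw [e] at hf hg
    have key := ih n (partialD i f) (partialD i g) c (contDiff_partialD hf) (contDiff_partialD hg)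
    simp only [Function.iterate_succ, Function.comp_apply]
    rw [partialD_add hf1 hg1, partialD_smul c hf1]
    exact key

lemma iterD_add_smul (α : Fin 3 → ℕ) (f g : E3 → F) (c : ℝ)
    (hf : ContDiff ℝ (order α : WithTop ℕ∞) f) (hg : ContDiff ℝ (order α : WithTop ℕ∞) g) :
    iterD α (f + g) = iterD α f + iterD α g ∧ iterD α (c • f) = c • iterD α f := by
  unfold iterD
  unfold order at hf hg
  obtain ⟨f2, a2, s2⟩ := iterate_partialD 2 (α 2) (α 0 + α 1) f g c hf hg
  obtain ⟨g2, -, -⟩ := iterate_partialD 2 (α 2) (α 0 + α 1) g g c hg hg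
  obtain ⟨f1, a1, s1⟩ := iterate_partialD 1 (α 1) (α 0) _ _ c f2 g2
  obtain ⟨g1, -, -⟩ := iterate_partialD 1 (α 1) (α 0) _ _ c g2 g2
  rw [← zero_add (α 0)] at f1 g1
  obtain ⟨-, a0, s0⟩ := iterate_partialD 0 (α 0) 0 _ _ c f1 g1
  rw [a2, s2, a1, s1, a0, s0]
  exact ⟨rfl, rfl⟩

lemma iterate_partialD_congr {G : Set E3} (hG : IsOpen G) (i : Fin 3) (a : ℕ) :
    ∀ f g : E3 → F, EqOn f g G → EqOn ((partialD i)^[a] f) ((partialD i)^[a] g) G := by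
  induction a with
  | zero => intro f g h; exact h
  | succ a ih =>
    intro f g h
    simp only [Function.iterate_succ, Function.comp_apply]
    refine ih _ _ fun x hx => ?_
    have : f =ᶠ[𝓝 x] g := h.eventuallyEq_of_mem (hG.mem_nhds hx)
    simp only [partialD, this.fderiv_eq]

lemma iterD_congr {G : Set E3} (hG : IsOpen G) (α : Fin 3 → ℕ) {f g : E3 → F} (h : EqOn f g G) :
    EqOn (iterD α f) (iterD α g) G :=
  iterate_partialD_congr hG _ _ _ _ (iterate_partialD_congr hG _ _ _ _
    (iterate_partialD_congr hG _ _ _ _ h))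

lemma dx_congr (D : Domain) (α : Fin 3 → ℕ) {f g : Phase → F} (h : EqOn f g D.phase) :
    EqOn (dx α f) (dx α g) D.phase := by
  rintro ⟨x, q⟩ ⟨hx, hq⟩
  exact iterD_congr D.isOpen α (f := fun y => f (y, q)) (g := fun y => g (y, q))
    (fun y hy => h (show (y, q) ∈ D.phase from ⟨hy, hq⟩)) hx

lemma IsCx.contDiff_order {Q : Type*} [TopologicalSpace Q] {k : ℕ∞} {f : E3 × Q → F}
    (hf : IsCx k f) {α : Fin 3 → ℕ} (hα : (order α : ℕ∞) ≤ k) (q : Q) :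
    ContDiff ℝ (order α : WithTop ℕ∞) (fun x => f (x, q)) :=
  (hf.contDiff q).of_le (by exact_mod_cast hα)

lemma IsCx.dx_add {Q : Type*} [TopologicalSpace Q] {k : ℕ∞} {f g : E3 × Q → F}
    (hf : IsCx k f) (hg : IsCx k g) {α : Fin 3 → ℕ} (hα : (order α : ℕ∞) ≤ k) :
    dx α (f + g) = dx α f + dx α g := by
  funext p
  exact congrFun (iterD_add_smul α _ _ 0 (hf.contDiff_order hα p.2)
    (hg.contDiff_order hα p.2)).1 p.1

lemma IsCx.dx_smul {Q : Type*} [TopologicalSpace Q] {k : ℕ∞} {f : E3 × Q → F}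
    (hf : IsCx k f) (c : ℝ) {α : Fin 3 → ℕ} (hα : (order α : ℕ∞) ≤ k) :
    dx α (c • f) = c • dx α f := by
  funext p
  exact congrFun (iterD_add_smul α _ _ c (hf.contDiff_order hα p.2)
    (hf.contDiff_order hα p.2)).2 p.1

lemma IsCx.add {Q : Type*} [TopologicalSpace Q] {k : ℕ∞} {f g : E3 × Q → F}
    (hf : IsCx k f) (hg : IsCx k g) : IsCx k (f + g) where
  contDiff q := (hf.contDiff q).add (hg.contDiff q)
  continuous_dx α hα := by
    rw [hf.dx_add hg hα]
    exact (hf.continuous_dx α hα).add (hg.continuous_dx α hα)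
  compact := hf.compact.add hg.compact

lemma IsCx.smul {Q : Type*} [TopologicalSpace Q] {k : ℕ∞} {f : E3 × Q → F}
    (hf : IsCx k f) (c : ℝ) : IsCx k (c • f) where
  contDiff q := contDiff_const.smul (hf.contDiff q)
  continuous_dx α hα := by
    rw [hf.dx_smul c hα]
    exact (hf.continuous_dx α hα).const_smul c
  compact := hf.compact.smul_left (f := fun _ => c)

lemma iterD_zero (α : Fin 3 → ℕ) : iterD α (0 : E3 → F) = 0 := by
  have h : ∀ (i : Fin 3) (a : ℕ), (partialD i)^[a] (0 : E3 → F) = 0 := by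
    intro i a
    induction a with
    | zero => rfl
    | succ a ih =>
      rw [Function.iterate_succ_apply']
      rw [ih]
      funext x
      simp [partialD]
  simp [iterD, h]

lemma isCx_zero {Q : Type*} [TopologicalSpace Q] (k : ℕ∞) : IsCx k (0 : E3 × Q → F) where
  contDiff q := contDiff_const
  continuous_dx α _ := by
    have : dx α (0 : E3 × Q → F) = 0 := by
      funext p
      exact congrFun (iterD_zero α) p.1
    rw [this]
    exact continuous_const
  compact := HasCompactSupport.zero

/-- The derivatives of a compactly supported function vanish off its support. -/
lemma IsCx.hasCompactSupport_dx {k : ℕ∞} {f : Phase → F} (hf : IsCx k f) (α : Fin 3 → ℕ) :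
    HasCompactSupport (dx α f) := by
  refine HasCompactSupport.intro hf.compact ?_
  rintro ⟨x, q⟩ hp
  have ho : IsOpen {y : E3 | (y, q) ∈ (tsupport f)ᶜ} :=
    (isClosed_tsupport f).isOpen_compl.preimage (by fun_prop : Continuous fun y : E3 => (y, q))
  have he : EqOn (fun y => f (y, q)) 0 {y : E3 | (y, q) ∈ (tsupport f)ᶜ} := fun y hy =>
    image_eq_zero_of_notMem_tsupport hy
  have h2 := iterD_congr ho α he (show x ∈ _ from hp)
  rw [iterD_zero] at h2
  exact h2

end Derivatives

/-! ### The Hilbert space `H₀^{(m,0,0)}(G × S × I, Γ₋)` -/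

/-- The intersection over `k ≥ 1` of the spaces `C₀^{(k,0,0)}(closure G × S × I, Γ₋)`. Only the
values on `G × S × I°` matter. -/
def C0 (D : Domain) : Submodule ℝ (Phase → ℝ) where
  carrier := {ψ | (∀ k : ℕ, 1 ≤ k → IsCxBar D k ψ) ∧ AvoidsInflow D ψ}
  zero_mem' := by
    refine ⟨fun k _ => ⟨0, isCx_zero _, fun _ _ => rfl⟩, ?_⟩
    simp [AvoidsInflow]
  add_mem' := by
    rintro ψ χ ⟨h1, h2⟩ ⟨h3, h4⟩
    refine ⟨fun k hk => ?_, ?_⟩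
    · obtain ⟨f, hf, ef⟩ := h1 k hk
      obtain ⟨g, hg, eg⟩ := h3 k hk
      exact ⟨f + g, hf.add hg, fun p hp => by simp [ef hp, eg hp]⟩
    · have hs : Function.support (ψ + χ) ∩ D.phase ⊆
          (Function.support ψ ∩ D.phase) ∪ (Function.support χ ∩ D.phase) := by
        rw [← union_inter_distrib_right]
        exact inter_subset_inter_left _ (Function.support_add _ _)
      have := closure_mono hs
      rw [closure_union] at this
      exact (Disjoint.union_left h2 h4).mono_left this
  smul_mem' := by
    rintro c ψ ⟨h1, h2⟩
    refine ⟨fun k hk => ?_, ?_⟩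
    · obtain ⟨f, hf, ef⟩ := h1 k hk
      exact ⟨c • f, hf.smul c, fun p hp => by simp [ef hp]⟩
    · exact h2.mono_left (closure_mono (inter_subset_inter_left _
        (Function.support_const_smul_subset c ψ)))

/-- The multi-indices `α ∈ ℕ³` with `|α| ≤ m`. -/
def multiIdx (m : ℕ) : Finset (Fin 3 → ℕ) :=
  (Fintype.piFinset fun _ => Finset.range (m + 1)).filter fun α => order α ≤ m

lemma mem_multiIdx {m : ℕ} {α : Fin 3 → ℕ} : α ∈ multiIdx m ↔ order α ≤ m := by
  refine ⟨fun h => (Finset.mem_filter.1 h).2, fun h => Finset.mem_filter.2 ⟨?_, h⟩⟩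
  simp only [Fintype.mem_piFinset, Finset.mem_range]
  unfold order at h
  intro i
  fin_cases i <;> simp <;> omega

/-- The multi-index `0`. -/
def zeroIdx (m : ℕ) : multiIdx m := ⟨0, mem_multiIdx.2 (by simp [order])⟩

/-- Families `(u_α)_{|α| ≤ m}` in `L²(G × S × I)` with the inner product
`∑_α ⟨u_α, v_α⟩`. A function `ψ` with derivatives in `L²` is represented by `(∂ₓ^α ψ)_α`, so that
the inner product is that of `H^{(m,0,0)}(G × S × I)`. -/
abbrev Jets (D : Domain) (m : ℕ) : Type :=
  PiLp 2 (fun _ : multiIdx m => Lp ℝ 2 D.μ)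

lemma ae_mem_phase (D : Domain) : ∀ᵐ p ∂D.μ, p ∈ D.phase :=
  ae_restrict_mem (D.isOpen.measurableSet.prod (MeasurableSet.univ.prod measurableSet_Ioo))

lemma exists_ext {D : Domain} (ψ : C0 D) (m : ℕ) :
    ∃ f : Phase → ℝ, IsCx m f ∧ EqOn ψ.1 f D.phase := by
  obtain ⟨f, hf, ef⟩ := ψ.2.1 (m + 1) (by omega)
  refine ⟨f, ⟨fun q => (hf.contDiff q).of_le ?_, fun α hα => hf.continuous_dx α ?_, hf.compact⟩, ef⟩
  · norm_cast; omega
  · exact hα.trans (by norm_cast; omega)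

lemma order_le {m : ℕ} (α : multiIdx m) : (order α.1 : ℕ∞) ≤ (m : ℕ∞) := by
  exact_mod_cast mem_multiIdx.1 α.2

lemma memLp_dx {D : Domain} {m : ℕ} (ψ : C0 D) (α : multiIdx m) : MemLp (dx α.1 ψ.1) 2 D.μ := by
  obtain ⟨f, hf, ef⟩ := exists_ext ψ m
  have h1 : MemLp (dx α.1 f) 2
      ((volume : Measure E3).prod (sphereMeasure.prod (volume : Measure ℝ))) :=
    (hf.continuous_dx α.1 (order_le α)).memLp_of_hasCompactSupport (hf.hasCompactSupport_dx α.1)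
  refine (h1.restrict D.phase).ae_eq ?_
  filter_upwards [ae_mem_phase D] with p hp
  exact (dx_congr D α.1 ef hp).symm

/-- The family `(∂ₓ^α ψ)_{|α| ≤ m}` of a smooth function, as a linear map. -/
def jet (D : Domain) (m : ℕ) : C0 D →ₗ[ℝ] Jets D m where
  toFun ψ := WithLp.toLp 2 fun α => (memLp_dx ψ α).toLp (dx α.1 ψ.1)
  map_add' ψ χ := by
    ext1 α
    simp only [PiLp.add_apply]
    rw [← MemLp.toLp_add, MemLp.toLp_eq_toLp_iff]
    obtain ⟨f, hf, ef⟩ := exists_ext ψ m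
    obtain ⟨g, hg, eg⟩ := exists_ext χ m
    filter_upwards [ae_mem_phase D] with p hp
    have e : EqOn (ψ + χ).1 (f + g) D.phase := fun p hp => by
      simp [ef hp, eg hp]
    rw [dx_congr D α.1 e hp, hf.dx_add hg (order_le α)]
    simp [dx_congr D α.1 ef hp, dx_congr D α.1 eg hp]
  map_smul' c ψ := by
    ext1 α
    simp only [PiLp.smul_apply, RingHom.id_apply]
    rw [← MemLp.toLp_const_smul, MemLp.toLp_eq_toLp_iff]
    obtain ⟨f, hf, ef⟩ := exists_ext ψ m
    filter_upwards [ae_mem_phase D] with p hp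
    have e : EqOn (c • ψ).1 (c • f) D.phase := fun p hp => by
      simp [ef hp]
    rw [dx_congr D α.1 e hp, hf.dx_smul c (order_le α)]
    simp [dx_congr D α.1 ef hp]

/-- `H₀^{(m,0,0)}(G × S × I, Γ₋)`: the completion of the space `C0 D` for the inner product of
`H^{(m,0,0)}(G × S × I)`, realised as the closure of its isometric image in a Hilbert space. -/
def H0 (D : Domain) (m : ℕ) : Submodule ℝ (Jets D m) :=
  (LinearMap.range (jet D m)).topologicalClosure

/-- The inclusion of the smooth functions into `H₀^{(m,0,0)}(G × S × I, Γ₋)`. -/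
def incl (D : Domain) (m : ℕ) : C0 D →ₗ[ℝ] H0 D m :=
  (jet D m).codRestrict (H0 D m) fun ψ =>
    Submodule.le_topologicalClosure _ (LinearMap.mem_range_self _ ψ)

/-- The element of `L²(G × S × I)` underlying an element of `H₀^{(m,0,0)}`, as a function. -/
def toFn {D : Domain} {m : ℕ} (u : H0 D m) : Phase → ℝ :=
  (u.1 (zeroIdx m) : Lp ℝ 2 D.μ)

/-! ### Weak derivatives and the coefficient spaces -/

/-- `g` is the weak derivative `∂ₓ^α f` on the open set `Ω`. The measure `μ` is meant to be
concentrated on `Ω` and finite. -/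
def IsWeakDx {Q : Type*} [TopologicalSpace Q] [MeasurableSpace Q] (Ω : Set (E3 × Q))
    (μ : Measure (E3 × Q)) (α : Fin 3 → ℕ) (f g : E3 × Q → ℝ) : Prop :=
  Integrable f μ ∧ Integrable g μ ∧
    ∀ φ : E3 × Q → ℝ, IsCx ⊤ φ → tsupport φ ⊆ Ω →
      ∫ p, f p * dx α φ p ∂μ = (-1) ^ order α * ∫ p, g p * φ p ∂μ

/-- The norm of `W^{∞,(m,0,0)}(G × S × I)`: the largest `L^∞`-norm of a derivative `∂ₓ^α f`,
`|α| ≤ m`. It is `∞` if one of these weak derivatives does not exist. -/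
def wNorm (D : Domain) (m : ℕ) (f : Phase → ℝ) : ℝ≥0∞ :=
  ⨆ α ∈ multiIdx m, ⨅ (g : Phase → ℝ) (_ : IsWeakDx D.phase D.μ α f g), eLpNorm g ∞ D.μ

/-- The space `𝒲^{∞,(m,0,0)}(G × S × I)`: the completion (closure) of
`C^{(∞,0,0)}(closure G × S × I)` for the norm of `W^{∞,(m,0,0)}(G × S × I)`. -/
def MemW (D : Domain) (m : ℕ) (f : Phase → ℝ) : Prop :=
  ∀ ε : ℝ≥0∞, 0 < ε → ∃ Φ : Phase → ℝ, IsCxBar D ⊤ Φ ∧ wNorm D m (f - Φ) < ε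

/-- The norm of `W^{∞,(m,0,0)}(G × S × I, L¹(S'))`. -/
def kNorm₁ (D : Domain) (m : ℕ) (σ : KPhase → ℝ) : ℝ≥0∞ :=
  ⨆ α ∈ multiIdx m, ⨅ (g : KPhase → ℝ) (_ : IsWeakDx D.kphase D.κ α σ g),
    essSup (fun p : Phase => ∫⁻ ω', ‖g (p.1, ω', p.2.1, p.2.2)‖ₑ ∂sphereMeasure) D.μ

/-- The norm of `W^{∞,(m,0,0)}(G × S' × I, L¹(S))`. -/
def kNorm₂ (D : Domain) (m : ℕ) (σ : KPhase → ℝ) : ℝ≥0∞ :=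
  ⨆ α ∈ multiIdx m, ⨅ (g : KPhase → ℝ) (_ : IsWeakDx D.kphase D.κ α σ g),
    essSup (fun p : Phase => ∫⁻ ω, ‖g (p.1, p.2.1, ω, p.2.2)‖ₑ ∂sphereMeasure) D.μ

/-- `σ` belongs to `C₀^{(∞,0,0)}(closure G × S × I, L¹(S'), Γ₋)`: the map
`(x, ω, E) ↦ σ(x, ·, ω, E)` is, on `G × S × I°`, the restriction of a compactly supported
`L¹(S')`-valued function, smooth in `x` with derivatives continuous in all variables, and its
support does not meet `Γ₋ ∪ Γ₀`. -/
def IsC0Kernel (D : Domain) (σ : KPhase → ℝ) : Prop :=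
  AEStronglyMeasurable σ D.κ ∧ ∃ T : Phase → Lp ℝ 1 sphereMeasure,
    IsCxBar D ⊤ T ∧ AvoidsInflow D T ∧
    ∀ᵐ p ∂D.μ, T p =ᵐ[sphereMeasure] fun ω' => σ (p.1, ω', p.2.1, p.2.2)

/-- The space `𝒲₀^{∞,(m,0,0)}(G × S × I, L¹(S'), Γ₋)`: the completion (closure) of
`C₀^{(∞,0,0)}(closure G × S × I, L¹(S'), Γ₋) ∩ W^{∞,(m,0,0)}(G × S' × I, L¹(S))` for the sum of the
two norms. -/
def MemW0 (D : Domain) (m : ℕ) (σ : KPhase → ℝ) : Prop :=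
  ∀ ε : ℝ≥0∞, 0 < ε → ∃ τ : KPhase → ℝ, IsC0Kernel D τ ∧ kNorm₂ D m τ < ∞ ∧
    kNorm₁ D m (σ - τ) + kNorm₂ D m (σ - τ) < ε

/-! ### The operators -/

/-- The streaming term `ω · ∇ₓψ` of a function that is differentiable in `x`. -/
def streaming (ψ : Phase → ℝ) : Phase → ℝ :=
  fun p => fderiv ℝ (fun x => ψ (x, p.2)) p.1 (p.2.1 : E3)

/-- The collision integral `(K_r ψ)(x, ω, E) = ∫_{S'} σ²(x, ω', ω, E) ψ(x, ω', E) dω'`. -/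
def collision (σ : KPhase → ℝ) (ψ : Phase → ℝ) : Phase → ℝ :=
  fun p => ∫ ω', σ (p.1, ω', p.2.1, p.2.2) * ψ (p.1, ω', p.2.2) ∂sphereMeasure

/-- `K` is the collision operator `K_r` as a bounded operator on `H₀^{(m,0,0)}`. -/
def IsCollisionOperator (D : Domain) (m : ℕ) (σ : KPhase → ℝ) (K : H0 D m →L[ℝ] H0 D m) : Prop :=
  ∀ u : H0 D m, toFn (K u) =ᵐ[D.μ] collision σ (toFn u)

/-- `Q` is the unbounded operator `Q_m ψ = ω · ∇ₓψ + Σψ - K_r ψ` in `H₀^{(m,0,0)}` with domain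
`⋂ₖ C₀^{(k,0,0)}(closure G × S × I, Γ₋)`. -/
def IsTransportOperator (D : Domain) (m : ℕ) (Sig : Phase → ℝ) (σ : KPhase → ℝ)
    (Q : H0 D m →ₗ.[ℝ] H0 D m) : Prop :=
  Q.domain = LinearMap.range (incl D m) ∧
    ∀ (ψ : C0 D) (u : Q.domain), (u : H0 D m) = incl D m ψ →
      toFn (Q u) =ᵐ[D.μ] fun p => streaming ψ.1 p + Sig p * ψ.1 p - collision σ ψ.1 p

/-- `c` is an admissible constant `c(m)`:
`‖Sψ‖ ≤ c ‖S‖_{W^{∞,(m,0,0)}} ‖ψ‖` for the norm of `H₀^{(m,0,0)}`, for all `S ∈ 𝒲^{∞,(m,0,0)}` and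
all smooth `ψ`. -/
def IsMultiplierConstant (D : Domain) (m : ℕ) (c : ℝ) : Prop :=
  0 < c ∧ ∀ S : Phase → ℝ, MemW D m S → ∀ (ψ : C0 D) (v : H0 D m),
    (toFn v =ᵐ[D.μ] fun p => S p * ψ.1 p) → ‖v‖ ≤ c * (wNorm D m S).toReal * ‖incl D m ψ‖

/-- `ψ` is a strong solution, in `H₀^{(m,0,0)}`, of `Qψ + Cψ = f`: it lies in the domain of the
closure of `Q` and solves the equation for this closure. -/
def IsStrongSolution {D : Domain} {m : ℕ} (Q : H0 D m →ₗ.[ℝ] H0 D m) (C : ℝ) (f ψ : H0 D m) : Prop :=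
  ∃ h : ψ ∈ Q.closure.domain, Q.closure ⟨ψ, h⟩ + C • ψ = f

/-! ### The equation in the sense of distributions and the inflow trace -/

/-- `d = ω · ∇ₓψ` weakly on `G × S × I°`. -/
def IsWeakStreaming (D : Domain) (ψ d : Phase → ℝ) : Prop :=
  ∀ φ : Phase → ℝ, IsCx ⊤ φ → tsupport φ ⊆ D.phase →
    ∫ p, ψ p * streaming φ p ∂D.μ = -∫ p, d p * φ p ∂D.μ

/-- The escape time `τ₋(y, ω)` from boundary to boundary. -/
def escapeTime (D : Domain) (y ω : E3) : ℝ :=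
  sInf {s : ℝ | 0 < s ∧ y + s • ω ∉ D.G}

/-- The surface measure of the boundary of `G`: the two-dimensional Hausdorff measure, normalised so
that it is area on planes. -/
def boundaryMeasure (D : Domain) : Measure E3 :=
  (ENNReal.ofReal (Real.pi / 4) • Measure.hausdorffMeasure 2).restrict (frontier D.G)

open scoped Classical in
/-- The squared norm of `F` restricted to `Γ₋` in `L²(Γ₋, τ₋ |ω · ν| dσ dω dE)`. -/
def inflowNormSq (D : Domain) (F : Phase → ℝ) : ℝ≥0∞ :=
  ∫⁻ E in Icc D.E₀ D.Em, ∫⁻ ω, ∫⁻ y,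
    (if inner ℝ (ω : E3) (outwardNormal D.G y) < 0 then
      ENNReal.ofReal (F (y, ω, E) ^ 2 * escapeTime D y ω * |inner ℝ (ω : E3) (outwardNormal D.G y)|)
    else 0) ∂(boundaryMeasure D) ∂sphereMeasure

/-- `ψ`, with `ψ` and `d = ω · ∇ₓψ` in `L²`, has inflow trace `ψ|_{Γ₋} = 0`. The trace is the
continuous extension, from functions of class `C^{(1,0,0)}` up to the boundary, of the restriction
to `Γ₋`. -/
def HasZeroInflowTrace (D : Domain) (ψ d : Phase → ℝ) : Prop :=
  ∃ F : ℕ → Phase → ℝ, (∀ n, IsCx 1 (F n)) ∧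
    Tendsto (fun n => eLpNorm (F n - ψ) 2 D.μ) atTop (𝓝 0) ∧
    Tendsto (fun n => eLpNorm (streaming (F n) - d) 2 D.μ) atTop (𝓝 0) ∧
    Tendsto (fun n => inflowNormSq D (F n)) atTop (𝓝 0)

/-- `ψ` solves `ω · ∇ₓψ + Σψ - K_r ψ + Cψ = f`, `ψ|_{Γ₋} = 0`, with `ω · ∇ₓψ ∈ L²` taken weakly, the
equation holding almost everywhere and the boundary condition in the sense of the inflow trace. -/
def SolvesInflowProblem (D : Domain) (Sig : Phase → ℝ) (σ : KPhase → ℝ) (C : ℝ)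
    (f ψ : Phase → ℝ) : Prop :=
  ∃ d : Phase → ℝ, MemLp d 2 D.μ ∧ IsWeakStreaming D ψ d ∧ HasZeroInflowTrace D ψ d ∧
    ∀ᵐ p ∂D.μ, d p + Sig p * ψ p - collision σ ψ p + C * ψ p = f p

end Transport

end

/-! The problem is a bounded perturbation of a maximal accretive operator. In `H0`, a closed space
of jets $(u_\alpha)_{|\alpha|\le m}$ in $L^2$, the components are the weak derivatives of $u_0$
(`isWeakDx_component`), so an element is determined by its underlying function (`toFn_injective`).

Streaming commutes with $\partial_x^\alpha$, as $\omega$ is only a parameter. Accretivity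
(`inner_streamH0_nonneg`) therefore reduces to $\int_G h\,\partial_\omega h\ge0$ for
$h=\partial_x^\alpha\psi$ and fixed $(\omega,E)$. Instead of Green's formula,
`setIntegral_mul_fderiv_nonneg` differentiates $t\mapsto\int_G h(x-t\omega)^2$ at $0$: since $h$
vanishes where lines enter $G$ and is Lipschitz, the mass flowing in during time $t$ is $O(t^2)$.

The range of the shifted streaming operator is dense because $\omega\cdot\nabla_x\psi+\lambda\psi=f$
is solved exactly, for smooth $f$, by integration along backward characteristics
(`exists_free_solution`). Strict convexity enters here: it separates the support of $f$ from the
points outside $G$ whose forward rays meet $\overline G$ (`disjoint_closure_shadow`), so that $f$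
can be cut off smoothly, and it keeps the solution zero near $\Gamma_-\cup\Gamma_0$
(`inner_pos_of_mem`). Hence the closed graph is maximal accretive
(`isMaximalAccretive_streamGraph`).

The operators $M$ (multiplication by $\Sigma$) and $K$ (collision) are built on jets by expanding
derivatives with the product rule. `exists_operator_H0` shows that `H0` is preserved, provided the
operators are limits of operators preserving smooth functions that vanish near the inflow boundary.
On $L^2$ the bounds are the sup norm for $M$ and the Schur test `IsSchur.eLpNorm_le` for $K$.
Counting terms in the product rule gives a multiplier constant depending on $m$ only.

By density $\|M\|\le c(m)\|\Sigma\|$ for every admissible constant (`norm_multiplier_le`), so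
$\|M-K\|<C$ and a Neumann series solves the equation (`exists_perturbed`); accretivity gives
uniqueness. Closability, the weak equation and the zero trace pass to the limit from smooth
functions: the weak relation is closed, and the smooth approximants vanish identically on
$\Gamma_-$. -/

noncomputable section

namespace Transport

/-! ### Calculus of functions that are smooth in the spatial variable -/

section SmoothX

set_option linter.unusedSectionVars false

variable {F : Type*} [NormedAddCommGroup F] [NormedSpace ℝ F]
variable {Q : Type*}

/-- The partial derivative `∂/∂xᵢ` of a function of `x ∈ ℝ³` and further variables. -/
def pd (i : Fin 3) (f : E3 × Q → F) : E3 × Q → F :=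
  fun p => partialD i (fun x => f (x, p.2)) p.1

/-- The linear map `ℝ³ → F` with the given values on the standard basis. -/
def linOf (g : Fin 3 → F) : E3 →L[ℝ] F :=
  ∑ i, (EuclideanSpace.proj i : E3 →L[ℝ] ℝ).smulRight (g i)

lemma linOf_apply (g : Fin 3 → F) (v : E3) : linOf g v = ∑ i, v i • g i := by
  simp [linOf]

lemma linOf_single (g : Fin 3 → F) (i : Fin 3) :
    linOf g (EuclideanSpace.single i 1) = g i := by
  rw [linOf_apply, Finset.sum_eq_single i] <;> simp +contextual

lemma eq_linOf (L : E3 →L[ℝ] F) : L = linOf fun i => L (EuclideanSpace.single i 1) := by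
  ext v
  rw [linOf_apply]
  conv_lhs => rw [← (EuclideanSpace.basisFun (Fin 3) ℝ).sum_repr v]
  simp

lemma norm_linOf_le (g : Fin 3 → F) : ‖linOf g‖ ≤ ∑ i, ‖g i‖ := by
  refine ContinuousLinearMap.opNorm_le_bound _ (by positivity) fun v => ?_
  rw [linOf_apply, Finset.sum_mul]
  refine (norm_sum_le _ _).trans (Finset.sum_le_sum fun i _ => ?_)
  rw [norm_smul, mul_comm]
  exact mul_le_mul_of_nonneg_left (PiLp.norm_apply_le v i) (norm_nonneg _)

variable [TopologicalSpace Q]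

/-- `f` is `k` times differentiable in `x`, and these derivatives are continuous in all variables
together. -/
def SmoothX : ℕ → (E3 × Q → F) → Prop
  | 0, f => Continuous f
  | k + 1, f => Continuous f ∧ (∀ q, Differentiable ℝ fun x => f (x, q)) ∧
      ∀ i, SmoothX k (pd i f)

lemma SmoothX.continuous {k : ℕ} {f : E3 × Q → F} (h : SmoothX k f) : Continuous f := by
  cases k with
  | zero => exact h
  | succ k => exact h.1

lemma SmoothX.pred : ∀ {k : ℕ} {f : E3 × Q → F}, SmoothX (k + 1) f → SmoothX k f
  | 0, _, h => h.1
  | _ + 1, _, h => ⟨h.1, h.2.1, fun i => (h.2.2 i).pred⟩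

lemma SmoothX.mono {k l : ℕ} (hkl : k ≤ l) {f : E3 × Q → F} (h : SmoothX l f) : SmoothX k f := by
  induction l, hkl using Nat.le_induction with
  | base => exact h
  | succ n _ ih => exact ih h.pred

lemma SmoothX.pderiv {k : ℕ} {f : E3 × Q → F} (h : SmoothX (k + 1) f) (i : Fin 3) :
    SmoothX k (pd i f) := h.2.2 i

lemma fderiv_eq_linOf (f : E3 × Q → F) (p : E3 × Q) :
    fderiv ℝ (fun x => f (x, p.2)) p.1 = linOf fun i => pd i f p :=
  eq_linOf _

lemma SmoothX.hasFDerivAt {k : ℕ} {f : E3 × Q → F} (h : SmoothX (k + 1) f) (p : E3 × Q) :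
    HasFDerivAt (fun x => f (x, p.2)) (linOf fun i => pd i f p) p.1 := by
  rw [← fderiv_eq_linOf]
  exact (h.2.1 p.2 p.1).hasFDerivAt

lemma pd_eq_of_hasFDerivAt {f : E3 × Q → F} {g : Fin 3 → E3 × Q → F}
    (h : ∀ p : E3 × Q, HasFDerivAt (fun x => f (x, p.2)) (linOf fun i => g i p) p.1) (i : Fin 3) :
    pd i f = g i := by
  funext p
  simp only [pd, partialD]
  rw [(h p).fderiv, linOf_single]

/-- An induction step for closure properties: once a candidate gradient of class `SmoothX k` is
exhibited, differentiability and the values of the partial derivatives both follow from it. -/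
lemma smoothX_succ_of_hasFDerivAt {k : ℕ} {f : E3 × Q → F} (hf : Continuous f)
    {g : Fin 3 → E3 × Q → F} (hg : ∀ i, SmoothX k (g i))
    (h : ∀ p : E3 × Q, HasFDerivAt (fun x => f (x, p.2)) (linOf fun i => g i p) p.1) :
    SmoothX (k + 1) f :=
  ⟨hf, fun q x => (h (x, q)).differentiableAt, fun i => by
    rw [pd_eq_of_hasFDerivAt h]; exact hg i⟩

lemma SmoothX.contDiff {k : ℕ} : ∀ {f : E3 × Q → F}, SmoothX k f → ∀ q,
    ContDiff ℝ (k : WithTop ℕ∞) fun x => f (x, q) := by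
  induction k with
  | zero =>
    intro f h q
    exact contDiff_zero.2 (h.continuous.comp (by fun_prop))
  | succ k ih =>
    intro f h q
    push_cast
    refine contDiff_succ_iff_hasFDerivAt.2
      ⟨fun x => linOf fun i => pd i f (x, q), ?_, fun x => h.hasFDerivAt (x, q)⟩
    unfold linOf
    refine ContDiff.sum fun i _ => ?_
    exact (ContinuousLinearMap.smulRightL ℝ E3 F (EuclideanSpace.proj i)).contDiff.comp
      (ih (h.pderiv i) q)

lemma partialD_comm {f : E3 → F} (hf : ContDiff ℝ 2 f) (i j : Fin 3) :
    partialD i (partialD j f) = partialD j (partialD i f) := by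
  have key : ∀ (i j : Fin 3) (x : E3), partialD i (partialD j f) x =
      fderiv ℝ (fderiv ℝ f) x (EuclideanSpace.single i 1) (EuclideanSpace.single j 1) := by
    intro i j x
    have h1 : DifferentiableAt ℝ (fderiv ℝ f) x :=
      (hf.fderiv_right (m := 1) (by norm_num)).differentiable (by norm_num) x
    have h2 : HasFDerivAt (partialD j f)
        ((ContinuousLinearMap.apply ℝ F (EuclideanSpace.single j (1 : ℝ))).comp
          (fderiv ℝ (fderiv ℝ f) x)) x :=
      (ContinuousLinearMap.apply ℝ F (EuclideanSpace.single j (1 : ℝ))).hasFDerivAt.comp x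
        h1.hasFDerivAt
    rw [partialD, h2.fderiv]
    rfl
  funext x
  rw [key, key]
  exact (hf.contDiffAt.isSymmSndFDerivAt (by simp)) _ _

lemma contDiff_iterate_partialD {i : Fin 3} {a n : ℕ} {f : E3 → F}
    (hf : ContDiff ℝ ((n + a : ℕ) : WithTop ℕ∞) f) :
    ContDiff ℝ (n : WithTop ℕ∞) ((partialD i)^[a] f) :=
  (iterate_partialD i a n f f 0 hf hf).1

lemma iterate_partialD_comm (i j : Fin 3) (a : ℕ) : ∀ {f : E3 → F},
    ContDiff ℝ ((1 + a : ℕ) : WithTop ℕ∞) f →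
    (partialD i)^[a] (partialD j f) = partialD j ((partialD i)^[a] f) := by
  induction a with
  | zero => intro f _; rfl
  | succ a ih =>
    intro f hf
    rw [Function.iterate_succ_apply, Function.iterate_succ_apply, partialD_comm, ih]
    · exact contDiff_partialD (hf.of_le (by norm_cast))
    · exact hf.of_le (by norm_cast; omega)

/-- The multi-index `α + eᵢ`. -/
def incr (α : Fin 3 → ℕ) (i : Fin 3) : Fin 3 → ℕ := α + Pi.single i 1

lemma order_incr (α : Fin 3 → ℕ) (i : Fin 3) : order (incr α i) = order α + 1 := by
  fin_cases i <;> simp [order, incr] <;> ring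

/-- `iterD` applies the coordinate derivatives in a fixed order, so the extra derivative has to be
commuted past the others into its own block. -/
lemma iterD_partialD (α : Fin 3 → ℕ) (i : Fin 3) {f : E3 → F}
    (hf : ContDiff ℝ ((order α + 1 : ℕ) : WithTop ℕ∞) f) :
    iterD α (partialD i f) = iterD (incr α i) f := by
  have h2 : ∀ n : ℕ, n + α 2 ≤ order α + 1 →
      ContDiff ℝ (n : WithTop ℕ∞) ((partialD 2)^[α 2] f) := fun n hn =>
    contDiff_iterate_partialD (hf.of_le (by exact_mod_cast hn))
  have h1 : ∀ n : ℕ, n + α 1 + α 2 ≤ order α + 1 →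
      ContDiff ℝ (n : WithTop ℕ∞) ((partialD 1)^[α 1] ((partialD 2)^[α 2] f)) := fun n hn =>
    contDiff_iterate_partialD (h2 _ (by exact_mod_cast hn))
  unfold order at h1 h2 hf
  unfold iterD
  have c2 : ∀ j, (partialD 2)^[α 2] (partialD j f) = partialD j ((partialD 2)^[α 2] f) := fun j =>
    iterate_partialD_comm 2 j _ (hf.of_le (by norm_cast; omega))
  have c1 : ∀ j, (partialD 1)^[α 1] (partialD j ((partialD 2)^[α 2] f)) =
      partialD j ((partialD 1)^[α 1] ((partialD 2)^[α 2] f)) := fun j =>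
    iterate_partialD_comm 1 j _ (h2 _ (by omega))
  have c0 : ∀ j, (partialD 0)^[α 0] (partialD j ((partialD 1)^[α 1] ((partialD 2)^[α 2] f))) =
      partialD j ((partialD 0)^[α 0] ((partialD 1)^[α 1] ((partialD 2)^[α 2] f))) := fun j =>
    iterate_partialD_comm 0 j _ (h1 _ (by omega))
  fin_cases i
  · simp [incr, c2, c1, Function.iterate_succ_apply]
  · simp only [Fin.mk_one, incr, Pi.add_apply]
    simp [c2, Function.iterate_succ_apply]
  · simp [incr, Function.iterate_succ_apply]

lemma dx_pd (α : Fin 3 → ℕ) (i : Fin 3) {f : E3 × Q → F}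
    (hf : ∀ q, ContDiff ℝ ((order α + 1 : ℕ) : WithTop ℕ∞) fun x => f (x, q)) :
    dx α (pd i f) = dx (incr α i) f := by
  funext p
  exact congrFun (iterD_partialD α i (hf p.2)) p.1

lemma dx_zero (f : E3 × Q → F) : dx 0 f = f := rfl

lemma SmoothX.of_continuous_dx {k : ℕ} : ∀ {f : E3 × Q → F},
    (∀ q, ContDiff ℝ (k : WithTop ℕ∞) fun x => f (x, q)) →
    (∀ α, order α ≤ k → Continuous (dx α f)) → SmoothX k f := by
  induction k with
  | zero => intro f _ h; exact h 0 (by simp [order])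
  | succ k ih =>
    intro f h1 h2
    refine ⟨h2 0 (by simp [order]), fun q => (h1 q).differentiable (by norm_cast), fun i => ?_⟩
    refine ih (fun q => contDiff_partialD (h1 q)) fun α hα => ?_
    rw [dx_pd α i fun q => (h1 q).of_le (by norm_cast; omega)]
    exact h2 _ (by rw [order_incr]; omega)

/-- Iterated partial derivatives, along a word. -/
def dxw : List (Fin 3) → (E3 × Q → F) → E3 × Q → F
  | [], f => f
  | i :: w, f => dxw w (pd i f)

lemma dxw_append (v w : List (Fin 3)) (f : E3 × Q → F) : dxw (v ++ w) f = dxw w (dxw v f) := by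
  induction v generalizing f with
  | nil => rfl
  | cons i v ih => exact ih _

/-- A word that spells a multi-index. -/
def word (α : Fin 3 → ℕ) : List (Fin 3) :=
  List.replicate (α 2) 2 ++ (List.replicate (α 1) 1 ++ List.replicate (α 0) 0)

lemma length_word (α : Fin 3 → ℕ) : (word α).length = order α := by
  simp [word, order]; ring

lemma dxw_replicate (i : Fin 3) (a : ℕ) (f : E3 × Q → F) :
    dxw (List.replicate a i) f = fun p => (partialD i)^[a] (fun x => f (x, p.2)) p.1 := by
  induction a generalizing f with
  | zero => rfl
  | succ a ih => rw [List.replicate_succ]; exact ih _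

lemma dx_eq_dxw (α : Fin 3 → ℕ) (f : E3 × Q → F) : dx α f = dxw (word α) f := by
  rw [word, dxw_append, dxw_append, dxw_replicate, dxw_replicate, dxw_replicate]
  rfl

lemma SmoothX.dxw {k : ℕ} (w : List (Fin 3)) : ∀ {f : E3 × Q → F},
    SmoothX (k + w.length) f → SmoothX k (dxw w f) := by
  induction w with
  | nil => intro f h; exact h
  | cons i w ih => intro f h; exact ih (h.pderiv i)

lemma SmoothX.dx {k : ℕ} {α : Fin 3 → ℕ} {f : E3 × Q → F} (h : SmoothX (k + order α) f) :
    SmoothX k (dx α f) := by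
  rw [dx_eq_dxw]
  exact SmoothX.dxw _ (by rwa [length_word])

/-- Symmetry of mixed partials makes the two descriptions agree; the recursive one is the form on
which inductions run. -/
lemma isCx_iff {k : ℕ} {f : E3 × Q → F} : IsCx k f ↔ SmoothX k f ∧ HasCompactSupport f := by
  refine ⟨fun h => ⟨.of_continuous_dx (fun q => h.contDiff q) fun α hα =>
    h.continuous_dx α (by exact_mod_cast hα), h.compact⟩, fun h => ⟨fun q => h.1.contDiff q,
      fun α hα => ?_, h.2⟩⟩
  have hα' : order α ≤ k := by exact_mod_cast hα
  exact (SmoothX.dx (k := 0) (h.1.mono (by omega))).continuous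

lemma isCx_top_iff {f : E3 × Q → F} :
    IsCx ⊤ f ↔ (∀ k, SmoothX k f) ∧ HasCompactSupport f := by
  refine ⟨fun h => ⟨fun k => .of_continuous_dx (fun q => (h.contDiff q).of_le ?_) fun α hα =>
    h.continuous_dx α le_top, h.compact⟩, fun h => ⟨fun q => ?_, fun α _ => ?_, h.2⟩⟩
  · exact_mod_cast le_top
  · exact contDiff_infty.2 fun k => (h.1 k).contDiff q
  · exact (SmoothX.dx (k := 0) (h.1 (0 + order α))).continuous

lemma pd_comm {i j : Fin 3} {f : E3 × Q → F} (h : SmoothX 2 f) :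
    pd i (pd j f) = pd j (pd i f) := by
  funext p
  exact congrFun (partialD_comm (by exact_mod_cast h.contDiff p.2) i j) p.1

lemma dxw_pd (w : List (Fin 3)) (i : Fin 3) : ∀ {f : E3 × Q → F}, SmoothX (w.length + 1) f →
    dxw w (pd i f) = pd i (dxw w f) := by
  induction w with
  | nil => intro f _; rfl
  | cons j w ih =>
    intro f h
    have h2 : SmoothX 2 f := h.mono (by simp)
    simp only [Transport.dxw]
    rw [pd_comm h2, ih (h.pderiv j)]

/-! #### Closure properties -/

variable {F₁ F₂ : Type*} [NormedAddCommGroup F₁] [NormedSpace ℝ F₁]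
  [NormedAddCommGroup F₂] [NormedSpace ℝ F₂]

lemma pd_add {f g : E3 × Q → F} (hf : SmoothX 1 f) (hg : SmoothX 1 g) (i : Fin 3) :
    pd i (f + g) = pd i f + pd i g := by
  funext p
  exact congrFun (partialD_add (by exact_mod_cast hf.contDiff p.2)
    (by exact_mod_cast hg.contDiff p.2)) p.1

lemma SmoothX.add {k : ℕ} : ∀ {f g : E3 × Q → F}, SmoothX k f → SmoothX k g → SmoothX k (f + g) := by
  induction k with
  | zero => intro f g hf hg; exact Continuous.add hf hg
  | succ k ih =>
    intro f g hf hg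
    refine ⟨hf.1.add hg.1, fun q => (hf.2.1 q).add (hg.2.1 q), fun i => ?_⟩
    rw [pd_add (hf.mono (by omega)) (hg.mono (by omega))]
    exact ih (hf.pderiv i) (hg.pderiv i)

lemma hasFDerivAt_bilin (B : F₁ →L[ℝ] F₂ →L[ℝ] F) {f : E3 × Q → F₁} {g : E3 × Q → F₂}
    (hf : SmoothX 1 f) (hg : SmoothX 1 g) (p : E3 × Q) :
    HasFDerivAt (fun x => B (f (x, p.2)) (g (x, p.2)))
      (linOf fun i => B (pd i f p) (g p) + B (f p) (pd i g p)) p.1 := by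
  refine (B.hasFDerivAt_of_bilinear (hf.hasFDerivAt p) (hg.hasFDerivAt p)).congr_fderiv ?_
  ext v
  simp [linOf_apply, Finset.sum_add_distrib, add_comm]

lemma pd_bilin (B : F₁ →L[ℝ] F₂ →L[ℝ] F) {f : E3 × Q → F₁} {g : E3 × Q → F₂}
    (hf : SmoothX 1 f) (hg : SmoothX 1 g) (i : Fin 3) :
    pd i (fun p => B (f p) (g p)) = (fun p => B (pd i f p) (g p)) + fun p => B (f p) (pd i g p) :=
  pd_eq_of_hasFDerivAt (g := fun i p => B (pd i f p) (g p) + B (f p) (pd i g p))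
    (hasFDerivAt_bilin B hf hg) i

/-- General bilinear maps are allowed because the collision integral is a pairing of an `L¹`-valued
with a `C(S)`-valued function; the scalar product is a special case. -/
lemma SmoothX.bilin (B : F₁ →L[ℝ] F₂ →L[ℝ] F) {k : ℕ} : ∀ {f : E3 × Q → F₁} {g : E3 × Q → F₂},
    SmoothX k f → SmoothX k g → SmoothX k fun p => B (f p) (g p) := by
  have hc : ∀ {f : E3 × Q → F₁} {g : E3 × Q → F₂}, Continuous f → Continuous g →
      Continuous fun p => B (f p) (g p) := fun hf hg =>
    (B.continuous.comp hf).clm_apply hg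
  induction k with
  | zero => intro f g hf hg; exact hc hf hg
  | succ k ih =>
    intro f g hf hg
    exact smoothX_succ_of_hasFDerivAt (hc hf.1 hg.1)
      (fun i => (ih (hf.pderiv i) hg.pred).add (ih hf.pred (hg.pderiv i)))
      (hasFDerivAt_bilin B (hf.mono (by omega)) (hg.mono (by omega)))

lemma SmoothX.mul {k : ℕ} {f g : E3 × Q → ℝ} (hf : SmoothX k f)
    (hg : SmoothX k g) : SmoothX k (f * g) :=
  SmoothX.bilin (ContinuousLinearMap.mul ℝ ℝ) hf hg

lemma pd_mul {f g : E3 × Q → ℝ} (hf : SmoothX 1 f) (hg : SmoothX 1 g) (i : Fin 3) :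
    pd i (f * g) = pd i f * g + f * pd i g :=
  pd_bilin (ContinuousLinearMap.mul ℝ ℝ) hf hg i

lemma pd_clm (L : F →L[ℝ] F₁) {f : E3 × Q → F} (hf : SmoothX 1 f) (i : Fin 3) :
    pd i (fun p => L (f p)) = fun p => L (pd i f p) :=
  pd_eq_of_hasFDerivAt (g := fun i p => L (pd i f p)) (fun p =>
    ((L.hasFDerivAt).comp p.1 (hf.hasFDerivAt p)).congr_fderiv (by ext v; simp [linOf_apply])) i

lemma SmoothX.clm (L : F →L[ℝ] F₁) {k : ℕ} : ∀ {f : E3 × Q → F}, SmoothX k f →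
    SmoothX k fun p => L (f p) := by
  induction k with
  | zero => intro f hf; exact L.continuous.comp hf
  | succ k ih =>
    intro f hf
    refine ⟨L.continuous.comp hf.1, fun q => L.differentiable.comp (hf.2.1 q), fun i => ?_⟩
    rw [pd_clm L (hf.mono (by omega))]
    exact ih (hf.pderiv i)

lemma dxw_clm (L : F →L[ℝ] F₁) (w : List (Fin 3)) : ∀ {f : E3 × Q → F}, SmoothX w.length f →
    dxw w (fun p => L (f p)) = fun p => L (dxw w f p) := by
  induction w with
  | nil => intro f _; rfl
  | cons i w ih =>
    intro f hf
    simp only [Transport.dxw]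
    rw [pd_clm L (hf.mono (by simp)), ih (hf.pderiv i)]

/-- Reparametrisation `(x, r) ↦ f(x + v(r), q(r))`. -/
lemma SmoothX.reparam {R : Type*} [TopologicalSpace R] {v : R → E3} {q : R → Q} (hv : Continuous v)
    (hq : Continuous q) {k : ℕ} : ∀ {f : E3 × Q → F}, SmoothX k f →
    SmoothX k fun p : E3 × R => f (p.1 + v p.2, q p.2) := by
  have hc : ∀ {f : E3 × Q → F}, Continuous f →
      Continuous fun p : E3 × R => f (p.1 + v p.2, q p.2) := fun hf => hf.comp (by fun_prop)
  induction k with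
  | zero => intro f hf; exact hc hf
  | succ k ih =>
    intro f hf
    refine smoothX_succ_of_hasFDerivAt (hc hf.1) (fun i => ih (hf.pderiv i)) fun p => ?_
    have h := hf.hasFDerivAt (p.1 + v p.2, q p.2)
    exact (hasFDerivAt_comp_add_right (f := fun x => f (x, q p.2)) (v p.2)).2 h

lemma smoothX_of_param {a : Q → F} (ha : Continuous a) (k : ℕ) :
    SmoothX k fun p : E3 × Q => a p.2 := by
  induction k generalizing a with
  | zero => exact ha.comp continuous_snd
  | succ k ih =>
    refine smoothX_succ_of_hasFDerivAt (g := fun _ _ => 0) (ha.comp continuous_snd)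
      (fun i => ih (a := fun _ => 0) continuous_const) fun p => ?_
    refine (hasFDerivAt_const (a p.2) p.1).congr_fderiv ?_
    ext v
    simp [linOf_apply]

lemma smoothX_of_contDiff {k : ℕ} : ∀ {b : E3 → F}, ContDiff ℝ (k : WithTop ℕ∞) b →
    SmoothX k fun p : E3 × Q => b p.1 := by
  induction k with
  | zero => intro b hb; exact hb.continuous.comp continuous_fst
  | succ k ih =>
    intro b hb
    exact ⟨hb.continuous.comp continuous_fst, fun q => hb.differentiable (by norm_cast),
      fun i => ih (contDiff_partialD (i := i) hb)⟩

/-- A function smooth in `x` with a compact parameter space `Y`, as a function with values in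
`C(Y)`. -/
lemma SmoothX.curry {Y : Type*} [TopologicalSpace Y] [CompactSpace Y] {k : ℕ} :
    ∀ {f : E3 × (Q × Y) → F} (hf : SmoothX k f),
      SmoothX k fun p : E3 × Q => (⟨fun y => f (p.1, (p.2, y)),
        hf.continuous.comp (by fun_prop)⟩ : C(Y, F)) := by
  have hc : ∀ {f : E3 × (Q × Y) → F} (hf : Continuous f),
      Continuous fun p : E3 × Q => (⟨fun y => f (p.1, (p.2, y)),
        hf.comp (by fun_prop)⟩ : C(Y, F)) := fun {f} hf =>
    (ContinuousMap.curry ⟨fun r : (E3 × Q) × Y => f (r.1.1, (r.1.2, r.2)),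
      hf.comp (by fun_prop)⟩).continuous
  induction k with
  | zero => intro f hf; exact hc hf
  | succ k ih =>
    intro f hf
    refine smoothX_succ_of_hasFDerivAt (g := fun i p => ⟨fun y => pd i f (p.1, (p.2, y)),
        (hf.pderiv i).continuous.comp (by fun_prop)⟩) (hc hf.1) (fun i => ih (hf.pderiv i)) fun p => ?_
    obtain ⟨x, q⟩ := p
    set g : Fin 3 → E3 → C(Y, F) := fun i x => ⟨fun y => pd i f (x, (q, y)),
        (hf.pderiv i).continuous.comp (by fun_prop)⟩ with hg
    have hgc : ∀ i, Continuous (g i) := fun i =>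
      (hc (hf.pderiv i).continuous).comp (f := fun x => (x, q)) (by fun_prop)
    refine HasFDerivAt.of_isLittleO ?_
    rw [Asymptotics.isLittleO_iff]
    intro ε hε
    -- The partials are continuous in `x` as maps into `C(Y)`, so one radius `δ` serves all `y` at
    -- once. The mean value inequality on the ball then bounds the remainder uniformly in `y`.
    have h1 : ∀ᶠ z in 𝓝 x, ∑ i, ‖g i z - g i x‖ < ε := by
      have : Tendsto (fun z => ∑ i, ‖g i z - g i x‖) (𝓝 x) (𝓝 (∑ i, ‖g i x - g i x‖)) :=
        ((continuous_finsetSum _ fun i _ => ((hgc i).sub continuous_const).norm)).tendsto x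
      simp only [sub_self, norm_zero, Finset.sum_const_zero] at this
      exact this.eventually_lt_const hε
    obtain ⟨δ, hδ, hb⟩ := Metric.eventually_nhds_iff_ball.1 h1
    filter_upwards [Metric.ball_mem_nhds x hδ] with z hz
    refine (ContinuousMap.norm_le _ (by positivity)).2 fun y => ?_
    have hd : ∀ w ∈ Metric.ball x δ, HasFDerivWithinAt (fun x => f (x, (q, y)))
        (linOf fun i => pd i f (w, (q, y))) (Metric.ball x δ) w := fun w _ =>
      (hf.hasFDerivAt (w, (q, y))).hasFDerivWithinAt
    have hbd : ∀ w ∈ Metric.ball x δ,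
        ‖(linOf fun i => pd i f (w, (q, y))) - linOf fun i => pd i f (x, (q, y))‖ ≤ ε := by
      intro w hw
      have e : (linOf fun i => pd i f (w, (q, y))) - (linOf fun i => pd i f (x, (q, y))) =
          linOf fun i => (g i w - g i x) y := by
        ext v
        simp [linOf_apply, hg, smul_sub]
      rw [e]
      refine (norm_linOf_le _).trans (le_trans (Finset.sum_le_sum fun i _ => ?_) (hb w hw).le)
      exact ContinuousMap.norm_coe_le_norm _ y
    have := (convex_ball x δ).norm_image_sub_le_of_norm_hasFDerivWithin_le' hd hbd
      (Metric.mem_ball_self hδ) hz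
    simpa [linOf_apply, hg, ContinuousMap.sum_apply] using this

lemma pd_congr {G : Set E3} (hG : IsOpen G) {V : Set Q} {f g : E3 × Q → F}
    (h : EqOn f g (G ×ˢ V)) (i : Fin 3) : EqOn (pd i f) (pd i g) (G ×ˢ V) := by
  rintro ⟨x, q⟩ ⟨hx, hq⟩
  exact iterate_partialD_congr hG i 1 (fun x => f (x, q)) (fun x => g (x, q))
    (fun y hy => h ⟨hy, hq⟩) hx

lemma pd_eq_zero_of_isOpen {O : Set (E3 × Q)} (hO : IsOpen O) {f : E3 × Q → F}
    (h : ∀ p ∈ O, f p = 0) (i : Fin 3) : ∀ p ∈ O, pd i f p = 0 := by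
  rintro ⟨x, q⟩ hp
  have ho : IsOpen {y : E3 | (y, q) ∈ O} := hO.preimage (by fun_prop)
  have := iterate_partialD_congr ho i 1 (fun x => f (x, q)) (fun _ => 0) (fun y hy => h _ hy) hp
  simpa [pd, partialD] using this

lemma dxw_eq_zero_of_isOpen {O : Set (E3 × Q)} (hO : IsOpen O) (w : List (Fin 3)) :
    ∀ {f : E3 × Q → F}, (∀ p ∈ O, f p = 0) → ∀ p ∈ O, dxw w f p = 0 := by
  induction w with
  | nil => intro f h; exact h
  | cons i w ih => intro f h; exact ih (pd_eq_zero_of_isOpen hO h i)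

lemma tsupport_dxw (w : List (Fin 3)) (f : E3 × Q → F) : tsupport (dxw w f) ⊆ tsupport f := by
  refine closure_minimal (fun p hp => ?_) (isClosed_tsupport f)
  by_contra hn
  exact hp (dxw_eq_zero_of_isOpen (isClosed_tsupport f).isOpen_compl w
    (fun p hp => image_eq_zero_of_notMem_tsupport hp) p hn)

lemma tsupport_pd (i : Fin 3) (f : E3 × Q → F) : tsupport (pd i f) ⊆ tsupport f :=
  tsupport_dxw [i] f

lemma hasCompactSupport_pd {f : E3 × Q → F} (h : HasCompactSupport f) (i : Fin 3) :
    HasCompactSupport (pd i f) :=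
  h.of_isClosed_subset (isClosed_tsupport _) (tsupport_pd i f)

end SmoothX

end Transport

end

noncomputable section

namespace Transport

/-! ### Test functions and weak derivatives -/

section Test

set_option linter.unusedSectionVars false

variable {Q : Type*} [MetricSpace Q]

/-- Test functions on `Ω`: smooth in `x`, with compact support in `Ω`. -/
def IsTest (Ω : Set (E3 × Q)) (φ : E3 × Q → ℝ) : Prop := IsCx ⊤ φ ∧ tsupport φ ⊆ Ω

lemma IsTest.smoothX {Ω : Set (E3 × Q)} {φ : E3 × Q → ℝ} (h : IsTest Ω φ) (k : ℕ) : SmoothX k φ :=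
  (isCx_top_iff.1 h.1).1 k

lemma IsTest.continuous {Ω : Set (E3 × Q)} {φ : E3 × Q → ℝ} (h : IsTest Ω φ) : Continuous φ :=
  (h.smoothX 0).continuous

lemma IsTest.compact {Ω : Set (E3 × Q)} {φ : E3 × Q → ℝ} (h : IsTest Ω φ) : HasCompactSupport φ :=
  h.1.compact

lemma IsTest.eq_zero {Ω : Set (E3 × Q)} {φ : E3 × Q → ℝ} (h : IsTest Ω φ) {p : E3 × Q}
    (hp : p ∉ Ω) : φ p = 0 :=
  image_eq_zero_of_notMem_tsupport fun hn => hp (h.2 hn)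

lemma IsTest.pd {Ω : Set (E3 × Q)} {φ : E3 × Q → ℝ} (h : IsTest Ω φ) (i : Fin 3) :
    IsTest Ω (pd i φ) :=
  ⟨isCx_top_iff.2 ⟨fun k => (h.smoothX (k + 1)).pderiv i, hasCompactSupport_pd h.compact i⟩,
    (tsupport_pd i φ).trans h.2⟩

lemma IsTest.dxw {Ω : Set (E3 × Q)} (w : List (Fin 3)) : ∀ {φ : E3 × Q → ℝ}, IsTest Ω φ →
    IsTest Ω (dxw w φ) := by
  induction w with
  | nil => intro φ h; exact h
  | cons i w ih => intro φ h; exact ih (h.pd i)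

lemma IsTest.dx {Ω : Set (E3 × Q)} (α : Fin 3 → ℕ) {φ : E3 × Q → ℝ} (h : IsTest Ω φ) :
    IsTest Ω (dx α φ) := by
  rw [dx_eq_dxw]; exact h.dxw _

/-- The extension of `ψ` may change with `k`, since each order of smoothness is checked separately
and the product does not see values off `Ω`. -/
lemma IsTest.mul_left {Ω : Set (E3 × Q)} {φ ψ : E3 × Q → ℝ} (h : IsTest Ω φ)
    (hψ : ∀ k, ∃ f, SmoothX k f ∧ EqOn ψ f Ω) : IsTest Ω (ψ * φ) := by
  refine ⟨isCx_top_iff.2 ⟨fun k => ?_, h.compact.mul_left⟩,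
    (tsupport_mul_subset_right (f := ψ)).trans h.2⟩
  obtain ⟨f, hf, ef⟩ := hψ k
  have : ψ * φ = f * φ := by
    funext p
    by_cases hp : p ∈ Ω
    · simp [ef hp]
    · simp [h.eq_zero hp]
  rw [this]
  exact hf.mul (h.smoothX k)

/-- A smooth bump in `x` times a Urysohn function in `q`: no smoothness in the parameter is demanded
of test functions. -/
lemma exists_test_local [ProperSpace Q] {U : Set (E3 × Q)} (hU : IsOpen U) {p : E3 × Q}
    (hp : p ∈ U) : ∃ φ : E3 × Q → ℝ, IsTest U φ ∧ (∀ p, φ p ∈ Icc (0 : ℝ) 1) ∧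
      ∀ᶠ z in 𝓝 p, φ z = 1 := by
  obtain ⟨x, q⟩ := p
  obtain ⟨V, W, hV, hW, hx, hq, hVW⟩ := isOpen_prod_iff.1 hU x q hp
  obtain ⟨δ, hδ, hδV⟩ := Metric.nhds_basis_closedBall.mem_iff.1 (hV.mem_nhds hx)
  obtain ⟨ε, hε, hεW⟩ := Metric.nhds_basis_closedBall.mem_iff.1 (hW.mem_nhds hq)
  let b : ContDiffBump x := ⟨δ / 2, δ, by positivity, by linarith⟩
  obtain ⟨u, hu1, hu0, huc, hur⟩ := exists_continuous_one_zero_of_isCompact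
    (isCompact_closedBall q (ε / 2)) (t := (Metric.ball q ε)ᶜ) Metric.isOpen_ball.isClosed_compl
    (disjoint_compl_right_iff_subset.2 (Metric.closedBall_subset_ball (by linarith)))
  have hus : tsupport u ⊆ Metric.closedBall q ε :=
    closure_minimal (fun z hz => by
      by_contra hn
      exact hz (hu0 fun hb => hn (Metric.ball_subset_closedBall hb))) Metric.isClosed_closedBall
  have hs : tsupport (fun p : E3 × Q => b p.1 * u p.2) ⊆
      Metric.closedBall x δ ×ˢ Metric.closedBall q ε := by
    refine closure_minimal (fun z hz => ?_) (Metric.isClosed_closedBall.prod Metric.isClosed_closedBall)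
    have hz' : b z.1 * u z.2 ≠ 0 := hz
    refine ⟨?_, hus (subset_tsupport _ (right_ne_zero_of_mul hz'))⟩
    have := subset_tsupport _ (left_ne_zero_of_mul hz' : z.1 ∈ Function.support b)
    rwa [b.tsupport_eq] at this
  refine ⟨fun p => b p.1 * u p.2, ⟨isCx_top_iff.2 ⟨fun k => ?_, ?_⟩, ?_⟩, ?_, ?_⟩
  · exact (smoothX_of_contDiff b.contDiff).mul (smoothX_of_param u.continuous k)
  · exact ((isCompact_closedBall x δ).prod (isCompact_closedBall q ε)).of_isClosed_subset
      (isClosed_tsupport _) hs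
  · exact hs.trans ((prod_mono hδV hεW).trans hVW)
  · exact fun p => ⟨mul_nonneg b.nonneg (hur _).1, mul_le_one₀ b.le_one (hur _).1 (hur _).2⟩
  · filter_upwards [prod_mem_nhds (Metric.closedBall_mem_nhds x (half_pos hδ))
      (Metric.closedBall_mem_nhds q (half_pos hε))] with z hz
    rw [b.one_of_mem_closedBall hz.1, hu1 hz.2]
    simp

lemma exists_test [ProperSpace Q] {U K : Set (E3 × Q)} (hU : IsOpen U) (hK : IsCompact K)
    (hKU : K ⊆ U) : ∃ φ : E3 × Q → ℝ, IsTest U φ ∧ (∀ p, φ p ∈ Icc (0 : ℝ) 1) ∧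
      ∀ p ∈ K, φ p = 1 := by
  refine hK.induction_on (p := fun s => ∃ φ : E3 × Q → ℝ, IsTest U φ ∧
    (∀ p, φ p ∈ Icc (0 : ℝ) 1) ∧ ∀ p ∈ s, φ p = 1) ?_ ?_ ?_ ?_
  · exact ⟨0, ⟨isCx_zero _, by simp⟩, by simp, by simp⟩
  · rintro s t hst ⟨φ, h1, h2, h3⟩
    exact ⟨φ, h1, h2, fun p hp => h3 p (hst hp)⟩
  · rintro s t ⟨φ, h1, h2, h3⟩ ⟨χ, g1, g2, g3⟩
    -- `φ + χ(1 - φ) = 1 - (1 - φ)(1 - χ)` stays in `[0, 1]` and equals `1` wherever `φ` or `χ`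
    -- does.
    have hs : tsupport (φ + χ * (fun p => 1 - φ p)) ⊆ tsupport φ ∪ tsupport χ :=
      (tsupport_add φ _).trans (union_subset_union_right _ tsupport_mul_subset_left)
    refine ⟨φ + χ * (fun p => 1 - φ p), ⟨isCx_top_iff.2 ⟨fun k => ?_, ?_⟩, ?_⟩, ?_, ?_⟩
    · refine (h1.smoothX k).add ((g1.smoothX k).mul ?_)
      have := (smoothX_of_param (Q := Q) (a := fun _ => (1 : ℝ)) continuous_const k).add
        ((h1.smoothX k).clm (-ContinuousLinearMap.id ℝ ℝ))
      convert this using 1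
      funext p
      simp [sub_eq_add_neg]
    · exact (h1.compact.isCompact.union g1.compact.isCompact).of_isClosed_subset
        (isClosed_tsupport _) hs
    · exact hs.trans (union_subset h1.2 g1.2)
    · intro p
      obtain ⟨a0, a1⟩ := h2 p
      obtain ⟨b0, b1⟩ := g2 p
      simp only [Pi.add_apply, Pi.mul_apply, mem_Icc]
      constructor <;> nlinarith
    · rintro p (hp | hp)
      · simp [h3 p hp]
      · simp [g3 p hp]
  · intro p hp
    obtain ⟨φ, h1, h2, h3⟩ := exists_test_local hU (hKU hp)
    exact ⟨{z | φ z = 1}, mem_nhdsWithin_of_mem_nhds h3, φ, h1, h2, fun p hp => hp⟩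

variable [ProperSpace Q] [MeasurableSpace Q] [BorelSpace Q]

/-- A function whose integral against every test function vanishes is zero. -/
lemma ae_eq_zero_of_forall_test {Ω : Set (E3 × Q)} (hΩ : IsOpen Ω) {μ : Measure (E3 × Q)}
    [IsFiniteMeasureOnCompacts μ] (hμ : ∀ᵐ p ∂μ, p ∈ Ω) {g : E3 × Q → ℝ} (hg : Integrable g μ)
    (h : ∀ φ, IsTest Ω φ → ∫ p, g p * φ p ∂μ = 0) : g =ᵐ[μ] 0 := by
  have key : ∀ K : Set (E3 × Q), IsCompact K → K ⊆ Ω → ∫ p in K, g p ∂μ = 0 := by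
    intro K hK hKΩ
    -- Cutoffs supported in shrinking thickenings of the closed set `K` tend pointwise to its
    -- indicator, and the integrands are dominated by `‖g‖`.
    have hU : ∀ n : ℕ, ∃ φ : E3 × Q → ℝ,
        IsTest (Metric.thickening (1 / ((n : ℝ) + 1)) K ∩ Ω) φ ∧
        (∀ p, φ p ∈ Icc (0 : ℝ) 1) ∧ ∀ p ∈ K, φ p = 1 := fun n =>
      exists_test (Metric.isOpen_thickening.inter hΩ) hK
        (subset_inter (Metric.self_subset_thickening (by positivity) _) hKΩ)
    choose φ h1 h2 h3 using hU
    have hl : Tendsto (fun n => ∫ p, g p * φ n p ∂μ) atTop (𝓝 (∫ p, K.indicator g p ∂μ)) := by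
      refine tendsto_integral_of_dominated_convergence (fun p => ‖g p‖)
        (fun n => hg.aestronglyMeasurable.mul (h1 n).continuous.aestronglyMeasurable) hg.norm
        (fun n => .of_forall fun p => ?_) (.of_forall fun p => ?_)
      · rw [norm_mul]
        refine mul_le_of_le_one_right (norm_nonneg _) ?_
        rw [Real.norm_eq_abs, abs_of_nonneg (h2 n p).1]
        exact (h2 n p).2
      · by_cases hp : p ∈ K
        · simp [h3 _ p hp, hp]
        · rw [indicator_of_notMem hp]
          obtain ⟨δ, hδ, hd⟩ : ∃ δ > 0, p ∉ Metric.thickening δ K := by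
            by_contra! hcon
            have : p ∈ closure K := by
              rw [Metric.closure_eq_iInter_thickening]
              simpa using hcon
            exact hp (hK.isClosed.closure_eq ▸ this)
          refine tendsto_const_nhds.congr' ?_
          have := (tendsto_one_div_add_atTop_nhds_zero_nat (𝕜 := ℝ)).eventually_lt_const hδ
          filter_upwards [this] with n hn
          rw [(h1 n).eq_zero fun hm => hd (Metric.thickening_mono hn.le _ hm.1), mul_zero]
    have h0 : ∀ n, ∫ p, g p * φ n p ∂μ = 0 := fun n =>
      h _ ⟨(h1 n).1, (h1 n).2.trans inter_subset_right⟩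
    simp only [h0] at hl
    rw [← integral_indicator hK.measurableSet]
    exact (tendsto_nhds_unique hl tendsto_const_nhds)
  refine ae_eq_zero_of_forall_setIntegral_isCompact_eq_zero' hg.locallyIntegrable fun K hK => ?_
  -- Exhausting `Ω` by increasing closed sets turns `K ∩ Ω` into a union of compact subsets of `Ω`.
  obtain ⟨F, hF1, hF2, hF3, hF4⟩ := hΩ.exists_iUnion_isClosed
  have e1 : ∫ p in K, g p ∂μ = ∫ p in K ∩ Ω, g p ∂μ := by
    refine setIntegral_congr_set ?_
    filter_upwards [hμ] with p hp
    exact propext ⟨fun hk => ⟨hk, hp⟩, fun hk => hk.1⟩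
  rw [e1, ← hF3, inter_iUnion]
  have := tendsto_setIntegral_of_monotone (μ := μ) (f := g) (s := fun n => K ∩ F n)
    (fun n => hK.measurableSet.inter (hF1 n).measurableSet)
    (fun a b hab => inter_subset_inter_right _ (hF4 hab)) hg.integrableOn
  simp only [key _ (hK.inter_right (hF1 _)) (inter_subset_right.trans (hF2 _))] at this
  exact (tendsto_nhds_unique this tendsto_const_nhds)

lemma ae_eq_of_forall_test {Ω : Set (E3 × Q)} (hΩ : IsOpen Ω) {μ : Measure (E3 × Q)}
    [IsFiniteMeasureOnCompacts μ] (hμ : ∀ᵐ p ∂μ, p ∈ Ω) {f g : E3 × Q → ℝ} (hf : Integrable f μ)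
    (hg : Integrable g μ)
    (h : ∀ φ, IsTest Ω φ → ∫ p, f p * φ p ∂μ = ∫ p, g p * φ p ∂μ) : f =ᵐ[μ] g := by
  have hi : ∀ {f : E3 × Q → ℝ}, Integrable f μ → ∀ φ, IsTest Ω φ →
      Integrable (fun p => f p * φ p) μ := by
    intro f hf φ hφ
    obtain ⟨C, hC⟩ := hφ.compact.exists_bound_of_continuous hφ.continuous
    exact hf.mul_bdd hφ.continuous.aestronglyMeasurable (.of_forall hC)
  have := ae_eq_zero_of_forall_test hΩ hμ (hf.sub hg) fun φ hφ => by
    simp only [Pi.sub_apply, sub_mul]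
    rw [integral_sub (hi hf φ hφ) (hi hg φ hφ), h φ hφ, sub_self]
  filter_upwards [this] with p hp
  simpa [sub_eq_zero] using hp

/-! ### Integration by parts in the spatial variable -/

variable [SecondCountableTopology Q] {ν : Measure Q} [SFinite ν] [IsFiniteMeasureOnCompacts ν]

/-- Fubini with `x` as the inner variable reduces this to slices in `ℝ³`; compact support of `φ`
alone disposes of the boundary terms. -/
lemma integral_mul_pd {f φ : E3 × Q → ℝ} (hf : SmoothX 1 f) (hφ : SmoothX 1 φ)
    (hc : HasCompactSupport φ) (i : Fin 3) :
    ∫ p, f p * pd i φ p ∂((volume : Measure E3).prod ν) =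
      -∫ p, pd i f p * φ p ∂((volume : Measure E3).prod ν) := by
  have hcp := hasCompactSupport_pd hc i
  have hi : ∀ {u v : E3 × Q → ℝ}, Continuous u → Continuous v → HasCompactSupport v →
      Integrable (fun p => u p * v p) ((volume : Measure E3).prod ν) := fun hu hv hs =>
    (hu.mul hv).integrable_of_hasCompactSupport hs.mul_left
  have hs : ∀ {v : E3 × Q → ℝ}, HasCompactSupport v → ∀ q, HasCompactSupport fun x => v (x, q) :=
    fun {v} hv q => HasCompactSupport.intro (hv.isCompact.image continuous_fst) fun x hx =>
      image_eq_zero_of_notMem_tsupport fun hn => hx ⟨(x, q), hn, rfl⟩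
  have hi' : ∀ {u v : E3 × Q → ℝ}, Continuous u → Continuous v → HasCompactSupport v → ∀ q,
      Integrable (fun x => u (x, q) * v (x, q)) (volume : Measure E3) := fun hu hv hsv q =>
    ((hu.comp (by fun_prop : Continuous fun x : E3 => (x, q))).mul
      (hv.comp (by fun_prop : Continuous fun x : E3 => (x, q)))).integrable_of_hasCompactSupport
      (hs hsv q).mul_left
  rw [integral_prod_symm _ (hi hf.continuous (hφ.pderiv i).continuous hcp),
    integral_prod_symm _ (hi (hf.pderiv i).continuous hφ.continuous hc), ← integral_neg]
  congr 1
  funext q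
  exact integral_mul_fderiv_eq_neg_fderiv_mul_of_integrable
    (f := fun x => f (x, q)) (g := fun x => φ (x, q)) (v := EuclideanSpace.single i (1 : ℝ))
    (hi' (hf.pderiv i).continuous hφ.continuous hc q)
    (hi' hf.continuous (hφ.pderiv i).continuous hcp q)
    (hi' hf.continuous hφ.continuous hc q) (fun x _ => hf.2.1 q x) (fun x _ => hφ.2.1 q x)

variable {G : Set E3} {V : Set Q}

/-- The test function vanishes off `G ×ˢ V`, so both integrals extend to the whole space with `f'`
replacing `f`, and the boundary of `G` plays no role. -/
lemma setIntegral_mul_pd (hG : IsOpen G) {f f' φ : E3 × Q → ℝ}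
    (hf : SmoothX 1 f') (ef : EqOn f f' (G ×ˢ V)) (hφ : IsTest (G ×ˢ V) φ) (i : Fin 3) :
    ∫ p in G ×ˢ V, f p * pd i φ p ∂((volume : Measure E3).prod ν) =
      -∫ p in G ×ˢ V, pd i f p * φ p ∂((volume : Measure E3).prod ν) := by
  have h0 : ∀ {u v w : E3 × Q → ℝ}, EqOn u v (G ×ˢ V) → IsTest (G ×ˢ V) w →
      ∫ p in G ×ˢ V, u p * w p ∂((volume : Measure E3).prod ν) =
        ∫ p, v p * w p ∂((volume : Measure E3).prod ν) := by
    intro u v w huv hw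
    have e : (fun p => u p * w p) = fun p => v p * w p := by
      funext p
      by_cases hp : p ∈ G ×ˢ V
      · simp only [huv hp]
      · simp [hw.eq_zero hp]
    rw [e]
    exact setIntegral_eq_integral_of_forall_compl_eq_zero fun p hp => by simp [hw.eq_zero hp]
  rw [h0 ef (hφ.pd i), h0 (pd_congr hG ef i) hφ]
  exact integral_mul_pd hf (hφ.smoothX 1) hφ.compact i

lemma setIntegral_mul_dxw (hG : IsOpen G) (w : List (Fin 3)) : ∀ {f f' φ : E3 × Q → ℝ},
    SmoothX w.length f' → EqOn f f' (G ×ˢ V) → IsTest (G ×ˢ V) φ →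
    ∫ p in G ×ˢ V, f p * dxw w φ p ∂((volume : Measure E3).prod ν) =
      (-1) ^ w.length * ∫ p in G ×ˢ V, dxw w f p * φ p ∂((volume : Measure E3).prod ν) := by
  induction w with
  | nil => intro f f' φ _ _ _; simp [dxw]
  | cons i w ih =>
    intro f f' φ hf ef hφ
    simp only [dxw]
    rw [dxw_pd w i (hφ.smoothX _), setIntegral_mul_pd hG (hf.mono (by simp)) ef (hφ.dxw w) i,
      ih (hf.pderiv i) (pd_congr hG ef i) hφ, List.length_cons, pow_succ]
    ring

lemma setIntegral_mul_dx (hG : IsOpen G) (α : Fin 3 → ℕ) {f f' φ : E3 × Q → ℝ}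
    (hf : SmoothX (order α) f') (ef : EqOn f f' (G ×ˢ V)) (hφ : IsTest (G ×ˢ V) φ) :
    ∫ p in G ×ˢ V, f p * dx α φ p ∂((volume : Measure E3).prod ν) =
      (-1) ^ order α * ∫ p in G ×ˢ V, dx α f p * φ p ∂((volume : Measure E3).prod ν) := by
  rw [dx_eq_dxw, dx_eq_dxw, ← length_word]
  exact setIntegral_mul_dxw hG _ (by rwa [length_word]) ef hφ

end Test

/-! ### Uniqueness and algebra of weak derivatives -/

section Weak

variable {Q : Type*} [MetricSpace Q] [ProperSpace Q] [MeasurableSpace Q] [BorelSpace Q]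
  {Ω : Set (E3 × Q)} {μ : Measure (E3 × Q)}

lemma IsWeakDx.ae_eq [IsFiniteMeasureOnCompacts μ] (hΩ : IsOpen Ω) (hμ : ∀ᵐ p ∂μ, p ∈ Ω)
    {α : Fin 3 → ℕ} {f g h : E3 × Q → ℝ} (hg : IsWeakDx Ω μ α f g) (hh : IsWeakDx Ω μ α f h) :
    g =ᵐ[μ] h := by
  refine ae_eq_of_forall_test hΩ hμ hg.2.1 hh.2.1 fun φ hφ => ?_
  have h1 := hg.2.2 φ hφ.1 hφ.2
  rw [hh.2.2 φ hφ.1 hφ.2] at h1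
  exact (mul_left_cancel₀ (pow_ne_zero _ (by norm_num)) h1).symm

omit [ProperSpace Q] [BorelSpace Q] in
-- Testing with `∂ᵢφ` links consecutive weak derivatives of `f` directly, which is the only form in
-- which the product rule uses them.
lemma IsWeakDx.pd {α : Fin 3 → ℕ} {i : Fin 3} {f g h : E3 × Q → ℝ} (hg : IsWeakDx Ω μ α f g)
    (hh : IsWeakDx Ω μ (incr α i) f h) {φ : E3 × Q → ℝ} (hφ : IsTest Ω φ) :
    ∫ p, g p * pd i φ p ∂μ = -∫ p, h p * φ p ∂μ := by
  have h1 := hg.2.2 _ (hφ.pd i).1 (hφ.pd i).2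
  rw [dx_pd α i fun q => (hφ.smoothX _).contDiff q, hh.2.2 φ hφ.1 hφ.2, order_incr, pow_succ,
    mul_assoc] at h1
  have := mul_left_cancel₀ (pow_ne_zero _ (by norm_num)) h1
  linarith

omit [ProperSpace Q] [BorelSpace Q] in
lemma integrable_mul_test [OpensMeasurableSpace (E3 × Q)] {f : E3 × Q → ℝ} (hf : Integrable f μ)
    {φ : E3 × Q → ℝ} (hφ : IsTest Ω φ) : Integrable (fun p => f p * φ p) μ := by
  obtain ⟨C, hC⟩ := hφ.compact.exists_bound_of_continuous hφ.continuous
  exact hf.mul_bdd hφ.continuous.aestronglyMeasurable (.of_forall hC)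

omit [ProperSpace Q] [BorelSpace Q] in
lemma IsWeakDx.add [OpensMeasurableSpace (E3 × Q)] {α : Fin 3 → ℕ} {f g f' g' : E3 × Q → ℝ}
    (h : IsWeakDx Ω μ α f g) (h' : IsWeakDx Ω μ α f' g') : IsWeakDx Ω μ α (f + f') (g + g') := by
  refine ⟨h.1.add h'.1, h.2.1.add h'.2.1, fun φ hφ hs => ?_⟩
  have ht : IsTest Ω φ := ⟨hφ, hs⟩
  simp only [Pi.add_apply, add_mul]
  rw [integral_add (integrable_mul_test h.1 (ht.dx α)) (integrable_mul_test h'.1 (ht.dx α)),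
    integral_add (integrable_mul_test h.2.1 ht) (integrable_mul_test h'.2.1 ht), mul_add,
    h.2.2 φ hφ hs, h'.2.2 φ hφ hs]

omit [ProperSpace Q] [BorelSpace Q] in
lemma IsWeakDx.neg {α : Fin 3 → ℕ} {f g : E3 × Q → ℝ}
    (h : IsWeakDx Ω μ α f g) : IsWeakDx Ω μ α (-f) (-g) := by
  refine ⟨h.1.neg, h.2.1.neg, fun φ hφ hs => ?_⟩
  simp [neg_mul, integral_neg, h.2.2 φ hφ hs]

omit [ProperSpace Q] [BorelSpace Q] in
lemma IsWeakDx.sub [OpensMeasurableSpace (E3 × Q)] {α : Fin 3 → ℕ} {f g f' g' : E3 × Q → ℝ}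
    (h : IsWeakDx Ω μ α f g) (h' : IsWeakDx Ω μ α f' g') : IsWeakDx Ω μ α (f - f') (g - g') := by
  rw [sub_eq_add_neg, sub_eq_add_neg]
  exact h.add h'.neg

omit [ProperSpace Q] [BorelSpace Q] in
lemma isWeakDx_zero {f : E3 × Q → ℝ} (h : Integrable f μ) : IsWeakDx Ω μ 0 f f :=
  ⟨h, h, fun φ _ _ => by simp [order, dx_zero]⟩

/-- Weak derivatives realising a norm of the form `max_{|α| ≤ m} N(∂ₓ^α f)`. -/
lemma exists_weak_family_of_lt_top [IsFiniteMeasureOnCompacts μ] (hΩ : IsOpen Ω)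
    (hμ : ∀ᵐ p ∂μ, p ∈ Ω) {m : ℕ} {f : E3 × Q → ℝ} (N : (E3 × Q → ℝ) → ℝ≥0∞)
    (hN : ∀ g h : E3 × Q → ℝ, g =ᵐ[μ] h → N g = N h) {a : ℝ≥0∞} (ha : a < ∞)
    (h : (⨆ α ∈ multiIdx m, ⨅ (g : E3 × Q → ℝ) (_ : IsWeakDx Ω μ α f g), N g) ≤ a) :
    ∃ G : (Fin 3 → ℕ) → E3 × Q → ℝ, ∀ b, order b ≤ m → IsWeakDx Ω μ b f (G b) ∧ N (G b) ≤ a := by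
  have : ∀ b, ∃ g : E3 × Q → ℝ, order b ≤ m → IsWeakDx Ω μ b f g ∧ N g ≤ a := by
    intro b
    by_cases hb : order b ≤ m
    · have hle := (le_iSup₂ (f := fun b (_ : b ∈ multiIdx m) => ⨅ (g : E3 × Q → ℝ)
          (_ : IsWeakDx Ω μ b f g), N g) b (mem_multiIdx.2 hb)).trans h
      -- If no weak derivative existed, the infimum would be over an empty family and equal `∞`.
      obtain ⟨g, hg⟩ : ∃ g, IsWeakDx Ω μ b f g := by
        by_contra! hcon
        have : (⨅ (g : E3 × Q → ℝ) (_ : IsWeakDx Ω μ b f g), N g) = ∞ := by simp [hcon]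
        rw [this] at hle
        exact absurd ha (not_lt.2 hle)
      -- Weak derivatives agree almost everywhere, so `N` is constant on them and any one realises
      -- the infimum.
      refine ⟨g, fun _ => ⟨hg, le_trans (le_iInf₂ fun g' hg' => ?_) hle⟩⟩
      rw [hN _ _ (hg.ae_eq hΩ hμ hg')]
    · exact ⟨0, fun h => absurd h hb⟩
  choose G hG using this
  exact ⟨G, hG⟩

end Weak

end Transport

end

noncomputable section

namespace Transport

/-! ### Smooth functions vanishing near the inflow boundary -/

section Spaces

variable {D : Domain} {m : ℕ}

lemma isOpen_phase (D : Domain) : IsOpen D.phase :=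
  D.isOpen.prod (isOpen_univ.prod isOpen_Ioo)

lemma isOpen_kphase (D : Domain) : IsOpen D.kphase :=
  D.isOpen.prod (isOpen_univ.prod (isOpen_univ.prod isOpen_Ioo))

lemma ae_mem_kphase (D : Domain) : ∀ᵐ p ∂D.κ, p ∈ D.kphase :=
  ae_restrict_mem (isOpen_kphase D).measurableSet

lemma volume_G_lt_top (D : Domain) : volume D.G < ∞ := D.isBounded.measure_lt_top

instance (D : Domain) : IsFiniteMeasure D.μ := by
  refine ⟨?_⟩
  rw [Domain.μ, Measure.restrict_apply_univ, Domain.phase, Measure.prod_prod, Measure.prod_prod]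
  exact ENNReal.mul_lt_top (volume_G_lt_top D)
    (ENNReal.mul_lt_top (measure_lt_top _ _) (by simp))

instance : SigmaFinite (sphereMeasure.prod (volume : Measure ℝ)) := Measure.prod.instSigmaFinite

instance : SigmaFinite (sphereMeasure.prod (sphereMeasure.prod (volume : Measure ℝ))) :=
  Measure.prod.instSigmaFinite

instance (D : Domain) : IsFiniteMeasure D.κ := by
  refine ⟨?_⟩
  rw [Domain.κ, Measure.restrict_apply_univ, Domain.kphase, Measure.prod_prod, Measure.prod_prod,
    Measure.prod_prod]
  exact ENNReal.mul_lt_top (volume_G_lt_top D) (ENNReal.mul_lt_top (measure_lt_top _ _)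
    (ENNReal.mul_lt_top (measure_lt_top _ _) (by simp)))

lemma exists_smooth_ext (ψ : C0 D) (k : ℕ) :
    ∃ f : Phase → ℝ, SmoothX k f ∧ HasCompactSupport f ∧ EqOn ψ.1 f D.phase := by
  obtain ⟨f, hf, ef⟩ := exists_ext ψ k
  exact ⟨f, (isCx_iff.1 hf).1, (isCx_iff.1 hf).2, ef⟩

lemma mem_C0_of {ψ : Phase → ℝ}
    (h : ∀ k : ℕ, ∃ f : Phase → ℝ, SmoothX k f ∧ HasCompactSupport f ∧ EqOn ψ f D.phase)
    (h' : AvoidsInflow D ψ) : ψ ∈ C0 D := by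
  refine ⟨fun k _ => ?_, h'⟩
  obtain ⟨f, h1, h2, h3⟩ := h k
  exact ⟨f, isCx_iff.2 ⟨h1, h2⟩, h3⟩

lemma AvoidsInflow.of_support {F : Type*} [NormedAddCommGroup F] {ψ : Phase → F} {χ : Phase → ℝ} (h : AvoidsInflow D ψ)
    (hs : ∀ p ∈ D.phase, p ∉ closure (Function.support ψ ∩ D.phase) → χ p = 0) :
    AvoidsInflow D χ := by
  refine h.mono_left (closure_minimal (fun p hp => ?_) isClosed_closure)
  by_contra hn
  exact hp.1 (hs p hp.2 hn)

lemma eq_zero_of_notMem_closure_support {F : Type*} [NormedAddCommGroup F] {ψ : Phase → F} {p : Phase} (hp : p ∈ D.phase)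
    (hn : p ∉ closure (Function.support ψ ∩ D.phase)) : ψ p = 0 := by
  by_contra h
  exact hn (subset_closure ⟨h, hp⟩)

/-- The partial derivative of a smooth function vanishing near the inflow boundary. -/
def pdC0 (i : Fin 3) (ψ : C0 D) : C0 D :=
  ⟨pd i ψ.1, mem_C0_of (fun k => by
    obtain ⟨f, h1, h2, h3⟩ := exists_smooth_ext ψ (k + 1)
    exact ⟨pd i f, h1.pderiv i, hasCompactSupport_pd h2 i, pd_congr D.isOpen h3 i⟩)
    (ψ.2.2.of_support fun p hp hn => pd_eq_zero_of_isOpen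
      ((isOpen_phase D).inter isClosed_closure.isOpen_compl) (fun q hq =>
        eq_zero_of_notMem_closure_support hq.1 hq.2) i p ⟨hp, hn⟩)⟩

/-- Iterated partial derivatives on `C0 D`, along a word. -/
def dxwC0 : List (Fin 3) → C0 D → C0 D
  | [], ψ => ψ
  | i :: w, ψ => dxwC0 w (pdC0 i ψ)

lemma coe_dxwC0 (w : List (Fin 3)) (ψ : C0 D) : (dxwC0 w ψ).1 = dxw w ψ.1 := by
  induction w generalizing ψ with
  | nil => rfl
  | cons i w ih => exact ih _

/-- The derivative `∂ₓ^α` on `C0 D`. -/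
def dxC0 (α : Fin 3 → ℕ) (ψ : C0 D) : C0 D := dxwC0 (word α) ψ

lemma coe_dxC0 (α : Fin 3 → ℕ) (ψ : C0 D) : (dxC0 α ψ).1 = dx α ψ.1 := by
  rw [dxC0, coe_dxwC0, dx_eq_dxw]

lemma pd_dx_eqOn (α : Fin 3 → ℕ) (i : Fin 3) (ψ : C0 D) :
    EqOn (pd i (dx α ψ.1)) (dx (incr α i) ψ.1) D.phase := by
  obtain ⟨f, h1, -, h3⟩ := exists_smooth_ext ψ (order α + 1)
  intro p hp
  rw [pd_congr D.isOpen (dx_congr D α h3) i hp, dx_congr D _ h3 hp,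
    ← dx_pd α i fun q => h1.contDiff q, dx_eq_dxw, dx_eq_dxw,
    dxw_pd (word α) i (by rwa [length_word])]

/-- Multiplication by a continuous function of `(ω, E)`. -/
def paramMulC0 (a : S2 × ℝ → ℝ) (ha : Continuous a) (ψ : C0 D) : C0 D :=
  ⟨fun p => a p.2 * ψ.1 p, mem_C0_of (fun k => by
    obtain ⟨f, h1, h2, h3⟩ := exists_smooth_ext ψ k
    exact ⟨fun p => a p.2 * f p, (smoothX_of_param ha k).mul h1, h2.mul_left,
      fun p hp => by simp only [h3 hp]⟩)
    (ψ.2.2.of_support fun p hp hn => by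
      simp [eq_zero_of_notMem_closure_support hp hn])⟩

lemma streaming_eq_sum (f : Phase → ℝ) (p : Phase) :
    streaming f p = ∑ i, (p.2.1 : E3) i * pd i f p := by
  rw [streaming, fderiv_eq_linOf, linOf_apply]
  rfl

/-- The streaming term on `C0 D`. -/
def streamC0 (ψ : C0 D) : C0 D :=
  ∑ i, paramMulC0 (fun q => (q.1 : E3) i) (by fun_prop) (pdC0 i ψ)

lemma coe_streamC0 (ψ : C0 D) : (streamC0 ψ).1 = streaming ψ.1 := by
  funext p
  rw [streaming_eq_sum, streamC0]
  simp [paramMulC0, pdC0]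

lemma memLp_C0 (ψ : C0 D) : MemLp ψ.1 2 D.μ := memLp_dx (m := 0) ψ (zeroIdx 0)

lemma jet_apply (ψ : C0 D) (α : multiIdx m) :
    ((jet D m ψ) α : Lp ℝ 2 D.μ) =ᵐ[D.μ] dx α.1 ψ.1 := (memLp_dx ψ α).coeFn_toLp

lemma toFn_incl (ψ : C0 D) : toFn (incl D m ψ) =ᵐ[D.μ] ψ.1 := jet_apply ψ (zeroIdx m)

lemma coe_incl (ψ : C0 D) : (incl D m ψ : Jets D m) = jet D m ψ := rfl

lemma jet_congr {ψ χ : C0 D} (h : EqOn ψ.1 χ.1 D.phase) : jet D m ψ = jet D m χ := by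
  refine PiLp.ext fun α => Lp.ext ?_
  filter_upwards [jet_apply ψ α, jet_apply χ α, ae_mem_phase D] with p h1 h2 hp
  rw [h1, h2, dx_congr D α.1 h hp]

lemma incl_congr {ψ χ : C0 D} (h : EqOn ψ.1 χ.1 D.phase) : incl D m ψ = incl D m χ :=
  Subtype.ext (jet_congr h)

lemma memLp_test {φ : Phase → ℝ} (hφ : IsTest D.phase φ) : MemLp φ 2 D.μ :=
  (hφ.continuous.memLp_of_hasCompactSupport hφ.compact (μ := (volume : Measure E3).prod
    (sphereMeasure.prod (volume : Measure ℝ)))).restrict D.phase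

lemma integrable_Lp (u : Lp ℝ 2 D.μ) : Integrable u D.μ :=
  (Lp.memLp u).integrable (by norm_num)

lemma integral_mul_eq_inner (u : Lp ℝ 2 D.μ) {φ : Phase → ℝ} (hφ : MemLp φ 2 D.μ) :
    ∫ p, u p * φ p ∂D.μ = inner ℝ (hφ.toLp φ) u := by
  rw [L2.inner_def]
  refine integral_congr_ae ?_
  filter_upwards [hφ.coeFn_toLp] with p hp
  simp [hp]

lemma continuous_integral_mul {φ : Phase → ℝ} (hφ : MemLp φ 2 D.μ) :
    Continuous fun u : Lp ℝ 2 D.μ => ∫ p, u p * φ p ∂D.μ := by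
  simp only [integral_mul_eq_inner _ hφ]
  exact continuous_const.inner continuous_id

lemma continuous_component (α : multiIdx m) : Continuous fun U : Jets D m => U α :=
  PiLp.continuous_apply 2 _ α

lemma integral_C0_mul_dx (ψ : C0 D) (α : Fin 3 → ℕ) {φ : Phase → ℝ} (hφ : IsTest D.phase φ) :
    ∫ p, ψ.1 p * dx α φ p ∂D.μ = (-1) ^ order α * ∫ p, dx α ψ.1 p * φ p ∂D.μ := by
  obtain ⟨f, h1, -, h3⟩ := exists_smooth_ext ψ (order α)
  exact setIntegral_mul_dx D.isOpen α h1 h3 hφ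

lemma integral_C0_mul_pd (ψ : C0 D) (i : Fin 3) {φ : Phase → ℝ} (hφ : IsTest D.phase φ) :
    ∫ p, ψ.1 p * pd i φ p ∂D.μ = -∫ p, pd i ψ.1 p * φ p ∂D.μ := by
  obtain ⟨f, h1, -, h3⟩ := exists_smooth_ext ψ 1
  exact setIntegral_mul_pd D.isOpen h1 h3 hφ i

/-- The components of an element of `H₀` are the weak derivatives of the underlying function. -/
lemma isWeakDx_component (u : H0 D m) (α : multiIdx m) :
    IsWeakDx D.phase D.μ α.1 (toFn u) (u.1 α : Lp ℝ 2 D.μ) := by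
  refine ⟨integrable_Lp _, integrable_Lp _, fun φ h1 h2 => ?_⟩
  have hφ : IsTest D.phase φ := ⟨h1, h2⟩
  -- For a fixed test function both sides are continuous in the jet, so it suffices to check the
  -- jets of smooth functions, where the identity is classical.
  have hcl : IsClosed {U : Jets D m | ∫ p, (U (zeroIdx m) : Lp ℝ 2 D.μ) p * dx α.1 φ p ∂D.μ =
      (-1) ^ order α.1 * ∫ p, (U α : Lp ℝ 2 D.μ) p * φ p ∂D.μ} :=
    isClosed_eq ((continuous_integral_mul (memLp_test (hφ.dx α.1))).comp (continuous_component _))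
      (((continuous_integral_mul (memLp_test hφ)).comp (continuous_component _)).const_mul _)
  refine closure_minimal ?_ hcl u.2
  rintro _ ⟨ψ, rfl⟩
  simp only [mem_ofPred_eq]
  have e0 : ∫ p, ((jet D m ψ) (zeroIdx m) : Lp ℝ 2 D.μ) p * dx α.1 φ p ∂D.μ =
      ∫ p, ψ.1 p * dx α.1 φ p ∂D.μ := integral_congr_ae <| by
    filter_upwards [jet_apply ψ (zeroIdx m)] with p hp
    rw [hp]; rfl
  have e1 : ∫ p, ((jet D m ψ) α : Lp ℝ 2 D.μ) p * φ p ∂D.μ =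
      ∫ p, dx α.1 ψ.1 p * φ p ∂D.μ := integral_congr_ae <| by
    filter_upwards [jet_apply ψ α] with p hp
    rw [hp]
  rw [e0, e1, integral_C0_mul_dx ψ α.1 hφ]

/-- All components are weak derivatives of the zeroth one, and weak derivatives are unique.
Identities between operators on `H0` can thus be checked on underlying functions. -/
lemma toFn_injective {u v : H0 D m} (h : toFn u =ᵐ[D.μ] toFn v) : u = v := by
  refine Subtype.ext (PiLp.ext fun α => Lp.ext ?_)
  refine (isWeakDx_component u α).ae_eq (isOpen_phase D) (ae_mem_phase D) ?_
  obtain ⟨-, h2, h3⟩ := isWeakDx_component v α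
  refine ⟨integrable_Lp _, h2, fun φ hφ hs => ?_⟩
  rw [← h3 φ hφ hs]
  refine integral_congr_ae ?_
  filter_upwards [h] with p hp
  rw [hp]

lemma toFn_add (u v : H0 D m) : toFn (u + v) =ᵐ[D.μ] toFn u + toFn v :=
  Lp.coeFn_add (u.1 (zeroIdx m)) (v.1 (zeroIdx m))

lemma toFn_sub (u v : H0 D m) : toFn (u - v) =ᵐ[D.μ] toFn u - toFn v :=
  Lp.coeFn_sub (u.1 (zeroIdx m)) (v.1 (zeroIdx m))

lemma toFn_smul (c : ℝ) (u : H0 D m) : toFn (c • u) =ᵐ[D.μ] c • toFn u :=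
  Lp.coeFn_smul c (u.1 (zeroIdx m))

lemma dense_range_incl (D : Domain) (m : ℕ) : DenseRange (incl D m) := by
  intro u
  rw [closure_subtype]
  have : Subtype.val '' range (incl D m) = (LinearMap.range (jet D m) : Set (Jets D m)) := by
    ext U
    simp only [mem_image, mem_range, exists_exists_eq_and]
    rfl
  rw [this]
  exact u.2

/-- The streaming operator with values in `H₀`, as a linear map. -/
def streamH0 (D : Domain) (m : ℕ) : C0 D →ₗ[ℝ] H0 D m where
  toFun ψ := incl D m (streamC0 ψ)
  map_add' ψ χ := by
    rw [← map_add]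
    refine incl_congr fun p hp => ?_
    obtain ⟨f, hf, -, ef⟩ := exists_smooth_ext ψ 1
    obtain ⟨g, hg, -, eg⟩ := exists_smooth_ext χ 1
    have e : EqOn (ψ + χ).1 (f + g) D.phase := fun p hp => by simp [ef hp, eg hp]
    have h : (streamC0 ψ + streamC0 χ).1 p = streaming ψ.1 p + streaming χ.1 p := by
      rw [← coe_streamC0, ← coe_streamC0]; rfl
    rw [coe_streamC0, h]
    simp only [streaming_eq_sum]
    rw [← Finset.sum_add_distrib]
    refine Finset.sum_congr rfl fun i _ => ?_
    rw [pd_congr D.isOpen e i hp, pd_congr D.isOpen ef i hp, pd_congr D.isOpen eg i hp,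
      pd_add hf hg]
    simp [mul_add]
  map_smul' c ψ := by
    rw [RingHom.id_apply, ← map_smul]
    refine incl_congr fun p hp => ?_
    obtain ⟨f, hf, -, ef⟩ := exists_smooth_ext ψ 1
    have e : EqOn (c • ψ).1 (fun p => (c • ContinuousLinearMap.id ℝ ℝ) (f p)) D.phase :=
      fun p hp => by simp [ef hp]
    have h : (c • streamC0 ψ).1 p = c * streaming ψ.1 p := by
      rw [← coe_streamC0]; rfl
    rw [coe_streamC0, h]
    simp only [streaming_eq_sum]
    rw [Finset.mul_sum]
    refine Finset.sum_congr rfl fun i _ => ?_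
    rw [pd_congr D.isOpen e i hp, pd_congr D.isOpen ef i hp, pd_clm _ hf]
    simp
    ring

lemma streamH0_apply (ψ : C0 D) : streamH0 D m ψ = incl D m (streamC0 ψ) := rfl

lemma toFn_streamH0 (ψ : C0 D) : toFn (streamH0 D m ψ) =ᵐ[D.μ] streaming ψ.1 := by
  rw [streamH0_apply, ← coe_streamC0]
  exact toFn_incl _

lemma memLp_streaming_test {φ : Phase → ℝ} (h : IsTest D.phase φ) : MemLp (streaming φ) 2 D.μ := by
  have : streaming φ = fun p => ∑ i, (p.2.1 : E3) i * pd i φ p := funext (streaming_eq_sum φ)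
  rw [this]
  refine memLp_finsetSum _ fun i _ => ?_
  have : MemLp (fun p : Phase => (p.2.1 : E3) i * pd i φ p) 2 ((volume : Measure E3).prod
    (sphereMeasure.prod (volume : Measure ℝ))) :=
    Continuous.memLp_of_hasCompactSupport (by have := (h.pd i).continuous; fun_prop)
      (h.pd i).compact.mul_left
  exact this.restrict _

/-- Each coordinate of `ω` is constant in `x`, so it can be absorbed into `ψ` without leaving `C0
D`; parts are then taken one coordinate at a time. -/
lemma integral_C0_mul_streaming (ψ : C0 D) {φ : Phase → ℝ} (hφ : IsTest D.phase φ) :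
    ∫ p, ψ.1 p * streaming φ p ∂D.μ = -∫ p, streaming ψ.1 p * φ p ∂D.μ := by
  have hi : ∀ χ : C0 D, Integrable χ.1 D.μ := fun χ => (memLp_C0 χ).integrable (by norm_num)
  simp only [streaming_eq_sum, Finset.mul_sum, Finset.sum_mul]
  rw [integral_finsetSum, integral_finsetSum, ← Finset.sum_neg_distrib]
  · refine Finset.sum_congr rfl fun i _ => ?_
    have h := integral_C0_mul_pd (paramMulC0 (fun q => (q.1 : E3) i) (by fun_prop) ψ) i hφ
    have e : EqOn (pd i (paramMulC0 (fun q => (q.1 : E3) i) (by fun_prop) ψ).1)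
        (fun p => (p.2.1 : E3) i * pd i ψ.1 p) D.phase := by
      obtain ⟨f, hf, -, ef⟩ := exists_smooth_ext ψ 1
      have e1 : EqOn (paramMulC0 (fun q => (q.1 : E3) i) (by fun_prop) ψ).1
          (fun p => (p.2.1 : E3) i * f p) D.phase := fun p hp => by
        simp [paramMulC0, ef hp]
      intro p hp
      rw [pd_congr D.isOpen e1 i hp]
      simp only [pd_congr D.isOpen ef i hp]
      have := (hf.hasFDerivAt p).const_mul ((p.2.1 : E3) i)
      simp only [pd, partialD]
      rw [this.fderiv]
      simp [linOf_single, pd, partialD]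
    calc _ = ∫ p, (paramMulC0 (fun q => (q.1 : E3) i) (by fun_prop) ψ).1 p * pd i φ p ∂D.μ :=
          integral_congr_ae (.of_forall fun p => by simp [paramMulC0]; ring)
      _ = _ := h
      _ = _ := by
        congr 1
        refine integral_congr_ae ?_
        filter_upwards [ae_mem_phase D] with p hp
        rw [e hp]
  · exact fun i _ => integrable_mul_test
      (hi (paramMulC0 (fun q => (q.1 : E3) i) (by fun_prop) (pdC0 i ψ))) hφ
  · intro i _
    refine (integrable_mul_test (hi (paramMulC0 (fun q => (q.1 : E3) i) (by fun_prop) ψ))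
      (hφ.pd i)).congr (.of_forall fun p => ?_)
    simp [paramMulC0]; ring

lemma toFn_streamH0_weak (ψ : C0 D) {φ : Phase → ℝ} (hφ : IsTest D.phase φ) :
    ∫ p, toFn (incl D m ψ) p * streaming φ p ∂D.μ =
      -∫ p, toFn (streamH0 D m ψ) p * φ p ∂D.μ := by
  have e1 : ∫ p, toFn (incl D m ψ) p * streaming φ p ∂D.μ = ∫ p, ψ.1 p * streaming φ p ∂D.μ :=
    integral_congr_ae (by filter_upwards [toFn_incl (m := m) ψ] with p hp; rw [hp])
  have e2 : ∫ p, toFn (streamH0 D m ψ) p * φ p ∂D.μ = ∫ p, streaming ψ.1 p * φ p ∂D.μ :=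
    integral_congr_ae (by filter_upwards [toFn_streamH0 (m := m) ψ] with p hp; rw [hp])
  rw [e1, e2, integral_C0_mul_streaming ψ hφ]

/-- The weak relation `d = ω · ∇ₓψ` is preserved by limits in `H₀`. -/
lemma isWeakStreaming_of_mem_closure {u v : H0 D m}
    (h : (u, v) ∈ closure (range fun ψ => (incl D m ψ, streamH0 D m ψ))) :
    IsWeakStreaming D (toFn u) (toFn v) := by
  intro φ h1 h2
  have hφ : IsTest D.phase φ := ⟨h1, h2⟩
  have hc : Continuous fun u : H0 D m => (u.1 (zeroIdx m) : Lp ℝ 2 D.μ) :=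
    (continuous_component _).comp continuous_subtype_val
  have hcl : IsClosed {w : H0 D m × H0 D m | ∫ p, toFn w.1 p * streaming φ p ∂D.μ =
      -∫ p, toFn w.2 p * φ p ∂D.μ} :=
    isClosed_eq ((continuous_integral_mul (memLp_streaming_test hφ)).comp (hc.comp continuous_fst))
      ((continuous_integral_mul (memLp_test hφ)).comp (hc.comp continuous_snd)).neg
  refine closure_minimal ?_ hcl h
  rintro _ ⟨ψ, rfl⟩
  exact toFn_streamH0_weak ψ hφ

/-- This is the source of closability: if smooth functions tend to zero and their streaming terms
converge, the limit is a weak streaming derivative of zero. -/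
lemma eq_zero_of_isWeakStreaming {v : H0 D m} {u : H0 D m} (hu : u = 0)
    (h : IsWeakStreaming D (toFn u) (toFn v)) : v = 0 := by
  have h0 : toFn u =ᵐ[D.μ] 0 := by
    subst hu
    exact Lp.coeFn_zero ℝ 2 D.μ
  have : toFn v =ᵐ[D.μ] 0 := by
    refine ae_eq_zero_of_forall_test (isOpen_phase D) (ae_mem_phase D) (integrable_Lp _)
      fun φ hφ => ?_
    have h2 := h φ hφ.1 hφ.2
    rw [integral_congr_ae (g := fun _ => (0 : ℝ)) (by filter_upwards [h0] with p hp; simp [hp]),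
      integral_zero] at h2
    exact neg_eq_zero.1 h2.symm
  refine toFn_injective ?_
  rw [hu] at h0
  exact this.trans h0.symm

end Spaces

end Transport

end

noncomputable section

namespace Transport

/-! ### Operators on jets built from the product rule -/

section Leibniz

variable {D : Domain} {m : ℕ}

/-- The component of index `c` of a jet, `0` if `|c| > m`. -/
def component (D : Domain) (m : ℕ) (c : Fin 3 → ℕ) : Jets D m →L[ℝ] Lp ℝ 2 D.μ :=
  if h : c ∈ multiIdx m then PiLp.proj 2 (fun _ : multiIdx m => Lp ℝ 2 D.μ) ⟨c, h⟩ else 0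

lemma norm_component_le (c : Fin 3 → ℕ) : ‖component D m c‖ ≤ 1 := by
  refine ContinuousLinearMap.opNorm_le_bound _ zero_le_one fun U => ?_
  unfold component
  split_ifs with h
  · simpa using PiLp.norm_apply_le U ⟨c, h⟩
  · simp

/-- The class in `L²` of a smooth function. -/
def classC0 (ψ : C0 D) : Lp ℝ 2 D.μ := (memLp_C0 ψ).toLp ψ.1

lemma coe_classC0 (ψ : C0 D) : classC0 ψ =ᵐ[D.μ] ψ.1 := (memLp_C0 ψ).coeFn_toLp

lemma classC0_congr {ψ χ : C0 D} (h : EqOn ψ.1 χ.1 D.phase) : classC0 ψ = classC0 χ := by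
  refine Lp.ext ?_
  filter_upwards [coe_classC0 ψ, coe_classC0 χ, ae_mem_phase D] with p h1 h2 hp
  rw [h1, h2, h hp]

lemma component_jet {c : Fin 3 → ℕ} (hc : order c ≤ m) (ψ : C0 D) :
    component D m c (jet D m ψ) = classC0 (dxC0 c ψ) := by
  refine Lp.ext ?_
  have h : c ∈ multiIdx m := mem_multiIdx.2 hc
  filter_upwards [jet_apply ψ ⟨c, h⟩, coe_classC0 (dxC0 c ψ)] with p h1 h2
  rw [h2, coe_dxC0, ← h1]
  simp [component, h]

variable (T : (Fin 3 → ℕ) → Lp ℝ 2 D.μ →L[ℝ] Lp ℝ 2 D.μ)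

/-- The derivative along a word of a bilinear expression `B(∂^b g, ∂^c u)`, expanded by the product
rule; here `T b = B(∂^b g, ·)`. -/
def leib (m : ℕ) : List (Fin 3) → (Fin 3 → ℕ) → (Fin 3 → ℕ) → Jets D m →L[ℝ] Lp ℝ 2 D.μ
  | [], b, c => (T b).comp (component D m c)
  | i :: w, b, c => leib m w (incr b i) c + leib m w b (incr c i)

/-- The operator on jets induced by `u ↦ B(g, u)` through the product rule. -/
def leibOp (m : ℕ) : Jets D m →L[ℝ] Jets D m :=
  ((PiLp.continuousLinearEquiv 2 ℝ fun _ : multiIdx m => Lp ℝ 2 D.μ).symm :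
    (multiIdx m → Lp ℝ 2 D.μ) →L[ℝ] Jets D m).comp
    (ContinuousLinearMap.pi fun α : multiIdx m => leib T m (word α.1) 0 0)

lemma leibOp_apply (U : Jets D m) (α : multiIdx m) : leibOp T m U α = leib T m (word α.1) 0 0 U :=
  rfl

lemma word_zero : word 0 = [] := rfl

lemma leibOp_zeroIdx (U : Jets D m) : leibOp T m U (zeroIdx m) = T 0 (U (zeroIdx m)) := by
  have h : (0 : Fin 3 → ℕ) ∈ multiIdx m := (zeroIdx m).2
  rw [leibOp_apply]
  simp only [zeroIdx, word_zero, leib, ContinuousLinearMap.comp_apply, component, h, dif_pos]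
  rfl

/-- Every letter of the word doubles the number of terms; each term is some `T b` after a projection
of norm at most one. -/
lemma norm_leib_le {N : ℝ} (hT : ∀ b, order b ≤ m → ‖T b‖ ≤ N) (w : List (Fin 3)) :
    ∀ b c, order b + w.length ≤ m → ‖leib T m w b c‖ ≤ 2 ^ w.length * N := by
  induction w with
  | nil =>
    intro b c h
    simp only [leib, List.length_nil, pow_zero, one_mul]
    refine (ContinuousLinearMap.opNorm_comp_le _ _).trans ?_
    exact (mul_le_of_le_one_right (norm_nonneg _) (norm_component_le c)).trans
      (hT b (by simpa using h))
  | cons i w ih =>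
    intro b c h
    simp only [leib, List.length_cons] at h ⊢
    refine (norm_add_le _ _).trans ?_
    have h1 := ih (incr b i) c (by rw [order_incr]; omega)
    have h2 := ih b (incr c i) (by omega)
    rw [pow_succ]
    linarith

/-- The constant in the bound for multiplication operators. -/
def leibConst (m : ℕ) : ℝ := (multiIdx m).card * 2 ^ m

lemma leibConst_pos (m : ℕ) : 0 < leibConst m := by
  have : 0 < (multiIdx m).card := Finset.card_pos.2 ⟨_, (zeroIdx m).2⟩
  unfold leibConst
  positivity

lemma norm_jets_le (U : Jets D m) : ‖U‖ ≤ ∑ α, ‖U α‖ := by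
  rw [PiLp.norm_eq_of_L2]
  refine Real.sqrt_le_iff.2 ⟨by positivity, ?_⟩
  exact Finset.sum_sq_le_sq_sum_of_nonneg fun i _ => norm_nonneg _

lemma norm_leibOp_le {N : ℝ} (hN : 0 ≤ N) (hT : ∀ b, order b ≤ m → ‖T b‖ ≤ N) :
    ‖leibOp T m‖ ≤ leibConst m * N := by
  have := leibConst_pos m
  refine ContinuousLinearMap.opNorm_le_bound _ (by positivity) fun U => ?_
  refine (norm_jets_le _).trans ?_
  have h : ∀ α : multiIdx m, ‖leibOp T m U α‖ ≤ 2 ^ m * N * ‖U‖ := by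
    intro α
    have hα := mem_multiIdx.1 α.2
    rw [leibOp_apply]
    refine (ContinuousLinearMap.le_opNorm _ _).trans ?_
    gcongr
    refine (norm_leib_le T hT (word α.1) 0 0 (by rw [length_word]; simpa [order] using hα)).trans ?_
    rw [length_word]
    gcongr
    norm_num
  refine (Finset.sum_le_sum fun α _ => h α).trans ?_
  simp [leibConst]
  ring_nf
  exact le_rfl

/-- The expansion is linear in the family `T`, so approximating the family approximates the induced
operator on jets. -/
lemma leib_sub (T' : (Fin 3 → ℕ) → Lp ℝ 2 D.μ →L[ℝ] Lp ℝ 2 D.μ) (w : List (Fin 3)) :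
    ∀ b c, leib (T - T') m w b c = leib T m w b c - leib T' m w b c := by
  induction w with
  | nil => intro b c; ext1 U; simp [leib]
  | cons i w ih => intro b c; simp only [leib, ih]; abel

lemma leibOp_sub (T' : (Fin 3 → ℕ) → Lp ℝ 2 D.μ →L[ℝ] Lp ℝ 2 D.μ) :
    leibOp (T - T') m = leibOp T m - leibOp T' m := by
  refine ContinuousLinearMap.ext fun U => PiLp.ext fun α => ?_
  have : (leibOp T m - leibOp T' m) U α = leibOp T m U α - leibOp T' m U α := rfl
  rw [this, leibOp_apply, leibOp_apply, leibOp_apply, leib_sub]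
  rfl

/-- The operators `T b = B(∂^b g, ·)` obey the product rule of first order, weakly, on smooth
functions. -/
def IsLeibniz (m : ℕ) : Prop :=
  ∀ (b : Fin 3 → ℕ) (i : Fin 3), order b + 1 ≤ m → ∀ (ψ : C0 D) (φ : Phase → ℝ),
    IsTest D.phase φ → ∫ p, T b (classC0 ψ) p * pd i φ p ∂D.μ =
      -∫ p, (T (incr b i) (classC0 ψ) + T b (classC0 (pdC0 i ψ))) p * φ p ∂D.μ

/-- `u ↦ B(g, u)` maps smooth functions that vanish near the inflow boundary to such functions. -/
def PreservesC0 : Prop := ∀ ψ : C0 D, ∃ χ : C0 D, T 0 (classC0 ψ) = classC0 χ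

variable {T}

/-- Derivatives are moved off the test function one letter at a time; each move applies the
first-order product rule once and so reproduces the recursion of `leib`. The total order never
exceeds `m`, where the rule is available. -/
lemma IsLeibniz.leib_weak (hT : IsLeibniz T m) (ψ : C0 D) (w : List (Fin 3)) :
    ∀ b c, order b + order c + w.length ≤ m → ∀ φ : Phase → ℝ, IsTest D.phase φ →
      ∫ p, T b (classC0 (dxC0 c ψ)) p * dxw w φ p ∂D.μ =
        (-1) ^ w.length * ∫ p, leib T m w b c (jet D m ψ) p * φ p ∂D.μ := by
  induction w with
  | nil =>
    intro b c h φ _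
    simp only [List.length_nil] at h
    simp [leib, dxw, component_jet (show order c ≤ m by omega)]
  | cons i w ih =>
    intro b c h φ hφ
    simp only [List.length_cons] at h
    simp only [dxw, leib]
    rw [dxw_pd w i (hφ.smoothX _), hT b i (by omega) _ _ (hφ.dxw w)]
    have e : classC0 (pdC0 i (dxC0 c ψ)) = classC0 (dxC0 (incr c i) ψ) := classC0_congr <| by
      rw [coe_dxC0]
      simp only [pdC0, coe_dxC0]
      exact pd_dx_eqOn c i ψ
    have h1 := ih (incr b i) c (by rw [order_incr]; omega) φ hφ
    have h2 := ih b (incr c i) (by rw [order_incr]; omega) φ hφ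
    have split : ∀ (u v : Lp ℝ 2 D.μ) (χ : Phase → ℝ), IsTest D.phase χ →
        ∫ p, (u + v) p * χ p ∂D.μ = ∫ p, u p * χ p ∂D.μ + ∫ p, v p * χ p ∂D.μ := by
      intro u v χ hχ
      rw [integral_mul_eq_inner _ (memLp_test hχ), integral_mul_eq_inner _ (memLp_test hχ),
        integral_mul_eq_inner _ (memLp_test hχ), inner_add_right]
    rw [e, split _ _ _ (hφ.dxw w), h1, h2, add_apply, split _ _ _ hφ,
      List.length_cons, pow_succ]
    ring

/-- The formal expansion and the classical derivative of `χ` have the same integrals against all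
test functions, hence coincide. -/
lemma IsLeibniz.leibOp_jet (hT : IsLeibniz T m) {ψ χ : C0 D} (h : T 0 (classC0 ψ) = classC0 χ) :
    leibOp T m (jet D m ψ) = jet D m χ := by
  refine PiLp.ext fun α => Lp.ext ?_
  have hα := mem_multiIdx.1 α.2
  refine EventuallyEq.trans ?_ (jet_apply χ α).symm
  refine ae_eq_of_forall_test (isOpen_phase D) (ae_mem_phase D) (integrable_Lp _)
    ((memLp_dx χ α).integrable (by norm_num)) fun φ hφ => ?_
  have h1 := hT.leib_weak ψ (word α.1) 0 0 (by rw [length_word]; simpa [order] using hα) φ hφ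
  have h0 : dxC0 0 ψ = ψ := rfl
  rw [h0, h, ← dx_eq_dxw, length_word] at h1
  have h2 : ∫ p, classC0 χ p * dx α.1 φ p ∂D.μ = ∫ p, χ.1 p * dx α.1 φ p ∂D.μ :=
    integral_congr_ae (by filter_upwards [coe_classC0 χ] with p hp; rw [hp])
  rw [h2, integral_C0_mul_dx χ α.1 hφ] at h1
  rw [leibOp_apply]
  exact (mul_left_cancel₀ (pow_ne_zero _ (by norm_num)) h1).symm

lemma IsLeibniz.mem_H0 (hT : IsLeibniz T m) (hC : PreservesC0 T) {U : Jets D m} (hU : U ∈ H0 D m) :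
    leibOp T m U ∈ H0 D m := by
  refine map_mem_closure (leibOp T m).continuous hU ?_
  rintro _ ⟨ψ, rfl⟩
  obtain ⟨χ, hχ⟩ := hC ψ
  exact ⟨χ, (hT.leibOp_jet hχ).symm⟩

/-- If the operators `T b` are limits of operators that obey the product rule and preserve `C0 D`,
then `T 0` induces a bounded operator on `H₀`. -/
lemma exists_operator_H0 {N : ℝ} (hN : 0 ≤ N) (hb : ∀ b, order b ≤ m → ‖T b‖ ≤ N)
    (h : ∀ ε > 0, ∃ T' : (Fin 3 → ℕ) → Lp ℝ 2 D.μ →L[ℝ] Lp ℝ 2 D.μ, IsLeibniz T' m ∧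
      PreservesC0 T' ∧ ∀ b, order b ≤ m → ‖T b - T' b‖ ≤ ε) :
    ∃ K : H0 D m →L[ℝ] H0 D m, ‖K‖ ≤ leibConst m * N ∧
      ∀ u : H0 D m, toFn (K u) =ᵐ[D.μ] T 0 (u.1 (zeroIdx m)) := by
  have hc := leibConst_pos m
  have hmem : ∀ U ∈ H0 D m, leibOp T m U ∈ H0 D m := by
    intro U hU
    have hcl : IsClosed (H0 D m : Set (Jets D m)) := Submodule.isClosed_topologicalClosure _
    change leibOp T m U ∈ (H0 D m : Set (Jets D m))
    rw [← hcl.closure_eq]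
    refine Metric.mem_closure_iff.2 fun ε hε => ?_
    -- The tolerance cancels the constant in `norm_leibOp_le`; adding one to `‖U‖` covers `U = 0`
    -- and makes the final inequality strict.
    obtain ⟨T', h1, h2, h3⟩ := h (ε / (leibConst m * (‖U‖ + 1))) (by positivity)
    refine ⟨leibOp T' m U, h1.mem_H0 h2 hU, ?_⟩
    rw [dist_eq_norm, ← sub_apply, ← leibOp_sub]
    refine (ContinuousLinearMap.le_opNorm _ _).trans_lt ?_
    have hle := norm_leibOp_le (T - T') (m := m)
      (N := ε / (leibConst m * (‖U‖ + 1))) (by positivity) h3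
    have e : leibConst m * (ε / (leibConst m * (‖U‖ + 1))) = ε / (‖U‖ + 1) := by
      field_simp
    rw [e] at hle
    calc ‖leibOp (T - T') m‖ * ‖U‖ ≤ ε / (‖U‖ + 1) * ‖U‖ := by gcongr
      _ < ε / (‖U‖ + 1) * (‖U‖ + 1) := by gcongr; linarith
      _ = ε := by field_simp
  refine ⟨((leibOp T m).comp (H0 D m).subtypeL).codRestrict (H0 D m) fun u => hmem u.1 u.2, ?_, ?_⟩
  · refine ContinuousLinearMap.opNorm_le_bound _ (by positivity) fun u => ?_
    exact (ContinuousLinearMap.le_opNorm (leibOp T m) u.1).trans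
      (mul_le_mul_of_nonneg_right (norm_leibOp_le T hN hb) (norm_nonneg _))
  · intro u
    have : toFn (((leibOp T m).comp (H0 D m).subtypeL).codRestrict (H0 D m)
      (fun u => hmem u.1 u.2) u) = (leibOp T m u.1 (zeroIdx m) : Lp ℝ 2 D.μ) := rfl
    rw [this, leibOp_zeroIdx]

end Leibniz

end Transport

end

noncomputable section

namespace Transport

/-! ### Multiplication operators -/

section Multipliers

variable {D : Domain} {m : ℕ}

/-- Linearity of `Φ` is asked only almost everywhere, which is what formulas evaluated on
representatives provide. -/
lemma exists_clm_of_ae {N : ℝ} (hN : 0 ≤ N) (Φ : Lp ℝ 2 D.μ → Phase → ℝ)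
    (hmeas : ∀ u, AEStronglyMeasurable (Φ u) D.μ)
    (hadd : ∀ u v, Φ (u + v) =ᵐ[D.μ] Φ u + Φ v)
    (hsmul : ∀ (c : ℝ) u, Φ (c • u) =ᵐ[D.μ] c • Φ u)
    (hb : ∀ u, eLpNorm (Φ u) 2 D.μ ≤ ENNReal.ofReal N * eLpNorm u 2 D.μ) :
    ∃ T : Lp ℝ 2 D.μ →L[ℝ] Lp ℝ 2 D.μ, ‖T‖ ≤ N ∧ ∀ u, T u =ᵐ[D.μ] Φ u := by
  have hmem : ∀ u, MemLp (Φ u) 2 D.μ := fun u =>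
    ⟨hmeas u, (hb u).trans_lt (ENNReal.mul_lt_top ENNReal.ofReal_lt_top (Lp.memLp u).2)⟩
  let L : Lp ℝ 2 D.μ →ₗ[ℝ] Lp ℝ 2 D.μ :=
    { toFun := fun u => (hmem u).toLp (Φ u)
      map_add' := fun u v => by
        rw [← MemLp.toLp_add, MemLp.toLp_eq_toLp_iff]
        exact hadd u v
      map_smul' := fun c u => by
        rw [RingHom.id_apply, ← MemLp.toLp_const_smul, MemLp.toLp_eq_toLp_iff]
        exact hsmul c u }
  have hL : ∀ u, ‖L u‖ ≤ N * ‖u‖ := by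
    intro u
    have h1 : ‖L u‖ = (eLpNorm (Φ u) 2 D.μ).toReal := Lp.norm_toLp _ (hmem u)
    rw [h1, Lp.norm_def]
    refine (ENNReal.toReal_mono (ENNReal.mul_lt_top ENNReal.ofReal_lt_top (Lp.memLp u).2).ne
      (hb u)).trans ?_
    rw [ENNReal.toReal_mul, ENNReal.toReal_ofReal hN]
  exact ⟨L.mkContinuous N hL, L.mkContinuous_norm_le hN hL, fun u => (hmem u).coeFn_toLp⟩

lemma opNorm_le_of_ae {N : ℝ} (hN : 0 ≤ N) {T : Lp ℝ 2 D.μ →L[ℝ] Lp ℝ 2 D.μ}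
    (hb : ∀ u, eLpNorm (T u) 2 D.μ ≤ ENNReal.ofReal N * eLpNorm u 2 D.μ) : ‖T‖ ≤ N := by
  refine ContinuousLinearMap.opNorm_le_bound _ hN fun u => ?_
  rw [Lp.norm_def, Lp.norm_def]
  refine (ENNReal.toReal_mono (ENNReal.mul_lt_top ENNReal.ofReal_lt_top (Lp.memLp u).2).ne
    (hb u)).trans ?_
  rw [ENNReal.toReal_mul, ENNReal.toReal_ofReal hN]

lemma eLpNorm_mul_le {g : Phase → ℝ} {N : ℝ}
    (hb : eLpNorm g ∞ D.μ ≤ ENNReal.ofReal N) (u : Lp ℝ 2 D.μ) :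
    eLpNorm (fun p => g p * u p) 2 D.μ ≤ ENNReal.ofReal N * eLpNorm u 2 D.μ := by
  have := eLpNorm_smul_le_eLpNorm_top_mul_eLpNorm (p := 2) (f := u) (φ := g)
    (Lp.aestronglyMeasurable u)
  exact this.trans (mul_le_mul_left hb _)

lemma exists_mulOp {g : Phase → ℝ} {N : ℝ} (hN : 0 ≤ N) (hg : AEStronglyMeasurable g D.μ)
    (hb : eLpNorm g ∞ D.μ ≤ ENNReal.ofReal N) :
    ∃ T : Lp ℝ 2 D.μ →L[ℝ] Lp ℝ 2 D.μ, ‖T‖ ≤ N ∧ ∀ u, T u =ᵐ[D.μ] fun p => g p * u p := by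
  refine exists_clm_of_ae hN (fun u p => g p * u p) (fun u => hg.mul (Lp.aestronglyMeasurable u))
    (fun u v => ?_) (fun c u => ?_) (eLpNorm_mul_le hb)
  · filter_upwards [Lp.coeFn_add u v] with p hp
    rw [hp]
    exact mul_add _ _ _
  · filter_upwards [Lp.coeFn_smul c u] with p hp
    simp [hp]
    ring

/-- The product rule for `ψφ`, where `φ` is a test function. -/
lemma pd_mul_test {Q : Type*} [MetricSpace Q] {G : Set E3} (hG : IsOpen G) {V : Set Q}
    {ψ f φ : E3 × Q → ℝ} (hf : SmoothX 1 f)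
    (ef : EqOn ψ f (G ×ˢ V)) (hφ : IsTest (G ×ˢ V) φ) (i : Fin 3) :
    EqOn (pd i (ψ * φ)) (fun p => pd i ψ p * φ p + ψ p * pd i φ p) (G ×ˢ V) := by
  have e : EqOn (ψ * φ) (f * φ) (G ×ˢ V) := fun p hp => by simp [ef hp]
  intro p hp
  rw [pd_congr hG e i hp, pd_mul hf (hφ.smoothX 1)]
  simp [pd_congr hG ef i hp, ef hp]

variable {f : Phase → ℝ} {G : (Fin 3 → ℕ) → Phase → ℝ}
  {T : (Fin 3 → ℕ) → Lp ℝ 2 D.μ →L[ℝ] Lp ℝ 2 D.μ}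

/-- `ψφ` is itself a test function: testing the relation between consecutive weak derivatives with
it and expanding `∂ᵢ(ψφ)` gives the rule. -/
lemma isLeibniz_mul (hG : ∀ b, order b ≤ m → IsWeakDx D.phase D.μ b f (G b))
    (hT : ∀ b, order b ≤ m → ∀ u, T b u =ᵐ[D.μ] fun p => G b p * u p) : IsLeibniz T m := by
  intro b i hb ψ φ hφ
  have hb' : order (incr b i) ≤ m := by rw [order_incr]; exact hb
  have hψφ : IsTest D.phase (ψ.1 * φ) := hφ.mul_left fun k => by
    obtain ⟨f, h1, -, h3⟩ := exists_smooth_ext ψ k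
    exact ⟨f, h1, h3⟩
  have hψφ' : IsTest D.phase ((pdC0 i ψ).1 * φ) := hφ.mul_left fun k => by
    obtain ⟨f, h1, -, h3⟩ := exists_smooth_ext (pdC0 i ψ) k
    exact ⟨f, h1, h3⟩
  have hψφ'' : IsTest D.phase (ψ.1 * pd i φ) := (hφ.pd i).mul_left fun k => by
    obtain ⟨f, h1, -, h3⟩ := exists_smooth_ext ψ k
    exact ⟨f, h1, h3⟩
  obtain ⟨f1, hf1, -, ef1⟩ := exists_smooth_ext ψ 1
  have key := (hG b (by omega)).pd (hG _ hb') hψφ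
  have e1 : ∫ p, T b (classC0 ψ) p * pd i φ p ∂D.μ = ∫ p, G b p * (ψ.1 * pd i φ) p ∂D.μ :=
    integral_congr_ae <| by
      filter_upwards [hT b (by omega) (classC0 ψ), coe_classC0 ψ] with p h1 h2
      rw [h1, h2, Pi.mul_apply]; ring
  have e2 : ∫ p, (T (incr b i) (classC0 ψ) + T b (classC0 (pdC0 i ψ))) p * φ p ∂D.μ =
      ∫ p, (G (incr b i) p * (ψ.1 * φ) p + G b p * ((pdC0 i ψ).1 * φ) p) ∂D.μ :=
    integral_congr_ae <| by
      filter_upwards [hT b (by omega) (classC0 (pdC0 i ψ)), coe_classC0 ψ, hT _ hb' (classC0 ψ),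
        coe_classC0 (pdC0 i ψ), Lp.coeFn_add (T (incr b i) (classC0 ψ))
          (T b (classC0 (pdC0 i ψ)))] with p h1 h2 h3 h4 h5
      rw [h5, Pi.add_apply, h1, h3, h2, h4, Pi.mul_apply, Pi.mul_apply]; ring
  have e3 : ∫ p, G b p * pd i (ψ.1 * φ) p ∂D.μ =
      ∫ p, (G b p * ((pdC0 i ψ).1 * φ) p + G b p * (ψ.1 * pd i φ) p) ∂D.μ :=
    integral_congr_ae <| by
      filter_upwards [ae_mem_phase D] with p hp
      rw [pd_mul_test D.isOpen hf1 ef1 hφ i hp]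
      simp [pdC0]; ring
  rw [e3, integral_add (integrable_mul_test (hG b (by omega)).2.1 hψφ')
    (integrable_mul_test (hG b (by omega)).2.1 hψφ'')] at key
  rw [e1, e2, integral_add (integrable_mul_test (hG _ hb').2.1 hψφ)
    (integrable_mul_test (hG b (by omega)).2.1 hψφ')]
  linarith

lemma preservesC0_mul (hf : IsCxBar D ⊤ f)
    (hT : ∀ u, T 0 u =ᵐ[D.μ] fun p => f p * u p) : PreservesC0 T := by
  intro ψ
  obtain ⟨F, hF, eF⟩ := hf
  refine ⟨⟨f * ψ.1, mem_C0_of (fun k => ?_) (ψ.2.2.of_support fun p hp hn => ?_)⟩, Lp.ext ?_⟩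
  · obtain ⟨h, h1, h2, h3⟩ := exists_smooth_ext ψ k
    exact ⟨F * h, ((isCx_top_iff.1 hF).1 k).mul h1, h2.mul_left, fun p hp => by
      simp [eF hp, h3 hp]⟩
  · simp [eq_zero_of_notMem_closure_support hp hn]
  · refine (hT _).trans (EventuallyEq.trans ?_ (coe_classC0 _).symm)
    filter_upwards [coe_classC0 ψ] with p hp
    rw [hp]; rfl

lemma exists_weak_family {f : Phase → ℝ} (h : wNorm D m f < ∞) :
    ∃ G : (Fin 3 → ℕ) → Phase → ℝ, ∀ b, order b ≤ m →
      IsWeakDx D.phase D.μ b f (G b) ∧ eLpNorm (G b) ∞ D.μ ≤ wNorm D m f :=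
  exists_weak_family_of_lt_top (isOpen_phase D) (ae_mem_phase D) (fun g => eLpNorm g ∞ D.μ)
    (fun _ _ h => eLpNorm_congr_ae h) h le_rfl

lemma wNorm_lt_top {f : Phase → ℝ} {G : (Fin 3 → ℕ) → Phase → ℝ}
    (hG : ∀ b, order b ≤ m → IsWeakDx D.phase D.μ b f (G b) ∧ eLpNorm (G b) ∞ D.μ < ∞) :
    wNorm D m f < ∞ := by
  have : wNorm D m f ≤ ∑ b ∈ multiIdx m, eLpNorm (G b) ∞ D.μ := by
    refine iSup₂_le fun b hb => ?_
    refine (iInf₂_le (G b) (hG b (mem_multiIdx.1 hb)).1).trans ?_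
    exact Finset.single_le_sum (f := fun b => eLpNorm (G b) ∞ D.μ) (fun _ _ => zero_le) hb
  exact this.trans_lt (ENNReal.sum_lt_top.2 fun b hb => (hG b (mem_multiIdx.1 hb)).2)

lemma isWeakDx_of_isCx {f : Phase → ℝ} {F : Phase → ℝ} (hF : IsCx ⊤ F) (eF : EqOn f F D.phase)
    (b : Fin 3 → ℕ) : IsWeakDx D.phase D.μ b f (dx b F) ∧ eLpNorm (dx b F) ∞ D.μ < ∞ := by
  have hs := (isCx_top_iff.1 hF).1
  have hc : ∀ b, Continuous (dx b F) := fun b => hF.continuous_dx b le_top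
  have hi : ∀ b, Integrable (dx b F) D.μ := fun b =>
    ((hc b).integrable_of_hasCompactSupport (hF.hasCompactSupport_dx b) (μ := (volume : Measure E3).prod
    (sphereMeasure.prod (volume : Measure ℝ)))).restrict
  refine ⟨⟨(hi 0).congr ?_, hi b, fun φ h1 h2 => ?_⟩, ?_⟩
  · filter_upwards [ae_mem_phase D] with p hp
    rw [dx_zero, eF hp]
  · have := setIntegral_mul_dx (ν := sphereMeasure.prod (volume : Measure ℝ)) D.isOpen b (hs _) eF
      (φ := φ) ⟨h1, h2⟩
    refine this.trans ?_
    congr 1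
    refine integral_congr_ae ?_
    filter_upwards [ae_mem_phase D] with p hp
    rw [dx_congr D b eF hp]
  · obtain ⟨C, hC⟩ := (hF.hasCompactSupport_dx b).exists_bound_of_continuous (hc b)
    rw [eLpNorm_exponent_top]
    exact eLpNormEssSup_lt_top_of_ae_bound (.of_forall hC)

/-- `S` lies within distance `1` of a smooth function whose derivatives are bounded by compact
support of the extension. -/
lemma MemW.wNorm_lt_top {S : Phase → ℝ} (h : MemW D m S) : wNorm D m S < ∞ := by
  obtain ⟨Φ, ⟨F, hF, eF⟩, hw⟩ := h 1 one_pos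
  obtain ⟨G, hG⟩ := exists_weak_family (hw.trans ENNReal.one_lt_top)
  refine Transport.wNorm_lt_top (G := fun b => G b + dx b F) fun b hb => ⟨?_, ?_⟩
  · have := (hG b hb).1.add (isWeakDx_of_isCx hF eF b).1
    rwa [sub_add_cancel] at this
  · refine (eLpNorm_add_le (hG b hb).1.2.1.aestronglyMeasurable
      (isWeakDx_of_isCx (D := D) hF eF b).1.2.1.aestronglyMeasurable (by simp)).trans_lt ?_
    exact ENNReal.add_lt_top.2 ⟨(hG b hb).2.trans_lt (hw.trans ENNReal.one_lt_top),
      (isWeakDx_of_isCx hF eF b).2⟩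

/-- The family consists of multiplications by the weak derivatives of `S`. Multiplication by `S`
need not preserve `C0 D`, but multiplication by its smooth approximants does, and
`exists_operator_H0` passes to the limit. -/
lemma exists_multiplier {S : Phase → ℝ} (h : MemW D m S) :
    ∃ M : H0 D m →L[ℝ] H0 D m, ‖M‖ ≤ leibConst m * (wNorm D m S).toReal ∧
      ∀ u : H0 D m, toFn (M u) =ᵐ[D.μ] fun p => S p * toFn u p := by
  have hfin := h.wNorm_lt_top
  obtain ⟨G, hG⟩ := exists_weak_family hfin
  have hex : ∀ (G : (Fin 3 → ℕ) → Phase → ℝ) (N : ℝ), 0 ≤ N → (∀ b, order b ≤ m →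
      Integrable (G b) D.μ ∧ eLpNorm (G b) ∞ D.μ ≤ ENNReal.ofReal N) →
      ∃ T : (Fin 3 → ℕ) → Lp ℝ 2 D.μ →L[ℝ] Lp ℝ 2 D.μ, ∀ b, order b ≤ m →
        ‖T b‖ ≤ N ∧ ∀ u, T b u =ᵐ[D.μ] fun p => G b p * u p := by
    intro G N hN hG
    have : ∀ b, ∃ T : Lp ℝ 2 D.μ →L[ℝ] Lp ℝ 2 D.μ, order b ≤ m →
        ‖T‖ ≤ N ∧ ∀ u, T u =ᵐ[D.μ] fun p => G b p * u p := by
      intro b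
      by_cases hb : order b ≤ m
      · obtain ⟨T, hT⟩ := exists_mulOp hN (hG b hb).1.aestronglyMeasurable (hG b hb).2
        exact ⟨T, fun _ => hT⟩
      · exact ⟨0, fun h => absurd h hb⟩
    choose T hT using this
    exact ⟨T, hT⟩
  obtain ⟨T, hT⟩ := hex G (wNorm D m S).toReal ENNReal.toReal_nonneg fun b hb =>
    ⟨(hG b hb).1.2.1, by rw [ENNReal.ofReal_toReal hfin.ne]; exact (hG b hb).2⟩
  obtain ⟨M, hM1, hM2⟩ := exists_operator_H0 (T := T) (m := m) (N := (wNorm D m S).toReal)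
    ENNReal.toReal_nonneg (fun b hb => (hT b hb).1) (by
    intro ε hε
    obtain ⟨Φ, hΦ, hw⟩ := h (ENNReal.ofReal ε) (by simpa using hε)
    obtain ⟨F, hF, eF⟩ := hΦ
    obtain ⟨G', hG'⟩ := exists_weak_family (hw.trans ENNReal.ofReal_lt_top)
    have hbnd : ∀ b, order b ≤ m →
        eLpNorm (dx b F) ∞ D.μ ≤ ENNReal.ofReal (∑ b ∈ multiIdx m,
          (eLpNorm (dx b F) ∞ D.μ).toReal) := by
      intro b hb
      have h1 := (isWeakDx_of_isCx (D := D) hF eF b).2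
      rw [← ENNReal.ofReal_toReal h1.ne]
      exact ENNReal.ofReal_le_ofReal (Finset.single_le_sum (f := fun b =>
        (eLpNorm (dx b F) ∞ D.μ).toReal) (fun _ _ => ENNReal.toReal_nonneg) (mem_multiIdx.2 hb))
    obtain ⟨T', hT'⟩ := hex (fun b => dx b F) _
      (Finset.sum_nonneg fun _ _ => ENNReal.toReal_nonneg) fun b hb =>
        ⟨(isWeakDx_of_isCx (D := D) hF eF b).1.2.1, hbnd b hb⟩
    refine ⟨T', isLeibniz_mul (f := Φ) (G := fun b => dx b F)
      (fun b _ => (isWeakDx_of_isCx hF eF b).1) fun b hb => (hT' b hb).2,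
      preservesC0_mul (f := Φ) ⟨F, hF, eF⟩ fun u => ?_, fun b hb => ?_⟩
    · filter_upwards [(hT' 0 (by simp [order])).2 u, ae_mem_phase D] with p h1 hp
      rw [h1, dx_zero, eF hp]
    · refine opNorm_le_of_ae hε.le fun u => ?_
      refine le_trans (le_of_eq (eLpNorm_congr_ae ?_)) (eLpNorm_mul_le (g := G' b)
        ((hG' b hb).2.trans hw.le) u)
      -- By uniqueness of weak derivatives, the multiplier in `T b - T' b` is the derivative of `S -
      -- Φ`, whose sup norm is below `ε`.
      have e : G' b =ᵐ[D.μ] G b - dx b F := (hG' b hb).1.ae_eq (isOpen_phase D) (ae_mem_phase D)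
        ((hG b hb).1.sub (isWeakDx_of_isCx hF eF b).1)
      filter_upwards [Lp.coeFn_sub (T b u) (T' b u), (hT b hb).2 u, (hT' b hb).2 u, e]
        with p h1 h2 h3 h4
      rw [sub_apply, h1, Pi.sub_apply, h2, h3, h4, Pi.sub_apply, sub_mul])
  refine ⟨M, hM1, fun u => (hM2 u).trans ?_⟩
  have e : G 0 =ᵐ[D.μ] S := (hG 0 (by simp [order])).1.ae_eq (isOpen_phase D) (ae_mem_phase D)
    (isWeakDx_zero (hG 0 (by simp [order])).1.1)
  filter_upwards [(hT 0 (by simp [order])).2 (u.1 (zeroIdx m)), e] with p h1 h2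
  rw [h1, h2]
  rfl

lemma isMultiplierConstant_leibConst (D : Domain) (m : ℕ) :
    IsMultiplierConstant D m (leibConst m) := by
  refine ⟨leibConst_pos m, fun S hS ψ v hv => ?_⟩
  obtain ⟨M, hM1, hM2⟩ := exists_multiplier hS
  have : v = M (incl D m ψ) := toFn_injective <| by
    filter_upwards [hv, hM2 (incl D m ψ), toFn_incl (m := m) ψ] with p h1 h2 h3
    rw [h1, h2, h3]
  rw [this]
  exact (M.le_opNorm _).trans (mul_le_mul_of_nonneg_right hM1 (norm_nonneg _))

/-- The norm of a multiplication operator is controlled by every admissible constant. -/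
lemma norm_multiplier_le {c : ℝ} (hc : IsMultiplierConstant D m c) {S : Phase → ℝ} (h : MemW D m S)
    {M : H0 D m →L[ℝ] H0 D m} (hM : ∀ u : H0 D m, toFn (M u) =ᵐ[D.μ] fun p => S p * toFn u p) :
    ‖M‖ ≤ c * (wNorm D m S).toReal := by
  refine ContinuousLinearMap.opNorm_le_bound _ (mul_nonneg hc.1.le ENNReal.toReal_nonneg) fun u => ?_
  refine (dense_range_incl D m).induction_on (p := fun u => ‖M u‖ ≤ _ * ‖u‖) u
    (isClosed_le (by fun_prop) (by fun_prop)) fun ψ => hc.2 S h ψ _ ?_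
  filter_upwards [hM (incl D m ψ), toFn_incl (m := m) ψ] with p h1 h2
  rw [h1, h2]

end Multipliers

end Transport

end

noncomputable section

namespace Transport

/-! ### Collision operators on `L²` -/

section Collision

variable {D : Domain} {m : ℕ}

/-- `((x, ω, E), ω') ↦ (x, ω', ω, E)`. -/
def insIn (r : Phase × S2) : KPhase := (r.1.1, r.2, r.1.2.1, r.1.2.2)

/-- `((x, ω', E), ω) ↦ (x, ω', ω, E)`. -/
def insOut (r : Phase × S2) : KPhase := (r.1.1, r.1.2.1, r.2, r.1.2.2)

/-- `(x, ω', ω, E) ↦ (x, ω', E)`. -/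
def inn (k : KPhase) : Phase := (k.1, k.2.1, k.2.2.2)

/-- `(x, ω', ω, E) ↦ (x, ω, E)`. -/
def out (k : KPhase) : Phase := (k.1, k.2.2.1, k.2.2.2)

lemma continuous_insIn : Continuous insIn := by unfold insIn; fun_prop
lemma continuous_insOut : Continuous insOut := by unfold insOut; fun_prop
lemma continuous_inn : Continuous inn := by unfold inn; fun_prop
lemma continuous_out : Continuous out := by unfold out; fun_prop

lemma prod_sphere_eq (D : Domain) : D.μ.prod sphereMeasure =
    (((volume : Measure E3).prod (sphereMeasure.prod (volume : Measure ℝ))).prod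
      sphereMeasure).restrict (D.phase ×ˢ univ) := by
  rw [← Measure.prod_restrict, Measure.restrict_univ]
  rfl

/-- The map only reassociates and permutes factors of a product measure. With `insOut` it allows the
four-variable integral to be iterated with either `ω'` or `ω` innermost. -/
lemma measurePreserving_insIn (D : Domain) :
    MeasurePreserving insIn (D.μ.prod sphereMeasure) D.κ := by
  have h := ((MeasurePreserving.id (volume : Measure E3)).prod (Measure.measurePreserving_swap
    (μ := sphereMeasure.prod (volume : Measure ℝ)) (ν := sphereMeasure))).comp
    (measurePreserving_prodAssoc (volume : Measure E3) (sphereMeasure.prod (volume : Measure ℝ))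
      sphereMeasure)
  have h2 := MeasurePreserving.restrict_preimage (f := insIn) h (isOpen_kphase D).measurableSet
  have e : insIn ⁻¹' D.kphase = D.phase ×ˢ univ := by
    ext r
    simp [Domain.phase, Domain.kphase, insIn]
  rw [prod_sphere_eq, ← e]
  exact h2

lemma measurePreserving_insOut (D : Domain) :
    MeasurePreserving insOut (D.μ.prod sphereMeasure) D.κ := by
  have h := ((MeasurePreserving.id (volume : Measure E3)).prod
    (((MeasurePreserving.id sphereMeasure).prod (Measure.measurePreserving_swap
      (μ := (volume : Measure ℝ)) (ν := sphereMeasure))).comp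
      (measurePreserving_prodAssoc sphereMeasure (volume : Measure ℝ) sphereMeasure))).comp
    (measurePreserving_prodAssoc (volume : Measure E3) (sphereMeasure.prod (volume : Measure ℝ))
      sphereMeasure)
  have h2 := MeasurePreserving.restrict_preimage (f := insOut) h (isOpen_kphase D).measurableSet
  have e : insOut ⁻¹' D.kphase = D.phase ×ˢ univ := by
    ext r
    simp [Domain.phase, Domain.kphase, insOut]
  rw [prod_sphere_eq, ← e]
  exact h2

/-- Composed with `insOut` this map is the first projection; hence null sets pull back to null sets,
and `u(x, ω', E)` makes sense for an almost everywhere class `u`. -/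
lemma quasiMeasurePreserving_inn (D : Domain) : Measure.QuasiMeasurePreserving inn D.κ D.μ := by
  refine ⟨continuous_inn.measurable, ?_⟩
  rw [← (measurePreserving_insOut D).map_eq,
    Measure.map_map continuous_inn.measurable continuous_insOut.measurable]
  exact (Measure.quasiMeasurePreserving_fst (μ := D.μ) (ν := sphereMeasure)).absolutelyContinuous

lemma ae_ae_insIn {P : KPhase → Prop} (h : ∀ᵐ k ∂D.κ, P k) :
    ∀ᵐ p ∂D.μ, ∀ᵐ ω' ∂sphereMeasure, P (insIn (p, ω')) :=
  Measure.ae_ae_of_ae_prod ((measurePreserving_insIn D).quasiMeasurePreserving.ae h)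

lemma ae_ae_insOut {P : KPhase → Prop} (h : ∀ᵐ k ∂D.κ, P k) :
    ∀ᵐ p ∂D.μ, ∀ᵐ ω ∂sphereMeasure, P (insOut (p, ω)) :=
  Measure.ae_ae_of_ae_prod ((measurePreserving_insOut D).quasiMeasurePreserving.ae h)

lemma lintegral_insIn {F : KPhase → ℝ≥0∞} (hF : AEMeasurable F D.κ) :
    ∫⁻ k, F k ∂D.κ = ∫⁻ p, ∫⁻ ω', F (insIn (p, ω')) ∂sphereMeasure ∂D.μ := by
  rw [← (measurePreserving_insIn D).map_eq] at hF ⊢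
  rw [lintegral_map' hF continuous_insIn.aemeasurable,
    lintegral_prod (fun a => F (insIn a)) (hF.comp_aemeasurable continuous_insIn.aemeasurable)]

lemma lintegral_insOut {F : KPhase → ℝ≥0∞} (hF : AEMeasurable F D.κ) :
    ∫⁻ k, F k ∂D.κ = ∫⁻ p, ∫⁻ ω, F (insOut (p, ω)) ∂sphereMeasure ∂D.μ := by
  rw [← (measurePreserving_insOut D).map_eq] at hF ⊢
  rw [lintegral_map' hF continuous_insOut.aemeasurable,
    lintegral_prod (fun a => F (insOut a)) (hF.comp_aemeasurable continuous_insOut.aemeasurable)]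

lemma integral_insIn {F : KPhase → ℝ} (hF : Integrable F D.κ) :
    ∫ k, F k ∂D.κ = ∫ p, ∫ ω', F (insIn (p, ω')) ∂sphereMeasure ∂D.μ := by
  have h := ((measurePreserving_insIn D).integrable_comp hF.aestronglyMeasurable).2 hF
  have h1 := integral_prod _ h
  rw [← (measurePreserving_insIn D).map_eq] at hF ⊢
  rw [integral_map continuous_insIn.aemeasurable hF.aestronglyMeasurable]
  exact h1

lemma integrable_insIn {F : KPhase → ℝ} (hF : Integrable F D.κ) :
    ∀ᵐ p ∂D.μ, Integrable (fun ω' => F (insIn (p, ω'))) sphereMeasure :=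
  (((measurePreserving_insIn D).integrable_comp hF.aestronglyMeasurable).2 hF).prod_right_ae

lemma aestronglyMeasurable_insIn {F : KPhase → ℝ} (hF : AEStronglyMeasurable F D.κ) :
    ∀ᵐ p ∂D.μ, AEStronglyMeasurable (fun ω' => F (insIn (p, ω'))) sphereMeasure :=
  (hF.comp_quasiMeasurePreserving (measurePreserving_insIn D).quasiMeasurePreserving).prodMk_left

lemma aestronglyMeasurable_insOut {F : KPhase → ℝ} (hF : AEStronglyMeasurable F D.κ) :
    ∀ᵐ p ∂D.μ, AEStronglyMeasurable (fun ω => F (insOut (p, ω))) sphereMeasure :=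
  (hF.comp_quasiMeasurePreserving (measurePreserving_insOut D).quasiMeasurePreserving).prodMk_left

/-- The hypotheses of the Schur test with constant `N`. -/
structure IsSchur (D : Domain) (g : KPhase → ℝ) (N : ℝ) : Prop where
  nonneg : 0 ≤ N
  meas : AEStronglyMeasurable g D.κ
  row : ∀ᵐ p ∂D.μ, ∫⁻ ω', ‖g (insIn (p, ω'))‖ₑ ∂sphereMeasure ≤ ENNReal.ofReal N
  col : ∀ᵐ p ∂D.μ, ∫⁻ ω, ‖g (insOut (p, ω))‖ₑ ∂sphereMeasure ≤ ENNReal.ofReal N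

lemma collision_eq (g : KPhase → ℝ) (u : Phase → ℝ) (p : Phase) :
    collision g u p = ∫ ω', g (insIn (p, ω')) * u (inn (insIn (p, ω'))) ∂sphereMeasure := rfl

lemma collision_congr {g g' : KPhase → ℝ} {u u' : Phase → ℝ} (hg : g =ᵐ[D.κ] g')
    (hu : u =ᵐ[D.μ] u') : collision g u =ᵐ[D.μ] collision g' u' := by
  filter_upwards [ae_ae_insIn hg, ae_ae_insIn ((quasiMeasurePreserving_inn D).ae hu)] with p h1 h2
  rw [collision_eq, collision_eq]
  refine integral_congr_ae ?_
  filter_upwards [h1, h2] with ω' h1 h2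
  rw [h1, h2]

lemma IsSchur.add {g g' : KPhase → ℝ} {N N' : ℝ} (h : IsSchur D g N) (h' : IsSchur D g' N') :
    IsSchur D (g + g') (N + N') := by
  have m1 := aestronglyMeasurable_insIn h.meas
  have m2 := aestronglyMeasurable_insOut h.meas
  refine ⟨add_nonneg h.nonneg h'.nonneg, h.meas.add h'.meas, ?_, ?_⟩
  · filter_upwards [h.row, h'.row, m1] with p h1 h2 h3
    rw [ENNReal.ofReal_add h.nonneg h'.nonneg]
    refine le_trans ?_ (add_le_add h1 h2)
    rw [← lintegral_add_left' h3.enorm]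
    exact lintegral_mono fun ω => enorm_add_le _ _
  · filter_upwards [h.col, h'.col, m2] with p h1 h2 h3
    rw [ENNReal.ofReal_add h.nonneg h'.nonneg]
    refine le_trans ?_ (add_le_add h1 h2)
    rw [← lintegral_add_left' h3.enorm]
    exact lintegral_mono fun ω => enorm_add_le _ _

variable {g : KPhase → ℝ} {N : ℝ}

lemma IsSchur.aestronglyMeasurable_mul (h : IsSchur D g N) {u : Phase → ℝ}
    (hu : AEStronglyMeasurable u D.μ) :
    AEStronglyMeasurable (fun k => g k * u (inn k)) D.κ :=
  h.meas.mul (hu.comp_quasiMeasurePreserving (quasiMeasurePreserving_inn D))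

/-- Tonelli moves the `ω`-integration inside, where `u` no longer depends on the integration
variable and the column bound applies. -/
lemma IsSchur.lintegral_le (h : IsSchur D g N) {u : Phase → ℝ≥0∞} (hu : AEMeasurable u D.μ) :
    ∫⁻ p, ∫⁻ ω', ‖g (insIn (p, ω'))‖ₑ * u (inn (insIn (p, ω'))) ∂sphereMeasure ∂D.μ ≤
      ENNReal.ofReal N * ∫⁻ p, u p ∂D.μ := by
  have hm : AEMeasurable (fun k => ‖g k‖ₑ * u (inn k)) D.κ :=
    h.meas.enorm.mul (hu.comp_quasiMeasurePreserving (quasiMeasurePreserving_inn D))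
  rw [← lintegral_insIn hm, lintegral_insOut hm, ← lintegral_const_mul'' _ hu]
  refine lintegral_mono_ae ?_
  have hmeas := aestronglyMeasurable_insOut h.meas
  filter_upwards [h.col, hmeas] with p h1 h2
  have e : ∀ ω, u (inn (insOut (p, ω))) = u p := fun ω => rfl
  simp only [e]
  rw [lintegral_mul_const'' _ h2.enorm]
  gcongr

lemma IsSchur.integrable (h : IsSchur D g N) {u : Phase → ℝ} (hu : Integrable u D.μ) :
    Integrable (fun k => g k * u (inn k)) D.κ := by
  have hm := h.aestronglyMeasurable_mul hu.aestronglyMeasurable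
  refine ⟨hm, ?_⟩
  rw [hasFiniteIntegral_iff_enorm, lintegral_insIn hm.enorm]
  simp only [enorm_mul]
  exact (h.lintegral_le hu.aestronglyMeasurable.enorm).trans_lt
    (ENNReal.mul_lt_top ENNReal.ofReal_lt_top hu.2)

/-- Cauchy–Schwarz with the weight split evenly: `ab = a^{1/2} · (a^{1/2} b)`. -/
lemma lintegral_mul_sq_le {α : Type*} [MeasurableSpace α] {μ : Measure α} {a b : α → ℝ≥0∞}
    (ha : AEMeasurable a μ) (hb : AEMeasurable b μ) :
    (∫⁻ x, a x * b x ∂μ) ^ (2 : ℝ) ≤ (∫⁻ x, a x ∂μ) * ∫⁻ x, a x * b x ^ (2 : ℝ) ∂μ := by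
  have h := ENNReal.lintegral_mul_le_Lp_mul_Lq μ Real.HolderConjugate.two_two
    (f := fun x => a x ^ (1 / 2 : ℝ)) (g := fun x => a x ^ (1 / 2 : ℝ) * b x)
    (ha.pow_const _) ((ha.pow_const _).mul hb)
  have e1 : ∀ x, ((fun x => a x ^ (1 / 2 : ℝ)) * fun x => a x ^ (1 / 2 : ℝ) * b x) x =
      a x * b x := fun x => by
    simp only [Pi.mul_apply]
    rw [← mul_assoc, ← ENNReal.rpow_add_of_nonneg _ _ (by norm_num) (by norm_num)]
    norm_num
  have e2 : ∀ x, (a x ^ (1 / 2 : ℝ)) ^ (2 : ℝ) = a x := fun x => by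
    rw [← ENNReal.rpow_mul]; norm_num
  simp only [e1, ENNReal.mul_rpow_of_nonneg _ _ (zero_le_two : (0 : ℝ) ≤ 2), e2] at h
  calc _ ≤ ((∫⁻ x, a x ∂μ) ^ (1 / 2 : ℝ) *
        (∫⁻ x, a x * b x ^ (2 : ℝ) ∂μ) ^ (1 / 2 : ℝ)) ^ (2 : ℝ) := by gcongr
    _ = _ := by
      rw [ENNReal.mul_rpow_of_nonneg _ _ zero_le_two, ← ENNReal.rpow_mul, ← ENNReal.rpow_mul]
      norm_num

lemma IsSchur.aestronglyMeasurable (h : IsSchur D g N) {u : Phase → ℝ}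
    (hu : AEStronglyMeasurable u D.μ) : AEStronglyMeasurable (collision g u) D.μ :=
  ((h.aestronglyMeasurable_mul hu).comp_quasiMeasurePreserving
    (measurePreserving_insIn D).quasiMeasurePreserving).integral_prod_right'

/-- The Schur test. -/
lemma IsSchur.eLpNorm_le (h : IsSchur D g N) {u : Phase → ℝ} (hu : AEStronglyMeasurable u D.μ) :
    eLpNorm (collision g u) 2 D.μ ≤ ENNReal.ofReal N * eLpNorm u 2 D.μ := by
  have hsq : ∀ f : Phase → ℝ, eLpNorm f 2 D.μ ^ (2 : ℝ) = ∫⁻ p, ‖f p‖ₑ ^ (2 : ℝ) ∂D.μ := fun f =>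
    eLpNorm_nnreal_pow_eq_lintegral (p := 2) two_ne_zero
  have h2 : (0 : ℝ) < 2 := two_pos
  rw [← ENNReal.rpow_le_rpow_iff h2, ENNReal.mul_rpow_of_nonneg _ _ h2.le, hsq, hsq]
  have m1 := aestronglyMeasurable_insIn h.meas
  have m2 := aestronglyMeasurable_insIn
    (hu.comp_quasiMeasurePreserving (quasiMeasurePreserving_inn D))
  -- Weighted Cauchy–Schwarz yields one factor `N` from the row bound; the remaining double integral
  -- yields the second from the column bound.
  calc ∫⁻ p, ‖collision g u p‖ₑ ^ (2 : ℝ) ∂D.μ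
      ≤ ∫⁻ p, ENNReal.ofReal N * ∫⁻ ω', ‖g (insIn (p, ω'))‖ₑ *
          ‖u (inn (insIn (p, ω')))‖ₑ ^ (2 : ℝ) ∂sphereMeasure ∂D.μ := by
        refine lintegral_mono_ae ?_
        filter_upwards [h.row, m1, m2] with p hp h1 h2
        have hle : ‖collision g u p‖ₑ ≤ ∫⁻ ω', ‖g (insIn (p, ω'))‖ₑ *
            ‖u (inn (insIn (p, ω')))‖ₑ ∂sphereMeasure := by
          rw [collision_eq]
          refine (enorm_integral_le_lintegral_enorm _).trans (le_of_eq ?_)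
          simp only [enorm_mul]
        refine (ENNReal.rpow_le_rpow hle zero_le_two).trans ?_
        exact (lintegral_mul_sq_le h1.enorm h2.enorm).trans (mul_le_mul_left hp _)
    _ = ENNReal.ofReal N * ∫⁻ p, ∫⁻ ω', ‖g (insIn (p, ω'))‖ₑ *
          ‖u (inn (insIn (p, ω')))‖ₑ ^ (2 : ℝ) ∂sphereMeasure ∂D.μ :=
        lintegral_const_mul' _ _ ENNReal.ofReal_ne_top
    _ ≤ ENNReal.ofReal N * (ENNReal.ofReal N * ∫⁻ p, ‖u p‖ₑ ^ (2 : ℝ) ∂D.μ) := by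
        gcongr
        exact h.lintegral_le (u := fun p => ‖u p‖ₑ ^ (2 : ℝ)) (hu.enorm.pow_const _)
    _ = _ := by
        rw [← mul_assoc]
        norm_num [sq]

lemma IsSchur.integrable_fiber (h : IsSchur D g N) {u : Phase → ℝ} (hu : Integrable u D.μ) :
    ∀ᵐ p ∂D.μ, Integrable (fun ω' => g (insIn (p, ω')) * u (inn (insIn (p, ω')))) sphereMeasure :=
  integrable_insIn (h.integrable hu)

lemma IsSchur.exists_clm (h : IsSchur D g N) :
    ∃ T : Lp ℝ 2 D.μ →L[ℝ] Lp ℝ 2 D.μ, ‖T‖ ≤ N ∧ ∀ u, T u =ᵐ[D.μ] collision g u := by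
  refine exists_clm_of_ae h.nonneg (fun u => collision g u)
    (fun u => h.aestronglyMeasurable (Lp.aestronglyMeasurable u)) (fun u v => ?_) (fun c u => ?_)
    fun u => h.eLpNorm_le (Lp.aestronglyMeasurable u)
  · refine (collision_congr (.refl _ _) (Lp.coeFn_add u v)).trans ?_
    filter_upwards [h.integrable_fiber (integrable_Lp u), h.integrable_fiber (integrable_Lp v)]
      with p h1 h2
    rw [Pi.add_apply, collision_eq, collision_eq, collision_eq, ← integral_add h1 h2]
    simp only [Pi.add_apply, mul_add]
  · refine (collision_congr (.refl _ _) (Lp.coeFn_smul c u)).trans (.of_forall fun p => ?_)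
    rw [Pi.smul_apply, smul_eq_mul, collision_eq, collision_eq, ← integral_const_mul]
    congr 1
    funext ω'
    simp only [Pi.smul_apply, smul_eq_mul]
    ring

lemma collision_kernel_sub {g' : KPhase → ℝ} {N' : ℝ} (h : IsSchur D g N) (h' : IsSchur D g' N')
    {u : Phase → ℝ} (hu : Integrable u D.μ) :
    collision (g - g') u =ᵐ[D.μ] collision g u - collision g' u := by
  filter_upwards [h.integrable_fiber hu, h'.integrable_fiber hu] with p h1 h2
  rw [Pi.sub_apply, collision_eq, collision_eq, collision_eq, ← integral_sub h1 h2]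
  simp only [Pi.sub_apply, sub_mul]

/-- This moves the pairing to the four-variable space, where the weak derivatives of the kernel are
defined. -/
lemma integral_collision_mul (h : IsSchur D g N) {u φ : Phase → ℝ} (hu : Integrable u D.μ)
    (hφ : IsTest D.phase φ) :
    Integrable (fun k => g k * u (inn k) * φ (out k)) D.κ ∧
    ∫ p, collision g u p * φ p ∂D.μ = ∫ k, g k * u (inn k) * φ (out k) ∂D.κ := by
  obtain ⟨C, hC⟩ := hφ.compact.exists_bound_of_continuous hφ.continuous
  have hi : Integrable (fun k => g k * u (inn k) * φ (out k)) D.κ :=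
    (h.integrable hu).mul_bdd (hφ.continuous.comp continuous_out).aestronglyMeasurable
      (.of_forall fun k => hC _)
  refine ⟨hi, ?_⟩
  rw [integral_insIn hi]
  refine integral_congr_ae (.of_forall fun p => ?_)
  have e : ∀ ω', φ (out (insIn (p, ω'))) = φ p := fun _ => rfl
  simp only [e]
  rw [integral_mul_const, collision_eq]

lemma hasCompactSupport_comp_out {φ : Phase → ℝ} (h : HasCompactSupport φ) :
    HasCompactSupport fun k => φ (out k) := by
  refine HasCompactSupport.intro
    ((h.isCompact.prod (isCompact_univ (X := S2))).image continuous_insIn) fun k hk => ?_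
  refine image_eq_zero_of_notMem_tsupport fun hn => hk ⟨(out k, k.2.1), ⟨hn, mem_univ _⟩, rfl⟩

lemma IsTest.comp_out {φ : Phase → ℝ} (h : IsTest D.phase φ) :
    IsTest D.kphase fun k => φ (out k) := by
  refine ⟨isCx_top_iff.2 ⟨fun k => ?_, hasCompactSupport_comp_out h.compact⟩, ?_⟩
  · have := SmoothX.reparam (R := S2 × S2 × ℝ) (v := fun _ => 0) (q := fun r => (r.2.1, r.2.2))
      continuous_const (by fun_prop) (h.smoothX k)
    simpa [out] using this
  · intro k hk
    have := tsupport_comp_subset_preimage φ continuous_out hk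
    have h2 := h.2 this
    simpa [Domain.phase, Domain.kphase, out] using h2

lemma exists_smooth_comp_inn (ψ : C0 D) (k : ℕ) :
    ∃ f : KPhase → ℝ, SmoothX k f ∧ EqOn (fun k => ψ.1 (inn k)) f D.kphase := by
  obtain ⟨f, h1, -, h3⟩ := exists_smooth_ext ψ k
  refine ⟨fun k => f (inn k), ?_, fun k hk => h3 ?_⟩
  · have := SmoothX.reparam (R := S2 × S2 × ℝ) (v := fun _ => 0) (q := fun r => (r.1, r.2.2))
      continuous_const (by fun_prop) h1
    simpa [inn] using this
  · simpa [Domain.phase, Domain.kphase, inn] using hk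

variable {σ : KPhase → ℝ} {G : (Fin 3 → ℕ) → KPhase → ℝ}
  {T : (Fin 3 → ℕ) → Lp ℝ 2 D.μ →L[ℝ] Lp ℝ 2 D.μ}

/-- The kernel's weak derivatives are tested with `ψ(x, ω', E) φ(x, ω, E)`. Its compact support
comes from `φ` and compactness of the sphere, and its `x`-derivative produces the two required
terms. -/
lemma isLeibniz_collision (hG : ∀ b, order b ≤ m → IsWeakDx D.kphase D.κ b σ (G b))
    (hS : ∀ b, order b ≤ m → IsSchur D (G b) N)
    (hT : ∀ b, order b ≤ m → ∀ u, T b u =ᵐ[D.μ] collision (G b) u) : IsLeibniz T m := by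
  intro b i hb ψ φ hφ
  have hb' : order (incr b i) ≤ m := by rw [order_incr]; exact hb
  have hb0 : order b ≤ m := by omega
  have hφo := hφ.comp_out
  have key := (hG b hb0).pd (hG _ hb') (hφo.mul_left (exists_smooth_comp_inn ψ))
  obtain ⟨f1, hf1, ef1⟩ := exists_smooth_comp_inn ψ 1
  have hi : ∀ χ : C0 D, Integrable χ.1 D.μ := fun χ => (memLp_C0 χ).integrable (by norm_num)
  have conv : ∀ b, order b ≤ m → ∀ (χ : C0 D) (φ : Phase → ℝ), IsTest D.phase φ →
      Integrable (fun k => G b k * χ.1 (inn k) * φ (out k)) D.κ ∧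
      ∫ p, T b (classC0 χ) p * φ p ∂D.μ = ∫ k, G b k * χ.1 (inn k) * φ (out k) ∂D.κ := by
    intro b hb χ φ hφ
    have h1 := integral_collision_mul (hS b hb) (hi χ) hφ
    refine ⟨h1.1, (integral_congr_ae ?_).trans h1.2⟩
    filter_upwards [hT b hb (classC0 χ), collision_congr (.refl _ (G b)) (coe_classC0 χ)]
      with p h2 h3
    rw [h2, h3]
  obtain ⟨i1, c1⟩ := conv b hb0 ψ _ (hφ.pd i)
  obtain ⟨i2, c2⟩ := conv _ hb' ψ _ hφ
  obtain ⟨i3, c3⟩ := conv b hb0 (pdC0 i ψ) _ hφ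
  have e2 : ∫ p, (T (incr b i) (classC0 ψ) + T b (classC0 (pdC0 i ψ))) p * φ p ∂D.μ =
      ∫ p, T (incr b i) (classC0 ψ) p * φ p ∂D.μ + ∫ p, T b (classC0 (pdC0 i ψ)) p * φ p ∂D.μ := by
    rw [integral_mul_eq_inner _ (memLp_test hφ), integral_mul_eq_inner _ (memLp_test hφ),
      integral_mul_eq_inner _ (memLp_test hφ), inner_add_right]
  rw [e2, c1, c2, c3]
  have e3 : ∫ k, G b k * pd i ((fun k => ψ.1 (inn k)) * fun k => φ (out k)) k ∂D.κ =
      ∫ k, (G b k * (pdC0 i ψ).1 (inn k) * φ (out k) + G b k * ψ.1 (inn k) * pd i φ (out k)) ∂D.κ :=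
    integral_congr_ae <| by
      filter_upwards [ae_mem_kphase D] with k hk
      rw [pd_mul_test D.isOpen hf1 ef1 hφo i hk]
      have a1 : pd i (fun k => ψ.1 (inn k)) k = (pdC0 i ψ).1 (inn k) := rfl
      have a2 : pd i (fun k => φ (out k)) k = pd i φ (out k) := rfl
      simp only [a1, a2]
      ring
  have e4 : ∫ k, G (incr b i) k * ((fun k => ψ.1 (inn k)) * fun k => φ (out k)) k ∂D.κ =
      ∫ k, G (incr b i) k * ψ.1 (inn k) * φ (out k) ∂D.κ :=
    integral_congr_ae (.of_forall fun k => by simp only [Pi.mul_apply]; ring)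
  rw [e3, e4, integral_add i3 i1] at key
  linarith

end Collision

end Transport

end

noncomputable section

namespace Transport

/-! ### The collision operator on `H₀` -/

section Kernels

variable {D : Domain} {m : ℕ}

lemma integrable_mul_continuousMap {u : S2 → ℝ} (hu : Integrable u sphereMeasure) (h : C(S2, ℝ)) :
    Integrable (fun ω => u ω * h ω) sphereMeasure :=
  hu.mul_bdd h.continuous.aestronglyMeasurable (.of_forall fun ω => h.norm_coe_le_norm ω)

/-- The pairing `∫ u h` of `L¹(S)` and `C(S)`. -/
def pairing : Lp ℝ 1 sphereMeasure →L[ℝ] C(S2, ℝ) →L[ℝ] ℝ :=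
  LinearMap.mkContinuous₂ (LinearMap.mk₂ ℝ (fun u h => ∫ ω, u ω * h ω ∂sphereMeasure)
    (fun u v h => by
      rw [← integral_add (integrable_mul_continuousMap (L1.integrable_coeFn u) h)
        (integrable_mul_continuousMap (L1.integrable_coeFn v) h)]
      refine integral_congr_ae ?_
      filter_upwards [Lp.coeFn_add u v] with ω hω
      rw [hω]
      exact add_mul _ _ _)
    (fun c u h => by
      rw [smul_eq_mul, ← integral_const_mul]
      refine integral_congr_ae ?_
      filter_upwards [Lp.coeFn_smul c u] with ω hω
      rw [hω]
      exact mul_assoc _ _ _)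
    (fun u h k => by
      rw [← integral_add (integrable_mul_continuousMap (L1.integrable_coeFn u) h)
        (integrable_mul_continuousMap (L1.integrable_coeFn u) k)]
      simp only [ContinuousMap.add_apply, mul_add])
    (fun c u h => by
      rw [smul_eq_mul, ← integral_const_mul]
      refine integral_congr_ae (.of_forall fun ω => ?_)
      simp only [ContinuousMap.smul_apply, smul_eq_mul]
      ring)) 1 fun u h => by
    simp only [LinearMap.mk₂_apply, one_mul]
    refine (norm_integral_le_integral_norm _).trans ?_
    rw [L1.norm_eq_integral_norm, ← integral_mul_const]
    refine integral_mono (integrable_mul_continuousMap (L1.integrable_coeFn u) h).norm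
      ((L1.integrable_coeFn u).norm.mul_const _) fun ω => ?_
    simp only [norm_mul]
    exact mul_le_mul_of_nonneg_left (h.norm_coe_le_norm ω) (norm_nonneg _)

lemma pairing_apply (u : Lp ℝ 1 sphereMeasure) (h : C(S2, ℝ)) :
    pairing u h = ∫ ω, u ω * h ω ∂sphereMeasure := rfl

/-- Smooth functions on the sphere, viewed as a two-dimensional manifold, already separate
integrable functions; the dimension fact supplies that structure. -/
lemma pairing_injective {u v : Lp ℝ 1 sphereMeasure} (h : pairing u = pairing v) : u = v := by
  have : Fact (Module.finrank ℝ E3 = 2 + 1) := ⟨by simp⟩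
  rw [← sub_eq_zero]
  have h0 : pairing (u - v) = 0 := by rw [map_sub, h, sub_self]
  refine Lp.ext ?_
  refine EventuallyEq.trans ?_ (Lp.coeFn_zero ℝ 1 sphereMeasure).symm
  refine ae_eq_zero_of_integral_contMDiff_smul_eq_zero (modelWithCornersSelf ℝ (EuclideanSpace ℝ (Fin 2)))
    (L1.integrable_coeFn (u - v)).locallyIntegrable fun g hg _ => ?_
  have := congrArg (fun L : C(S2, ℝ) →L[ℝ] ℝ => L ⟨g, hg.continuous⟩) h0
  simp only [pairing_apply, ContinuousMap.coe_mk, zero_apply] at this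
  rw [← this]
  simp only [smul_eq_mul, mul_comm]

lemma integral_kernel_test {F : KPhase → ℝ} (hF : Integrable F D.κ) (h : C(S2, ℝ)) :
    Integrable (fun p => ∫ ω', F (insIn (p, ω')) * h ω' ∂sphereMeasure) D.μ ∧
    ∀ φ, IsTest D.phase φ → ∫ k, F k * (h k.2.1 * φ (out k)) ∂D.κ =
      ∫ p, (∫ ω', F (insIn (p, ω')) * h ω' ∂sphereMeasure) * φ p ∂D.μ := by
  have hi : Integrable (fun k => F k * h k.2.1) D.κ :=
    hF.mul_bdd (h.continuous.comp (by fun_prop)).aestronglyMeasurable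
      (.of_forall fun k => h.norm_coe_le_norm _)
  refine ⟨(((measurePreserving_insIn D).integrable_comp hi.aestronglyMeasurable).2
    hi).integral_prod_left, fun φ hφ => ?_⟩
  obtain ⟨C, hC⟩ := hφ.compact.exists_bound_of_continuous hφ.continuous
  have hi2 : Integrable (fun k => F k * (h k.2.1 * φ (out k))) D.κ := by
    simp only [← mul_assoc]
    exact hi.mul_bdd (hφ.continuous.comp continuous_out).aestronglyMeasurable
      (.of_forall fun k => hC _)
  rw [integral_insIn hi2]
  refine integral_congr_ae (.of_forall fun p => ?_)
  simp only
  rw [← integral_mul_const]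
  refine integral_congr_ae (.of_forall fun ω' => ?_)
  exact (mul_assoc _ _ _).symm

lemma dx_param_mul {Q : Type*} [TopologicalSpace Q] (α : Fin 3 → ℕ) (a : Q → ℝ) {f : E3 × Q → ℝ}
    (hf : SmoothX (order α) f) : dx α (fun p => a p.2 * f p) = fun p => a p.2 * dx α f p := by
  funext p
  exact congrFun (iterD_add_smul α _ _ (a p.2) (hf.contDiff p.2) (hf.contDiff p.2)).2 p.1

lemma dx_clm {Q F F₁ : Type*} [TopologicalSpace Q] [NormedAddCommGroup F] [NormedSpace ℝ F]
    [NormedAddCommGroup F₁] [NormedSpace ℝ F₁] (L : F →L[ℝ] F₁) (α : Fin 3 → ℕ) {f : E3 × Q → F}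
    (hf : SmoothX (order α) f) : dx α (fun p => L (f p)) = fun p => L (dx α f p) := by
  rw [dx_eq_dxw, dx_eq_dxw, dxw_clm L _ (by rwa [length_word])]

/-- The weak derivatives of a kernel of class `C₀^{(∞,0,0)}` are the classical ones. -/
lemma ae_eq_dx_of_isWeakDx {τ g : KPhase → ℝ} {T : Phase → Lp ℝ 1 sphereMeasure}
    (hT : IsCx ⊤ T)
    (hτ : ∀ᵐ p ∂D.μ, T p =ᵐ[sphereMeasure] fun ω' => τ (insIn (p, ω'))) {b : Fin 3 → ℕ}
    (hg : IsWeakDx D.kphase D.κ b τ g) :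
    ∀ᵐ p ∂D.μ, (fun ω' => g (insIn (p, ω'))) =ᵐ[sphereMeasure]
      (dx b T p : Lp ℝ 1 sphereMeasure) := by
  have hTs := (isCx_top_iff.1 hT).1
  have hdT : IsCx ⊤ (dx b T) := isCx_top_iff.2 ⟨fun k => (hTs (k + order b)).dx,
    hT.hasCompactSupport_dx b⟩
  -- For a fixed `h`, test functions of the form `h(ω') φ(x, ω, E)` reduce the `L¹`-valued claim to
  -- a scalar one.
  have key : ∀ h : C(S2, ℝ), (fun p => ∫ ω', g (insIn (p, ω')) * h ω' ∂sphereMeasure) =ᵐ[D.μ]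
      fun p => pairing (dx b T p) h := by
    intro h
    have hLs : ∀ {T : Phase → Lp ℝ 1 sphereMeasure}, IsCx ⊤ T → IsCx ⊤ fun p => pairing (T p) h :=
      fun hT => isCx_top_iff.2 ⟨fun k => ((isCx_top_iff.1 hT).1 k).clm (pairing.flip h),
        hT.compact.comp_left (g := fun t => pairing t h) (by simp)⟩
    refine ae_eq_of_forall_test (isOpen_phase D) (ae_mem_phase D)
      (integral_kernel_test hg.2.1 h).1
      (isWeakDx_of_isCx (D := D) (hLs hdT) (fun _ _ => rfl) 0).1.1 fun φ hφ => ?_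
    have hΨ : IsTest D.kphase fun k => h k.2.1 * φ (out k) :=
      hφ.comp_out.mul_left fun k => ⟨fun k => h k.2.1,
        smoothX_of_param (a := fun q : S2 × S2 × ℝ => h q.1) (by fun_prop) k, fun _ _ => rfl⟩
    have h1 := hg.2.2 _ hΨ.1 hΨ.2
    rw [dx_param_mul (Q := S2 × S2 × ℝ) b (fun q => h q.1) (hφ.comp_out.smoothX _)] at h1
    have h2 := (integral_kernel_test hg.1 h).2 _ (hφ.dx b)
    have h3 := (integral_kernel_test hg.2.1 h).2 _ hφ
    have h4 : ∫ p, (∫ ω', τ (insIn (p, ω')) * h ω' ∂sphereMeasure) * dx b φ p ∂D.μ =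
        ∫ p, pairing (T p) h * dx b φ p ∂D.μ := integral_congr_ae <| by
      filter_upwards [hτ] with p hp
      congr 1
      refine integral_congr_ae ?_
      filter_upwards [hp] with ω' hω
      rw [hω]
    have h5 := setIntegral_mul_dx (ν := sphereMeasure.prod (volume : Measure ℝ)) D.isOpen b
      ((isCx_top_iff.1 (hLs hT)).1 _) (fun _ _ => rfl) hφ
    have h6 : dx b (fun p => pairing (T p) h) = fun p => pairing (dx b T p) h :=
      dx_clm (pairing.flip h) b (hTs _)
    rw [h6] at h5
    rw [h3] at h1
    have h7 : ∫ k, τ k * (h k.2.1 * dx b (fun k => φ (out k)) k) ∂D.κ =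
      ∫ k, τ k * (h k.2.1 * dx b φ (out k)) ∂D.κ := rfl
    have h8 : ∫ p, pairing (T p) h * dx b φ p ∂D.μ =
      (-1) ^ order b * ∫ p, pairing (dx b T p) h * φ p ∂D.μ := h5
    have h9 := h1.symm.trans (h7.trans (h2.trans (h4.trans h8)))
    exact mul_left_cancel₀ (pow_ne_zero _ (by norm_num)) h9
  -- The exceptional null set depends on `h`; a countable dense family in `C(S)` yields a common
  -- one, and continuity of both functionals covers the remaining `h`.
  have hall := ae_all_iff.2 fun n => key (TopologicalSpace.denseSeq C(S2, ℝ) n)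
  filter_upwards [hall, integrable_insIn hg.2.1] with p hp hi
  have hpair : ∀ h : C(S2, ℝ), pairing (hi.toL1 _) h =
      ∫ ω', g (insIn (p, ω')) * h ω' ∂sphereMeasure := fun h => by
    rw [pairing_apply]
    refine integral_congr_ae ?_
    filter_upwards [hi.coeFn_toL1] with ω' hω
    rw [hω]
  have heq : pairing (hi.toL1 _) = pairing (dx b T p) := by
    refine ContinuousLinearMap.coeFn_injective ?_
    refine (TopologicalSpace.denseRange_denseSeq C(S2, ℝ)).equalizer
      (ContinuousLinearMap.continuous _) (ContinuousLinearMap.continuous _) (funext fun n => ?_)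
    simp only [Function.comp_apply]
    rw [hpair, hp n]
  rw [← pairing_injective heq]
  exact hi.coeFn_toL1.symm

/-- Row bounds for approximating kernels are not assumed: they follow since the classical
`L¹`-valued derivatives are continuous with compact support and agree with the weak ones. -/
lemma exists_row_bound {τ g : KPhase → ℝ} (hτ : IsC0Kernel D τ) {b : Fin 3 → ℕ}
    (hg : IsWeakDx D.kphase D.κ b τ g) :
    ∃ A : ℝ, 0 ≤ A ∧
      ∀ᵐ p ∂D.μ, ∫⁻ ω', ‖g (insIn (p, ω'))‖ₑ ∂sphereMeasure ≤ ENNReal.ofReal A := by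
  obtain ⟨-, T₀, ⟨T, hT, eT⟩, -, hae⟩ := hτ
  obtain ⟨A, hA⟩ := (hT.hasCompactSupport_dx b).exists_bound_of_continuous
    (hT.continuous_dx b le_top)
  have hae' : ∀ᵐ p ∂D.μ, T p =ᵐ[sphereMeasure] fun ω' => τ (insIn (p, ω')) := by
    filter_upwards [hae, ae_mem_phase D] with p h1 h2
    rw [← eT h2]
    exact h1
  refine ⟨|A|, abs_nonneg A, ?_⟩
  filter_upwards [ae_eq_dx_of_isWeakDx hT hae' hg] with p hp
  have e : ∫⁻ ω', ‖g (insIn (p, ω'))‖ₑ ∂sphereMeasure = ∫⁻ ω', ‖dx b T p ω'‖ₑ ∂sphereMeasure :=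
    lintegral_congr_ae (by filter_upwards [hp] with ω' h; rw [h])
  rw [e, ← L1.ofReal_norm_eq_lintegral]
  exact ENNReal.ofReal_le_ofReal ((hA p).trans (le_abs_self A))

lemma essSup_row_congr {g h : KPhase → ℝ} (e : g =ᵐ[D.κ] h) :
    essSup (fun p => ∫⁻ ω', ‖g (insIn (p, ω'))‖ₑ ∂sphereMeasure) D.μ =
      essSup (fun p => ∫⁻ ω', ‖h (insIn (p, ω'))‖ₑ ∂sphereMeasure) D.μ := by
  refine essSup_congr_ae ?_
  filter_upwards [ae_ae_insIn e] with p hp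
  exact lintegral_congr_ae (by filter_upwards [hp] with ω' h; rw [h])

lemma essSup_col_congr {g h : KPhase → ℝ} (e : g =ᵐ[D.κ] h) :
    essSup (fun p => ∫⁻ ω, ‖g (insOut (p, ω))‖ₑ ∂sphereMeasure) D.μ =
      essSup (fun p => ∫⁻ ω, ‖h (insOut (p, ω))‖ₑ ∂sphereMeasure) D.μ := by
  refine essSup_congr_ae ?_
  filter_upwards [ae_ae_insOut e] with p hp
  exact lintegral_congr_ae (by filter_upwards [hp] with ω' h; rw [h])

/-- The first norm controls rows and the second columns. The two families of weak derivatives they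
provide agree almost everywhere, so one family has both bounds. -/
lemma exists_schur_of_kNorm_lt {d : KPhase → ℝ} {ε : ℝ} (hε : 0 ≤ ε)
    (h : kNorm₁ D m d + kNorm₂ D m d ≤ ENNReal.ofReal ε) :
    ∃ G : (Fin 3 → ℕ) → KPhase → ℝ, ∀ b, order b ≤ m →
      IsWeakDx D.kphase D.κ b d (G b) ∧ IsSchur D (G b) ε := by
  obtain ⟨G, hG⟩ := exists_weak_family_of_lt_top (isOpen_kphase D) (ae_mem_kphase D) (m := m)
    (f := d) (fun g : KPhase → ℝ => essSup (fun p : Phase =>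
      ∫⁻ ω', ‖g (insIn (p, ω'))‖ₑ ∂sphereMeasure) D.μ) (fun _ _ e => essSup_row_congr e)
    ENNReal.ofReal_lt_top (le_self_add.trans h)
  obtain ⟨G', hG'⟩ := exists_weak_family_of_lt_top (isOpen_kphase D) (ae_mem_kphase D) (m := m)
    (f := d) (fun g : KPhase → ℝ => essSup (fun p : Phase =>
      ∫⁻ ω, ‖g (insOut (p, ω))‖ₑ ∂sphereMeasure) D.μ) (fun _ _ e => essSup_col_congr e)
    ENNReal.ofReal_lt_top (le_add_self.trans h)
  refine ⟨G, fun b hb => ⟨(hG b hb).1, hε, (hG b hb).1.2.1.aestronglyMeasurable, ?_, ?_⟩⟩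
  · filter_upwards [ENNReal.ae_le_essSup
      (fun p : Phase => ∫⁻ ω', ‖G b (insIn (p, ω'))‖ₑ ∂sphereMeasure)] with p hp
    exact hp.trans (hG b hb).2
  · have e := essSup_col_congr ((hG b hb).1.ae_eq (isOpen_kphase D) (ae_mem_kphase D) (hG' b hb).1)
    filter_upwards [ENNReal.ae_le_essSup
      (fun p : Phase => ∫⁻ ω, ‖G b (insOut (p, ω))‖ₑ ∂sphereMeasure)] with p hp
    exact hp.trans (e.le.trans (hG' b hb).2)

/-- Columns are controlled by the finite second norm and rows by `exists_row_bound`; summing the row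
bounds gives one constant for all orders up to `m`. -/
lemma exists_schur_of_isC0Kernel {τ : KPhase → ℝ} (hτ : IsC0Kernel D τ)
    (h : kNorm₂ D m τ < ∞) :
    ∃ (G : (Fin 3 → ℕ) → KPhase → ℝ) (N : ℝ), ∀ b, order b ≤ m →
      IsWeakDx D.kphase D.κ b τ (G b) ∧ IsSchur D (G b) N := by
  obtain ⟨G, hG⟩ := exists_weak_family_of_lt_top (isOpen_kphase D) (ae_mem_kphase D) (m := m)
    (f := τ) (fun g : KPhase → ℝ => essSup (fun p : Phase =>
      ∫⁻ ω, ‖g (insOut (p, ω))‖ₑ ∂sphereMeasure) D.μ) (fun _ _ e => essSup_col_congr e)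
    h le_rfl
  have hA : ∀ b, ∃ A : ℝ, 0 ≤ A ∧ (order b ≤ m → ∀ᵐ p ∂D.μ,
      ∫⁻ ω', ‖G b (insIn (p, ω'))‖ₑ ∂sphereMeasure ≤ ENNReal.ofReal A) := by
    intro b
    by_cases hb : order b ≤ m
    · obtain ⟨A, h1, h2⟩ := exists_row_bound hτ (hG b hb).1
      exact ⟨A, h1, fun _ => h2⟩
    · exact ⟨0, le_rfl, fun h => absurd h hb⟩
  choose A hA0 hA using hA
  have hs : 0 ≤ ∑ b ∈ multiIdx m, A b := Finset.sum_nonneg fun b _ => hA0 b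
  refine ⟨G, (kNorm₂ D m τ).toReal + ∑ b ∈ multiIdx m, A b, fun b hb => ⟨(hG b hb).1,
    add_nonneg ENNReal.toReal_nonneg hs, (hG b hb).1.2.1.aestronglyMeasurable, ?_, ?_⟩⟩
  · filter_upwards [hA b hb] with p hp
    refine hp.trans (ENNReal.ofReal_le_ofReal ?_)
    have := Finset.single_le_sum (fun b _ => hA0 b) (mem_multiIdx.2 hb)
    have h0 : 0 ≤ (kNorm₂ D m τ).toReal := ENNReal.toReal_nonneg
    linarith
  · filter_upwards [ENNReal.ae_le_essSup
      (fun p : Phase => ∫⁻ ω, ‖G b (insOut (p, ω))‖ₑ ∂sphereMeasure)] with p hp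
    refine hp.trans ((hG b hb).2.trans ?_)
    rw [ENNReal.ofReal_add ENNReal.toReal_nonneg hs, ENNReal.ofReal_toReal h.ne]
    exact le_self_add

/-- The integral pairs the `L¹(S')`-valued kernel with the `C(S')`-valued function `(x, ω, E) ↦ ψ(x,
·, E)`, both smooth in `x`. It vanishes near the inflow boundary because the kernel does. -/
lemma preservesC0_collision {τ : KPhase → ℝ} (hτ : IsC0Kernel D τ)
    {T : (Fin 3 → ℕ) → Lp ℝ 2 D.μ →L[ℝ] Lp ℝ 2 D.μ}
    (hT : ∀ u, T 0 u =ᵐ[D.μ] collision τ u) : PreservesC0 T := by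
  intro ψ
  obtain ⟨-, K₀, ⟨K, hK, eK⟩, hav, hae⟩ := hτ
  refine ⟨⟨fun p => ∫ ω', K₀ p ω' * ψ.1 (p.1, ω', p.2.2) ∂sphereMeasure,
    mem_C0_of (fun k => ?_) (hav.of_support fun p hp hn => ?_)⟩, Lp.ext ?_⟩
  · obtain ⟨f, h1, -, h3⟩ := exists_smooth_ext ψ k
    have hr : SmoothX k fun r : E3 × ((S2 × ℝ) × S2) => f (r.1, (r.2.2, r.2.1.2)) := by
      have := SmoothX.reparam (R := (S2 × ℝ) × S2) (v := fun _ => 0) (q := fun r => (r.2, r.1.2))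
        continuous_const (by fun_prop) h1
      simpa using this
    refine ⟨_, ((isCx_top_iff.1 hK).1 k).bilin pairing hr.curry, ?_, fun p hp => ?_⟩
    · exact HasCompactSupport.intro hK.compact fun p hp => by
        rw [image_eq_zero_of_notMem_tsupport hp]
        simp
    · simp only [pairing_apply, ContinuousMap.coe_mk]
      rw [eK hp]
      refine integral_congr_ae (.of_forall fun ω' => ?_)
      simp only
      congr 1
      exact h3 ⟨hp.1, mem_univ _, hp.2.2⟩
  · have h0 := eq_zero_of_notMem_closure_support hp hn
    rw [h0]
    refine integral_eq_zero_of_ae ?_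
    filter_upwards [Lp.coeFn_zero ℝ 1 sphereMeasure] with ω' h
    rw [h]
    simp
  · refine (hT _).trans ((collision_congr (.refl _ τ) (coe_classC0 ψ)).trans
      (EventuallyEq.trans ?_ (coe_classC0 _).symm))
    filter_upwards [hae] with p hp
    refine integral_congr_ae ?_
    filter_upwards [hp] with ω' h
    rw [h]

lemma exists_collision_family {G : (Fin 3 → ℕ) → KPhase → ℝ} {N : ℝ}
    (hS : ∀ b, order b ≤ m → IsSchur D (G b) N) :
    ∃ T : (Fin 3 → ℕ) → Lp ℝ 2 D.μ →L[ℝ] Lp ℝ 2 D.μ, ∀ b, order b ≤ m →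
      ‖T b‖ ≤ N ∧ ∀ u, T b u =ᵐ[D.μ] collision (G b) u := by
  have : ∀ b, ∃ T : Lp ℝ 2 D.μ →L[ℝ] Lp ℝ 2 D.μ, order b ≤ m →
      ‖T‖ ≤ N ∧ ∀ u, T u =ᵐ[D.μ] collision (G b) u := by
    intro b
    by_cases hb : order b ≤ m
    · obtain ⟨T, hT⟩ := (hS b hb).exists_clm
      exact ⟨T, fun _ => hT⟩
    · exact ⟨0, fun h => absurd h hb⟩
  choose T hT using this
  exact ⟨T, hT⟩

/-- A splitting `σ = τ₀ + (σ - τ₀)` gives weak derivatives and Schur bounds for `σ`; better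
approximants then show, as for multipliers, that `H0` is preserved. -/
lemma exists_collisionOperator {σ : KPhase → ℝ} (h : MemW0 D m σ) :
    ∃ K : H0 D m →L[ℝ] H0 D m, IsCollisionOperator D m σ K := by
  have h0m : order 0 ≤ m := by simp [order]
  obtain ⟨τ₀, hτ₀, hfin₀, hlt₀⟩ := h 1 one_pos
  obtain ⟨G₀, N₀, hG₀⟩ := exists_schur_of_isC0Kernel hτ₀ hfin₀
  obtain ⟨Gd, hGd⟩ := exists_schur_of_kNorm_lt (ε := 1) zero_le_one (by simpa using hlt₀.le)
  have hG : ∀ b, order b ≤ m → IsWeakDx D.kphase D.κ b σ (G₀ b + Gd b) ∧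
      IsSchur D (G₀ b + Gd b) (N₀ + 1) := fun b hb => by
    refine ⟨?_, (hG₀ b hb).2.add (hGd b hb).2⟩
    have := (hG₀ b hb).1.add (hGd b hb).1
    rwa [add_sub_cancel] at this
  obtain ⟨T, hT⟩ := exists_collision_family fun b hb => (hG b hb).2
  obtain ⟨K, -, hK⟩ := exists_operator_H0 (T := T) (m := m) (hG 0 h0m).2.nonneg
    (fun b hb => (hT b hb).1) (by
    intro ε hε
    obtain ⟨τ, hτ, hfin, hlt⟩ := h (ENNReal.ofReal ε) (by simpa using hε)
    obtain ⟨G', N', hG'⟩ := exists_schur_of_isC0Kernel hτ hfin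
    obtain ⟨Ge, hGe⟩ := exists_schur_of_kNorm_lt hε.le hlt.le
    obtain ⟨T', hT'⟩ := exists_collision_family fun b hb => (hG' b hb).2
    have e0 : G' 0 =ᵐ[D.κ] τ := (hG' 0 h0m).1.ae_eq (isOpen_kphase D) (ae_mem_kphase D)
      (isWeakDx_zero (hG' 0 h0m).1.1)
    refine ⟨T', isLeibniz_collision (fun b hb => (hG' b hb).1) (fun b hb => (hG' b hb).2)
      (fun b hb => (hT' b hb).2), preservesC0_collision hτ fun u =>
        ((hT' 0 h0m).2 u).trans (collision_congr e0 (.refl _ _)), fun b hb => ?_⟩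
    refine opNorm_le_of_ae hε.le fun u => ?_
    refine le_trans (le_of_eq (eLpNorm_congr_ae ?_))
      ((hGe b hb).2.eLpNorm_le (Lp.aestronglyMeasurable u))
    have e : Ge b =ᵐ[D.κ] (G₀ b + Gd b) - G' b :=
      (hGe b hb).1.ae_eq (isOpen_kphase D) (ae_mem_kphase D) ((hG b hb).1.sub (hG' b hb).1)
    filter_upwards [Lp.coeFn_sub (T b u) (T' b u), (hT b hb).2 u, (hT' b hb).2 u,
      collision_congr e (.refl _ u),
      collision_kernel_sub (hG b hb).2 (hG' b hb).2 (integrable_Lp u)] with p h1 h2 h3 h4 h5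
    rw [sub_apply, h1, Pi.sub_apply, h2, h3, h4, h5, Pi.sub_apply])
  have e : G₀ 0 + Gd 0 =ᵐ[D.κ] σ := (hG 0 h0m).1.ae_eq (isOpen_kphase D) (ae_mem_kphase D)
    (isWeakDx_zero (hG 0 h0m).1.1)
  exact ⟨K, fun u => (hK u).trans (((hT 0 h0m).2 _).trans (collision_congr e (.refl _ _)))⟩

end Kernels

end Transport

end

noncomputable section

namespace Transport

/-! ### Geometry of the boundary -/

section Geometry

variable {D : Domain} {m : ℕ}

lemma IsBoundaryChart.differentiableAt {G : Set E3} {y : E3} {φ : OpenPartialHomeomorph E3 E3}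
    (h : IsBoundaryChart G y φ) : ContDiffAt ℝ 1 φ y :=
  (h.2.1.contDiffAt (φ.open_source.mem_nhds h.1)).of_le (by exact_mod_cast le_top)

lemma IsBoundaryChart.hasStrictFDerivAt {G : Set E3} {y : E3} {φ : OpenPartialHomeomorph E3 E3}
    (h : IsBoundaryChart G y φ) :
    HasStrictFDerivAt (fun x => φ x 2) (fderiv ℝ (fun x => φ x 2) y) y := by
  have h1 : ContDiffAt ℝ 1 (fun x => φ x 2) y :=
    ((EuclideanSpace.proj (2 : Fin 3) : E3 →L[ℝ] ℝ).contDiff.contDiffAt).comp y h.differentiableAt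
  exact h1.hasStrictFDerivAt (by norm_num)

/-- In the chart the function becomes a coordinate, whose derivative is nonzero; the chain rule with
the inverse chart excludes a vanishing gradient. -/
lemma IsBoundaryChart.fderiv_ne_zero {G : Set E3} {y : E3} {φ : OpenPartialHomeomorph E3 E3}
    (h : IsBoundaryChart G y φ) : fderiv ℝ (fun x => φ x 2) y ≠ 0 := by
  have hy := φ.map_source h.1
  have h2 : DifferentiableAt ℝ φ.symm (φ y) :=
    ((h.2.2.1.contDiffAt (φ.open_target.mem_nhds hy)).of_le
      (by exact_mod_cast le_top : (1 : WithTop ℕ∞) ≤ _)).differentiableAt (by norm_num)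
  have h1 : DifferentiableAt ℝ (fun x => φ x 2) (φ.symm (φ y)) := by
    rw [φ.left_inv h.1]
    exact h.hasStrictFDerivAt.hasFDerivAt.differentiableAt
  have hcomp := h1.hasFDerivAt.comp (φ y) h2.hasFDerivAt
  have he : ((fun x => φ x 2) ∘ φ.symm) =ᶠ[𝓝 (φ y)] fun z => z 2 := by
    filter_upwards [φ.open_target.mem_nhds hy] with z hz
    simp [φ.right_inv hz]
  have h3 := hcomp.congr_of_eventuallyEq he.symm
  have h4 : HasFDerivAt (fun z : E3 => z 2) (EuclideanSpace.proj (2 : Fin 3) : E3 →L[ℝ] ℝ) (φ y) :=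
    (EuclideanSpace.proj (2 : Fin 3) : E3 →L[ℝ] ℝ).hasFDerivAt
  have h5 := h3.unique h4
  rw [φ.left_inv h.1] at h5
  intro h0
  rw [h0, ContinuousLinearMap.zero_comp] at h5
  have := congrArg (fun L : E3 →L[ℝ] ℝ => L (EuclideanSpace.single 2 1)) h5
  simp at this

/-- The normal is a default choice, meaningful only once some normal exists; the normalised Riesz
representative of the chart's gradient is one. -/
lemma isOutwardNormal_outwardNormal {y : E3} (hy : y ∈ frontier D.G) :
    IsOutwardNormal D.G y (outwardNormal D.G y) := by
  obtain ⟨φ, hφ⟩ := D.smooth_boundary y hy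
  refine Classical.epsilon_spec (p := IsOutwardNormal D.G y) ?_
  set ℓ := fderiv ℝ (fun x => φ x 2) y with hℓ
  set v := (InnerProductSpace.toDual ℝ E3).symm ℓ with hv
  have hv0 : v ≠ 0 := by
    simpa [hv] using hφ.fderiv_ne_zero
  have hn : 0 < ‖v‖ := norm_pos_iff.2 hv0
  refine ⟨‖v‖⁻¹ • v, by rw [norm_smul, norm_inv, norm_norm, inv_mul_cancel₀ hn.ne'], φ, hφ, ‖v‖,
    hn, fun w => ?_⟩
  rw [real_inner_smul_left, ← mul_assoc, mul_inv_cancel₀ hn.ne', one_mul, hv,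
    InnerProductSpace.toDual_symm_apply]

/-- A local defining function of `G` at a boundary point. -/
lemma exists_definingFunction {y : E3} (hy : y ∈ frontier D.G) :
    ∃ (ρ : E3 → ℝ) (O : Set E3) (a : ℝ), 0 < a ∧ IsOpen O ∧ y ∈ O ∧ ContinuousOn ρ O ∧
      HasStrictFDerivAt ρ (a • innerSL ℝ (outwardNormal D.G y)) y ∧ ∀ x ∈ O, x ∈ D.G ↔ ρ x < 0 := by
  obtain ⟨-, φ, hφ, a, ha, h⟩ := isOutwardNormal_outwardNormal hy
  refine ⟨fun x => φ x 2, φ.source, a, ha, φ.open_source, hφ.1, ?_, ?_, hφ.2.2.2⟩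
  · exact (by fun_prop : Continuous fun z : E3 => z 2).comp_continuousOn φ.continuousOn
  · have e : a • innerSL ℝ (outwardNormal D.G y) = fderiv ℝ (fun x => φ x 2) y :=
      ContinuousLinearMap.ext fun v => by rw [h]; simp
    rw [e]
    exact hφ.hasStrictFDerivAt

lemma notMem_of_mem_frontier {y : E3} (hy : y ∈ frontier D.G) : y ∉ D.G := by
  rw [D.isOpen.frontier_eq] at hy
  exact hy.2

lemma mem_frontier_of {y : E3} (h1 : y ∈ closure D.G) (h2 : y ∉ D.G) : y ∈ frontier D.G := by
  rw [D.isOpen.frontier_eq]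
  exact ⟨h1, h2⟩

/-- Rays in outward directions leave the closure of `G`, locally uniformly. -/
lemma eventually_notMem_closure {y w : E3} (hy : y ∈ frontier D.G)
    (hw : 0 < inner ℝ w (outwardNormal D.G y)) :
    ∀ᶠ r : (E3 × E3) × ℝ in 𝓝 ((y, w), 0), 0 < r.2 → r.1.1 ∉ D.G →
      r.1.1 + r.2 • r.1.2 ∉ closure D.G := by
  obtain ⟨ρ, O, a, ha, hO, hyO, hc, hs, hG⟩ := exists_definingFunction hy
  set L : E3 →L[ℝ] ℝ := a • innerSL ℝ (outwardNormal D.G y) with hL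
  have hLw : 0 < L w := by
    simp only [hL, smul_apply, innerSL_apply_apply, smul_eq_mul]
    rw [real_inner_comm]
    positivity
  -- Chosen so that the linearisation error, at most `ε‖w‖` per unit time, stays below the growth
  -- rate `L w` of the defining function.
  set ε := L w / (2 * (‖w‖ + 1)) with hε
  have hε0 : 0 < ε := by positivity
  have hεw : ε * ‖w‖ < L w := by
    rw [hε, div_mul_eq_mul_div, div_lt_iff₀ (by positivity)]
    nlinarith [norm_nonneg w]
  -- Strict differentiability bounds increments between two arbitrary points near `y`, which permits
  -- a moving base point outside `G`.
  have e1 := (Asymptotics.isLittleO_iff.1 hs.isLittleO) hε0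
  have t0 : Tendsto (fun r : (E3 × E3) × ℝ => r.1.1 + r.2 • r.1.2) (𝓝 ((y, w), 0)) (𝓝 y) := by
    have : Continuous fun r : (E3 × E3) × ℝ => r.1.1 + r.2 • r.1.2 := by fun_prop
    simpa using this.tendsto ((y, w), 0)
  have t1 : Tendsto (fun r : (E3 × E3) × ℝ => r.1.1) (𝓝 ((y, w), 0)) (𝓝 y) := by
    have : Continuous fun r : (E3 × E3) × ℝ => r.1.1 := by fun_prop
    simpa using this.tendsto ((y, w), 0)
  have t2 : Tendsto (fun r : (E3 × E3) × ℝ => (r.1.1 + r.2 • r.1.2, r.1.1)) (𝓝 ((y, w), 0))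
      (𝓝 (y, y)) := t0.prodMk_nhds t1
  have e2 : ∀ᶠ r : (E3 × E3) × ℝ in 𝓝 ((y, w), 0), ε * ‖r.1.2‖ < L r.1.2 := by
    have h1 : Continuous fun r : (E3 × E3) × ℝ => ε * ‖r.1.2‖ := by fun_prop
    have h2 : Continuous fun r : (E3 × E3) × ℝ => L r.1.2 := by fun_prop
    exact h1.continuousAt.eventually_lt h2.continuousAt hεw
  filter_upwards [t2.eventually e1, e2, t0 (hO.mem_nhds hyO), t1 (hO.mem_nhds hyO)]
    with r h1 h2 h3 h4 hr hnG hcl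
  have hz : 0 ≤ ρ r.1.1 := not_lt.1 fun h => hnG ((hG _ h4).2 h)
  simp only [add_sub_cancel_left, norm_smul, Real.norm_eq_abs, abs_of_pos hr, map_smul,
    smul_eq_mul] at h1
  have hpos : 0 < ρ (r.1.1 + r.2 • r.1.2) := by
    have := (abs_le.1 h1).1
    nlinarith
  -- Positivity of `ρ` persists on a neighbourhood, which therefore misses `G`; so the point is
  -- outside the closure as well.
  have hopen : IsOpen (O ∩ ρ ⁻¹' Ioi 0) := hc.isOpen_inter_preimage hO isOpen_Ioi
  obtain ⟨x, hx1, hx2⟩ := mem_closure_iff.1 hcl _ hopen ⟨h3, hpos⟩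
  exact absurd ((hG x hx1.1).1 hx2) (not_lt.2 (le_of_lt hx1.2))

lemma eventually_notMem_closure_ray {y w : E3} (hy : y ∈ frontier D.G)
    (hw : 0 < inner ℝ w (outwardNormal D.G y)) :
    ∀ᶠ s : ℝ in 𝓝 0, 0 < s → y + s • w ∉ closure D.G := by
  have h := eventually_notMem_closure hy hw
  have t : Tendsto (fun s : ℝ => ((y, w), s)) (𝓝 0) (𝓝 ((y, w), 0)) :=
    (by fun_prop : Continuous fun s : ℝ => ((y, w), s)).tendsto 0
  filter_upwards [t.eventually h] with s hs h0
  exact hs h0 (notMem_of_mem_frontier hy)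

lemma inner_nonpos_of_ray {y w : E3} (hy : y ∈ frontier D.G) {r : ℝ} (hr : 0 < r)
    (h : ∀ s, 0 < s → s < r → y + s • w ∈ D.G) : inner ℝ w (outwardNormal D.G y) ≤ 0 := by
  by_contra! hw
  have h1 := (eventually_notMem_closure_ray hy hw).filter_mono (nhdsWithin_le_nhds (s := Ioi 0))
  have h2 : ∀ᶠ s : ℝ in 𝓝[>] 0, s < r :=
    (eventually_lt_nhds hr).filter_mono nhdsWithin_le_nhds
  obtain ⟨s, h3, h4, h5⟩ := (h1.and (h2.and self_mem_nhdsWithin)).exists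
  exact h3 h5 (subset_closure (h s h5 h4))

/-- Arbitrarily close to a boundary point, the outward normal ray runs outside the closure. This is
needed because strict convexity only puts segments into the interior of the closure. -/
lemma interior_closure_subset (D : Domain) : interior (closure D.G) ⊆ D.G := by
  intro y hy
  by_contra hn
  have hf := mem_frontier_of (interior_subset hy) hn
  have hν : 0 < inner ℝ (outwardNormal D.G y) (outwardNormal D.G y) := by
    rw [real_inner_self_eq_norm_sq, (isOutwardNormal_outwardNormal hf).1]
    norm_num
  have h1 := (eventually_notMem_closure_ray hf hν).filter_mono (nhdsWithin_le_nhds (s := Ioi 0))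
  have t : Tendsto (fun s : ℝ => y + s • outwardNormal D.G y) (𝓝 0) (𝓝 y) := by
    have : Continuous fun s : ℝ => y + s • outwardNormal D.G y := by fun_prop
    simpa using this.tendsto 0
  have h2 := (t.eventually (isOpen_interior.mem_nhds hy)).filter_mono (nhdsWithin_le_nhds (s := Ioi 0))
  obtain ⟨s, h3, h4, h5⟩ := (h1.and (h2.and self_mem_nhdsWithin)).exists
  exact h3 h5 (interior_subset h4)

lemma mem_of_segment {y w : E3} {s r : ℝ} (hw : w ≠ 0) (h0 : y ∈ closure D.G)
    (h1 : y + s • w ∈ closure D.G) (hr : 0 < r) (hrs : r < s) : y + r • w ∈ D.G := by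
  have hs : 0 < s := hr.trans hrs
  refine interior_closure_subset D ?_
  have hne : y ≠ y + s • w := by
    simp [hs.ne', hw]
  have := D.strictConvex h0 h1 hne (a := 1 - r / s) (b := r / s)
    (by rw [sub_pos, div_lt_one hs]; exact hrs) (by positivity) (by ring)
  convert this using 1
  have e : (r / s) • s • w = r • w := by rw [smul_smul, div_mul_cancel₀ _ hs.ne']
  rw [smul_add, e, ← add_assoc, ← add_smul]
  simp

lemma inner_nonpos_of_mem {y w : E3} (hy : y ∈ frontier D.G) {s : ℝ} (hs : 0 < s)
    (h : y + s • w ∈ closure D.G) : inner ℝ w (outwardNormal D.G y) ≤ 0 := by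
  by_cases hw : w = 0
  · simp [hw]
  · exact inner_nonpos_of_ray hy hs fun r h1 h2 =>
      mem_of_segment hw (frontier_subset_closure hy) h h1 h2

/-- As `G` is open, the backward direction `-w` can be tilted by a small `εν` and still point into
it. The non-strict inequality for `-w + εν` then gives `w · ν ≥ ε`. -/
lemma inner_pos_of_mem {y w : E3} (hw : w ≠ 0) (hy : y ∈ frontier D.G) {s : ℝ} (hs : 0 < s)
    (h : y - s • w ∈ closure D.G) : 0 < inner ℝ w (outwardNormal D.G y) := by
  set ν := outwardNormal D.G y with hν
  have hmid : y + (s / 2) • (-w) ∈ D.G :=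
    mem_of_segment (neg_ne_zero.2 hw) (frontier_subset_closure hy)
      (by simpa [sub_eq_add_neg] using h) (half_pos hs) (half_lt_self hs)
  have t : Tendsto (fun ε : ℝ => y + (s / 2) • (-w + ε • ν)) (𝓝 0) (𝓝 (y + (s / 2) • (-w))) := by
    have : Continuous fun ε : ℝ => y + (s / 2) • (-w + ε • ν) := by fun_prop
    simpa using this.tendsto 0
  have h2 := (t.eventually (D.isOpen.mem_nhds hmid)).filter_mono (nhdsWithin_le_nhds (s := Ioi 0))
  obtain ⟨ε, h3, h4⟩ := (h2.and self_mem_nhdsWithin).exists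
  have h5 := inner_nonpos_of_mem hy (half_pos hs) (subset_closure h3)
  rw [inner_add_left, inner_neg_left, real_inner_smul_left, ← hν, real_inner_self_eq_norm_sq,
    (isOutwardNormal_outwardNormal hy).1] at h5
  have h4' : 0 < ε := h4
  linarith

lemma sphere_ne_zero (ω : S2) : (ω : E3) ≠ 0 := by
  intro h
  have := mem_sphere_zero_iff_norm.1 ω.2
  rw [h, norm_zero] at this
  exact zero_ne_one this

lemma closure_phase (D : Domain) :
    closure D.phase = closure D.G ×ˢ (univ ×ˢ Icc D.E₀ D.Em) := by
  rw [Domain.phase, closure_prod_eq, closure_prod_eq, closure_univ, closure_Ioo D.E₀_lt_Em.ne]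

lemma isCompact_closure_phase (D : Domain) : IsCompact (closure D.phase) := by
  rw [closure_phase]
  exact D.isBounded.isCompact_closure.prod (isCompact_univ.prod isCompact_Icc)

/-- Extensions of functions in `C0 D`, and their derivatives, vanish on `Γ₋ ∪ Γ₀`. -/
lemma dxw_eq_zero_of_inflow (ψ : C0 D) {f : Phase → ℝ} (w : List (Fin 3))
    (hf : SmoothX w.length f) (ef : EqOn ψ.1 f D.phase) {p : Phase} (hp : p ∈ D.inflowOrTangent) :
    dxw w f p = 0 := by
  have hn : p ∉ closure (Function.support ψ.1 ∩ D.phase) := fun h =>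
    disjoint_left.1 ψ.2.2 h hp
  have hO : IsOpen ((closure (Function.support ψ.1 ∩ D.phase))ᶜ ∩ D.phase) :=
    isClosed_closure.isOpen_compl.inter (isOpen_phase D)
  have h0 := dxw_eq_zero_of_isOpen hO w (f := f) fun q hq => by
    rw [← ef hq.2]
    exact eq_zero_of_notMem_closure_support hq.2 hq.1
  have hpc : p ∈ closure D.phase := by
    rw [closure_phase]
    exact ⟨frontier_subset_closure hp.1, mem_univ _, hp.2.1⟩
  -- The point is a limit of interior phase points off the support, where the derivative vanishes on
  -- an open set; continuity of the extension's derivative does the rest.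
  have hcl : p ∈ closure ((closure (Function.support ψ.1 ∩ D.phase))ᶜ ∩ D.phase) :=
    isClosed_closure.isOpen_compl.inter_closure ⟨hn, hpc⟩
  have hcont : Continuous (dxw w f) := (SmoothX.dxw (k := 0) w (by simpa using hf)).continuous
  exact closure_minimal h0 (isClosed_singleton.preimage hcont) hcl

end Geometry

/-! ### The streaming operator is accretive -/

section Accretive

/-- If `x ∉ G` and `x + tω ∈ G`, the segment enters `G` at a boundary point. -/
lemma exists_entry {G : Set E3} (hG : IsOpen G) {x ω : E3} {t : ℝ} (ht : 0 < t) (hx : x ∉ G)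
    (hxt : x + t • ω ∈ G) : ∃ s, 0 ≤ s ∧ s < t ∧ x + s • ω ∈ frontier G ∧
      ∀ r, 0 < r → r < t - s → (x + s • ω) + r • ω ∈ G := by
  have hc : Continuous fun s : ℝ => x + s • ω := by fun_prop
  -- The entry time is the last time in `[0, t]` at which the ray is outside `G`.
  set A := Icc 0 t ∩ (fun s : ℝ => x + s • ω) ⁻¹' Gᶜ with hA
  have hAc : IsCompact A := isCompact_Icc.inter_right (hG.isClosed_compl.preimage hc)
  have hA0 : A.Nonempty := ⟨0, ⟨le_rfl, ht.le⟩, by simpa using hx⟩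
  have hs := hAc.sSup_mem hA0
  set s := sSup A with hsdef
  have hst : s < t := by
    refine lt_of_le_of_ne hs.1.2 fun h => hs.2 ?_
    simp only [h]
    exact hxt
  have hin : ∀ r, 0 < r → r ≤ t - s → (x + s • ω) + r • ω ∈ G := by
    intro r h1 h2
    by_contra hn
    have : s + r ∈ A := ⟨⟨by linarith [hs.1.1], by linarith⟩, by
      simpa [add_smul, add_assoc] using hn⟩
    have := le_csSup hAc.bddAbove this
    linarith
  refine ⟨s, hs.1.1, hst, ?_, fun r h1 h2 => hin r h1 h2.le⟩
  rw [hG.frontier_eq]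
  refine ⟨?_, hs.2⟩
  have hlim : Tendsto (fun r : ℝ => (x + s • ω) + r • ω) (𝓝[>] 0) (𝓝 (x + s • ω)) := by
    have : Continuous fun r : ℝ => (x + s • ω) + r • ω := by fun_prop
    simpa using (this.tendsto 0).mono_left nhdsWithin_le_nhds
  refine mem_closure_of_tendsto hlim ?_
  filter_upwards [self_mem_nhdsWithin, (eventually_lt_nhds (sub_pos.2 hst)).filter_mono
    nhdsWithin_le_nhds] with r h1 h2
  exact hin r h1 h2.le

/-- `∫_G h ∂_ω h ≥ 0` if `h` vanishes where lines in direction `ω` enter `G`. -/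
lemma setIntegral_mul_fderiv_nonneg {G : Set E3} (hG : IsOpen G) (hGb : volume G < ∞) {h : E3 → ℝ}
    (hh : ContDiff ℝ 1 h) (hc : HasCompactSupport h) {ω : E3}
    (hv : ∀ y ∈ frontier G, ∀ r : ℝ, 0 < r →
      (∀ s : ℝ, 0 < s → s < r → y + s • ω ∈ G) → h y = 0) :
    0 ≤ ∫ x in G, h x * fderiv ℝ h x ω := by
  obtain ⟨L, hL⟩ := hh.lipschitzWith_of_hasCompactSupport hc (by norm_num)
  have hfc : Continuous fun x => h x * fderiv ℝ h x ω :=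
    hh.continuous.mul ((hh.continuous_fderiv (by norm_num)).clm_apply continuous_const)
  have hsq : Continuous fun x => h x ^ 2 := hh.continuous.pow 2
  have hsqc : HasCompactSupport fun x => h x ^ 2 := hc.comp_left (g := fun t => t ^ 2) (by simp)
  obtain ⟨C, hC⟩ := (hc.mul_right (f' := fun x => fderiv ℝ h x ω)).exists_bound_of_continuous hfc
  obtain ⟨C₂, hC₂⟩ := hsqc.exists_bound_of_continuous hsq
  have hfin : IsFiniteMeasure (volume.restrict G) := ⟨by simpa using hGb⟩
  -- Its derivative at `0` is `-2∫_G h ∂_ω h`, so the goal is that this derivative is nonpositive.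
  set Φ : ℝ → ℝ := fun t => ∫ x in G, h (x - t • ω) ^ 2 with hΦ
  have hd : HasDerivAt Φ (∫ x in G, -(2 * (h x * fderiv ℝ h x ω))) 0 := by
    have := hasDerivAt_integral_of_dominated_loc_of_deriv_le (μ := volume.restrict G)
      (F := fun (t : ℝ) (x : E3) => h (x - t • ω) ^ 2)
      (F' := fun t x => -(2 * (h (x - t • ω) * fderiv ℝ h (x - t • ω) ω))) (x₀ := (0 : ℝ))
      (s := univ) (bound := fun _ => 2 * C) univ_mem
      (.of_forall fun t => (hsq.comp (by fun_prop : Continuous fun x => x - t • ω)).aestronglyMeasurable)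
      (by
        refine Integrable.of_bound (C := C₂) (hsq.comp (by fun_prop :
          Continuous fun x => x - (0 : ℝ) • ω)).aestronglyMeasurable (.of_forall fun x => hC₂ _))
      ((continuous_const.mul (hfc.comp (by fun_prop :
        Continuous fun x => x - (0 : ℝ) • ω))).neg.aestronglyMeasurable)
      (.of_forall fun x t _ => by
        rw [norm_neg, norm_mul, Real.norm_two]
        exact mul_le_mul_of_nonneg_left (hC _) zero_le_two)
      (integrable_const _)
      (.of_forall fun x t _ => by
        have h1 : HasDerivAt (fun t : ℝ => x - t • ω) (-ω) t := by
          simpa using ((hasDerivAt_id t).smul_const ω).const_sub x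
        have h2 := ((hh.differentiable (by norm_num) (x - t • ω)).hasFDerivAt.comp_hasDerivAt t
          h1).pow 2
        refine h2.congr_deriv ?_
        simp
        ring)
    simpa using this.2
  -- After translation `Φ t` integrates `h²` over `G - tω`. A point there but outside `G` is within
  -- `t‖ω‖` of an entry point where `h` vanishes, so the Lipschitz bound makes its contribution
  -- quadratic in `t`.
  have hle : ∀ t > 0, Φ t ≤ Φ 0 + (L * ‖ω‖) ^ 2 * volume.real G * t ^ 2 := by
    intro t ht
    have hm : MeasurableSet G := hG.measurableSet
    have hm' : MeasurableSet ((fun x => x + t • ω) ⁻¹' G) := (by fun_prop :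
      Continuous fun x : E3 => x + t • ω).measurable hm
    have e1 : Φ t = ∫ x, ((fun x => x + t • ω) ⁻¹' G).indicator (fun x => h x ^ 2) x := by
      change ∫ x in G, h (x - t • ω) ^ 2 = _
      rw [← integral_indicator hm, ← integral_add_right_eq_self _ (t • ω)]
      congr 1
      funext x
      by_cases hx : x + t • ω ∈ G
      · simp [hx]
      · simp [hx]
    have e2 : Φ 0 = ∫ x, G.indicator (fun x => h x ^ 2) x := by
      rw [integral_indicator hm]
      simp [hΦ]
    have e3 : (L * ‖ω‖) ^ 2 * volume.real G * t ^ 2 =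
        ∫ x, ((fun x => x + t • ω) ⁻¹' G).indicator (fun _ => (L * ‖ω‖ * t) ^ 2) x := by
      rw [integral_indicator hm', setIntegral_const, measureReal_def, measureReal_def,
        measure_preimage_add_right]
      simp
      ring
    have i1 : Integrable (fun x => h x ^ 2) := hsq.integrable_of_hasCompactSupport hsqc
    have i2 : Integrable (((fun x => x + t • ω) ⁻¹' G).indicator
        (fun _ : E3 => (L * ‖ω‖ * t) ^ 2)) := by
      refine (integrable_indicator_iff hm').2 (integrableOn_const ?_)
      rw [measure_preimage_add_right]
      exact hGb.ne
    rw [e1, e2, e3, ← integral_add (i1.indicator hm) i2]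
    refine integral_mono (i1.indicator hm') ((i1.indicator hm).add i2) fun x => ?_
    by_cases hxt : x + t • ω ∈ G
    · rw [indicator_of_mem (show x ∈ (fun x => x + t • ω) ⁻¹' G from hxt),
        indicator_of_mem (show x ∈ (fun x => x + t • ω) ⁻¹' G from hxt)]
      by_cases hx : x ∈ G
      · rw [indicator_of_mem hx]
        nlinarith [sq_nonneg (L * ‖ω‖ * t)]
      · rw [indicator_of_notMem hx, zero_add]
        obtain ⟨s, h0, hst, hfr, hray⟩ := exists_entry hG ht hx hxt
        have hy := hv _ hfr (t - s) (sub_pos.2 hst) hray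
        have hd := hL.dist_le_mul x (x + s • ω)
        rw [hy, Real.dist_eq, sub_zero, dist_self_add_right, norm_smul, Real.norm_eq_abs,
          abs_of_nonneg h0] at hd
        rw [← sq_abs]
        have hb : |h x| ≤ L * ‖ω‖ * t := hd.trans (by
          have : (L : ℝ) * (s * ‖ω‖) = L * ‖ω‖ * s := by ring
          rw [this]
          gcongr)
        gcongr
    · rw [indicator_of_notMem (show x ∉ (fun x => x + t • ω) ⁻¹' G from hxt),
        indicator_of_notMem (show x ∉ (fun x => x + t • ω) ⁻¹' G from hxt), add_zero]
      exact indicator_nonneg (fun _ _ => sq_nonneg _) x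
  have hnonpos : ∫ x in G, -(2 * (h x * fderiv ℝ h x ω)) ≤ 0 := by
    -- The right-hand difference quotients are bounded by a constant times `t`, which tends to zero.
    have hs := (hasDerivWithinAt_iff_tendsto_slope' (s := Ioi 0) (by simp)).1
      (hd.hasDerivWithinAt (s := Ioi 0))
    have hr : Tendsto (fun t : ℝ => (L * ‖ω‖) ^ 2 * volume.real G * t) (𝓝[>] 0) (𝓝 0) := by
      have : Continuous fun t : ℝ => (L * ‖ω‖) ^ 2 * volume.real G * t := by fun_prop
      simpa using (this.tendsto 0).mono_left nhdsWithin_le_nhds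
    refine le_of_tendsto_of_tendsto hs hr ?_
    filter_upwards [self_mem_nhdsWithin] with t ht
    have ht' : 0 < t := ht
    rw [slope_def_field, sub_zero, div_le_iff₀ ht']
    have := hle t ht'
    nlinarith
  rw [integral_neg, integral_const_mul] at hnonpos
  linarith

variable {D : Domain} {m : ℕ}

/-- The coefficients `ω` do not depend on `x`, so only commutation of second derivatives is
involved. -/
lemma pd_streaming {f : Phase → ℝ} (hf : SmoothX 2 f) (j : Fin 3) :
    pd j (streaming f) = streaming (pd j f) := by
  have e : streaming f = fun p => ∑ i, (p.2.1 : E3) i * pd i f p := funext (streaming_eq_sum f)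
  have h : ∀ p : Phase, HasFDerivAt (fun x => ∑ i, (p.2.1 : E3) i * pd i f (x, p.2))
      (linOf fun j => ∑ i, (p.2.1 : E3) i * pd j (pd i f) p) p.1 := by
    intro p
    refine (HasFDerivAt.fun_sum fun i _ =>
      ((hf.pderiv i).hasFDerivAt p).const_mul ((p.2.1 : E3) i)).congr_fderiv ?_
    ext v
    simp only [sum_apply, smul_apply, linOf_apply, smul_eq_mul, Finset.mul_sum]
    rw [Finset.sum_comm]
    exact Finset.sum_congr rfl fun _ _ => Finset.sum_congr rfl fun _ _ => by ring
  rw [e, pd_eq_of_hasFDerivAt (g := fun j p => ∑ i, (p.2.1 : E3) i * pd j (pd i f) p) h]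
  funext p
  rw [streaming_eq_sum]
  exact Finset.sum_congr rfl fun i _ => by rw [pd_comm hf]

lemma dxw_streaming (w : List (Fin 3)) : ∀ {f : Phase → ℝ}, SmoothX (w.length + 1) f →
    dxw w (streaming f) = streaming (dxw w f) := by
  induction w with
  | nil => intro f _; rfl
  | cons i w ih =>
    intro f hf
    simp only [dxw]
    rw [pd_streaming (hf.mono (by simp)), ih (hf.pderiv i)]

lemma streaming_congr {f g : Phase → ℝ} (h : EqOn f g D.phase) :
    EqOn (streaming f) (streaming g) D.phase := by
  intro p hp
  rw [streaming_eq_sum, streaming_eq_sum]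
  exact Finset.sum_congr rfl fun i _ => by rw [pd_congr D.isOpen h i hp]

lemma continuous_streaming {f : Phase → ℝ} (hf : SmoothX 1 f) : Continuous (streaming f) := by
  have e : streaming f = fun p => ∑ i, (p.2.1 : E3) i * pd i f p := funext (streaming_eq_sum f)
  rw [e]
  refine continuous_finsetSum _ fun i _ => ?_
  have := (hf.pderiv i).continuous
  fun_prop

/-- Fubini freezes `(ω, E)`; a ray entering `G` has `ω · ν ≤ 0` at its entry point, so the vanishing
on `Γ₋ ∪ Γ₀` is what the slice estimate needs. -/
lemma integral_streaming_mul_self_nonneg {h : Phase → ℝ} (hh : SmoothX 1 h)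
    (hc : HasCompactSupport h) (hv : ∀ p ∈ D.inflowOrTangent, h p = 0) :
    0 ≤ ∫ p, h p * streaming h p ∂D.μ := by
  have hi : Integrable (fun p => h p * streaming h p) D.μ :=
    ((hh.continuous.mul (continuous_streaming hh)).integrable_of_hasCompactSupport hc.mul_right
      (μ := (volume : Measure E3).prod (sphereMeasure.prod (volume : Measure ℝ)))).restrict
  have hμ : D.μ = ((volume : Measure E3).restrict D.G).prod
      ((sphereMeasure.prod (volume : Measure ℝ)).restrict (univ ×ˢ Ioo D.E₀ D.Em)) := by
    rw [Measure.prod_restrict]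
    rfl
  rw [hμ] at hi ⊢
  rw [integral_prod_symm _ hi]
  refine integral_nonneg_of_ae ?_
  filter_upwards [ae_restrict_mem (MeasurableSet.univ.prod measurableSet_Ioo)] with q hq
  have hcq : HasCompactSupport fun x => h (x, q) :=
    HasCompactSupport.intro (hc.isCompact.image continuous_fst) fun x hx =>
      image_eq_zero_of_notMem_tsupport fun hn => hx ⟨(x, q), hn, rfl⟩
  refine setIntegral_mul_fderiv_nonneg D.isOpen (volume_G_lt_top D) (h := fun x => h (x, q))
    (by exact_mod_cast hh.contDiff q) hcq (ω := (q.1 : E3)) fun y hy r hr hray => ?_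
  exact hv (y, q) ⟨hy, Ioo_subset_Icc_self hq.2, inner_nonpos_of_ray hy hr hray⟩

/-- The streaming operator is accretive. -/
lemma inner_streamH0_nonneg (ψ : C0 D) : 0 ≤ inner ℝ (incl D m ψ) (streamH0 D m ψ) := by
  rw [streamH0_apply, Submodule.coe_inner, coe_incl, coe_incl, PiLp.inner_apply]
  refine Finset.sum_nonneg fun α _ => ?_
  obtain ⟨f, h1, h2, h3⟩ := exists_smooth_ext ψ (1 + order α.1)
  have h1' : SmoothX ((word α.1).length + 1) f := by rw [length_word, add_comm]; exact h1
  rw [L2.inner_def]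
  have e : ∫ p, inner ℝ ((jet D m ψ α : Lp ℝ 2 D.μ) p) ((jet D m (streamC0 ψ) α : Lp ℝ 2 D.μ) p) ∂D.μ
      = ∫ p, dx α.1 f p * streaming (dx α.1 f) p ∂D.μ := by
    refine integral_congr_ae ?_
    filter_upwards [jet_apply ψ α, jet_apply (streamC0 ψ) α, ae_mem_phase D] with p a1 a2 hp
    rw [a1, a2, coe_streamC0, dx_congr D α.1 (streaming_congr h3) hp, dx_congr D α.1 h3 hp,
      dx_eq_dxw, dx_eq_dxw, dxw_streaming _ h1']
    simp [mul_comm]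
  rw [e]
  refine integral_streaming_mul_self_nonneg h1.dx
    (h2.of_isClosed_subset (isClosed_tsupport _) (by rw [dx_eq_dxw]; exact tsupport_dxw _ _))
    fun p hp => ?_
  rw [dx_eq_dxw]
  exact dxw_eq_zero_of_inflow ψ _ (h1'.mono (by omega)) h3 hp

end Accretive

end Transport

end

noncomputable section

namespace Transport

/-! ### Solution of the free transport equation along characteristics -/

section Characteristics

variable {D : Domain} {m : ℕ}

/-- Points outside `G` from which the characteristic meets the closure of `G`. -/
def shadow (D : Domain) : Set Phase :=
  {p | p.1 ∉ D.G ∧ p.2.2 ∈ Icc D.E₀ D.Em ∧ ∃ s : ℝ, 0 < s ∧ p.1 + s • (p.2.1 : E3) ∈ closure D.G}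

/-- A common point would lie on the boundary with `ω · ν > 0`, because `f` avoids `Γ₋ ∪ Γ₀`. The
return times along an approximating sequence are bounded: a positive limit contradicts convexity,
and a zero limit contradicts the locally uniform exit of outward rays. -/
lemma disjoint_closure_shadow (f : C0 D) :
    Disjoint (closure (Function.support f.1 ∩ D.phase)) (closure (shadow D)) := by
  refine disjoint_left.2 fun p hp hpZ => ?_
  obtain ⟨z, hz, hzp⟩ := mem_closure_iff_seq_limit.1 hpZ
  choose h1 h2 s hs hsG using hz
  have t1 : Tendsto (fun n => (z n).1) atTop (𝓝 p.1) := (continuous_fst.tendsto p).comp hzp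
  have t2 : Tendsto (fun n => ((z n).2.1 : E3)) atTop (𝓝 (p.2.1 : E3)) :=
    ((by fun_prop : Continuous fun p : Phase => (p.2.1 : E3)).tendsto p).comp hzp
  have hpc : p ∈ closure D.phase := closure_mono inter_subset_right hp
  rw [closure_phase] at hpc
  have hfr : p.1 ∈ frontier D.G := mem_frontier_of hpc.1
    (D.isOpen.isClosed_compl.mem_of_tendsto t1 (.of_forall h1))
  have hin : 0 < inner ℝ (p.2.1 : E3) (outwardNormal D.G p.1) := by
    by_contra! hn
    exact disjoint_left.1 f.2.2 hp ⟨hfr, hpc.2.2, hn⟩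
  obtain ⟨M, hM⟩ := (Metric.isBounded_range_of_tendsto _ t1).exists_norm_le
  obtain ⟨R, hR⟩ := D.isBounded.closure.exists_norm_le
  have hb : ∀ n, s n ∈ Icc 0 (R + M) := fun n => by
    refine ⟨(hs n).le, ?_⟩
    have e : ‖s n • ((z n).2.1 : E3)‖ = s n := by
      rw [norm_smul, mem_sphere_zero_iff_norm.1 (z n).2.1.2, mul_one, Real.norm_eq_abs,
        abs_of_pos (hs n)]
    have := norm_sub_le ((z n).1 + s n • ((z n).2.1 : E3)) (z n).1
    rw [add_sub_cancel_left, e] at this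
    linarith [hR _ (hsG n), hM _ ⟨n, rfl⟩]
  obtain ⟨a, ha, φ, hφ, hφa⟩ := isCompact_Icc.tendsto_subseq hb
  have t1' := t1.comp hφ.tendsto_atTop
  have t2' := t2.comp hφ.tendsto_atTop
  have hmem : p.1 + a • (p.2.1 : E3) ∈ closure D.G :=
    isClosed_closure.mem_of_tendsto (t1'.add (hφa.smul t2')) (.of_forall fun n => hsG (φ n))
  rcases ha.1.eq_or_lt with h0 | h0
  · rw [← h0] at hφa
    obtain ⟨n, hn⟩ := (((t1'.prodMk_nhds t2').prodMk_nhds hφa).eventually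
      (eventually_notMem_closure hfr hin)).exists
    exact hn (hs _) (h1 _) (hsG _)
  · exact absurd (inner_nonpos_of_mem hfr h0 hmem) (not_le.2 hin)

/-- Integration over `[0, L]` is a continuous linear functional on `C([0, L])`, so smoothness
follows from currying and composition with it. -/
lemma smoothX_intervalIntegral {Q : Type*} [TopologicalSpace Q] {k : ℕ} {f : E3 × (Q × ℝ) → ℝ}
    (hf : SmoothX k f) {L : ℝ} (hL : 0 ≤ L) :
    SmoothX k fun p : E3 × Q => ∫ s in (0 : ℝ)..L, f (p.1, (p.2, s)) := by
  set ν : Measure (Icc (0 : ℝ) L) := Measure.comap Subtype.val volume with hν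
  have hfin : IsFiniteMeasure ν :=
    ⟨by rw [hν, comap_subtype_coe_apply measurableSet_Icc, image_univ, Subtype.range_coe]; simp⟩
  have h1 := SmoothX.reparam (R := Q × Icc (0 : ℝ) L) (v := fun _ => (0 : E3))
    (q := fun r => (r.1, (r.2 : ℝ))) continuous_const (by fun_prop) hf
  have h2 := h1.curry.clm ((L1.integralCLM (μ := ν)).comp (ContinuousMap.toLp (E := ℝ) 1 ν ℝ))
  convert h2 using 2 with p
  rw [intervalIntegral.integral_of_le hL, ← integral_Icc_eq_integral_Ioc,
    ← integral_subtype_comap measurableSet_Icc]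
  set c : C(Icc (0 : ℝ) L, ℝ) :=
    ⟨fun y => f (p.1 + 0, (p.2, (y : ℝ))), h1.continuous.comp
      (by fun_prop : Continuous fun y : Icc (0 : ℝ) L => (p.1, (p.2, y)))⟩ with hc
  change _ = L1.integralCLM (ContinuousMap.toLp (E := ℝ) 1 ν ℝ c)
  rw [← L1.integral_eq, L1.integral_eq_integral]
  refine integral_congr_ae ?_
  filter_upwards [ContinuousMap.coeFn_toLp (p := 1) (𝕜 := ℝ) ν c] with y hy
  rw [hy]
  simp [hc]

/-- Integration of `e^{-λs} g` along the backward characteristics. -/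
def charIntegral (lam L : ℝ) (g : Phase → ℝ) : Phase → ℝ :=
  fun p => ∫ s in (0 : ℝ)..L, Real.exp (-lam * s) * g (p.1 - s • (p.2.1 : E3), p.2)

lemma SmoothX.charIntegral {k : ℕ} {g : Phase → ℝ} (hg : SmoothX k g) (lam : ℝ) {L : ℝ}
    (hL : 0 ≤ L) : SmoothX k (charIntegral lam L g) := by
  have h1 : SmoothX k fun p : E3 × ((S2 × ℝ) × ℝ) => Real.exp (-lam * p.2.2) :=
    smoothX_of_param (a := fun q : (S2 × ℝ) × ℝ => Real.exp (-lam * q.2)) (by fun_prop) k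
  have h2 : SmoothX k fun p : E3 × ((S2 × ℝ) × ℝ) => g (p.1 + -(p.2.2 • (p.2.1.1 : E3)), p.2.1) :=
    SmoothX.reparam (R := (S2 × ℝ) × ℝ) (v := fun q => -(q.2 • (q.1.1 : E3))) (q := fun q => q.1)
      (by fun_prop) (by fun_prop) hg
  have h3 := smoothX_intervalIntegral (h1.mul h2) hL
  simp only [← sub_eq_add_neg, Pi.mul_apply] at h3
  exact h3

lemma charIntegral_eq_zero {lam L : ℝ} (hL : 0 ≤ L) {g : Phase → ℝ} {p : Phase}
    (h : ∀ s ∈ Icc 0 L, g (p.1 - s • (p.2.1 : E3), p.2) = 0) : charIntegral lam L g p = 0 := by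
  rw [charIntegral, intervalIntegral.integral_congr (g := fun _ => (0 : ℝ)),
    intervalIntegral.integral_zero]
  intro s hs
  rw [uIcc_of_le hL] at hs
  simp [h s hs]

/-- The image of a set under the forward characteristic flow. -/
lemma isCompact_flow {K : Set Phase} (hK : IsCompact K) (L : ℝ) :
    IsCompact {p : Phase | ∃ s ∈ Icc 0 L, (p.1 - s • (p.2.1 : E3), p.2) ∈ K} := by
  have := (hK.prod (isCompact_Icc (a := (0 : ℝ)) (b := L))).image
    (f := fun r : Phase × ℝ => ((r.1.1 + r.2 • (r.1.2.1 : E3), r.1.2) : Phase)) (by fun_prop)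
  convert this using 1
  ext p
  constructor
  · rintro ⟨s, hs, hp⟩
    exact ⟨((p.1 - s • (p.2.1 : E3), p.2), s), ⟨hp, hs⟩, by simp⟩
  · rintro ⟨⟨q, s⟩, ⟨h1, h2⟩, rfl⟩
    exact ⟨s, h2, by simpa using h1⟩

/-- Shifting the base point by `tω` becomes, after substitution, a shift of both integration limits
and a factor `e^{-λt}`. Differentiating at `t = 0` leaves the value at the lower limit; the upper
one vanishes by hypothesis. -/
lemma streaming_charIntegral {lam L : ℝ} (hL : 0 ≤ L) {g : Phase → ℝ} (hg : SmoothX 1 g) {p : Phase}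
    (h : g (p.1 - L • (p.2.1 : E3), p.2) = 0) :
    streaming (charIntegral lam L g) p + lam * charIntegral lam L g p = g p := by
  set ω : E3 := p.2.1.1 with hω
  set u : ℝ → ℝ := fun s => Real.exp (-lam * s) * g (p.1 - s • ω, p.2) with hu
  have huc : Continuous u := by
    have := hg.continuous
    fun_prop
  have e : ∀ t : ℝ, charIntegral lam L g (p.1 + t • ω, p.2) =
      Real.exp (-lam * t) * ((∫ s in (0 : ℝ)..(L - t), u s) - ∫ s in (0 : ℝ)..(0 - t), u s) := by
    intro t
    rw [intervalIntegral.integral_interval_sub_left (huc.intervalIntegrable _ _)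
      (huc.intervalIntegrable _ _), ← intervalIntegral.integral_comp_sub_right,
      ← intervalIntegral.integral_const_mul, charIntegral]
    refine intervalIntegral.integral_congr fun s _ => ?_
    simp only [hu]
    rw [← mul_assoc, ← Real.exp_add]
    congr 2
    · ring
    · congr 1
      rw [sub_smul]
      abel
  have hU : ∀ b : ℝ, HasDerivAt (fun t => ∫ s in (0 : ℝ)..t, u s) (u b) b := fun b =>
    (huc.integral_hasStrictDerivAt 0 b).hasDerivAt
  have hU' : ∀ a : ℝ, HasDerivAt (fun t => ∫ s in (0 : ℝ)..(a - t), u s) (-u a) 0 := fun a => by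
    have h1 : HasDerivAt (fun t : ℝ => a - t) (-1) 0 := (hasDerivAt_id 0).const_sub a
    have h2 := hU (a - 0)
    have h3 := h2.comp (0 : ℝ) h1
    rw [sub_zero, mul_neg_one] at h3
    exact h3
  have hexp : HasDerivAt (fun t : ℝ => Real.exp (-lam * t)) (-lam) 0 := by
    simpa using ((hasDerivAt_id (0 : ℝ)).const_mul (-lam)).exp
  have hd := hexp.mul ((hU' L).sub (hU' 0))
  have hF := (hg.charIntegral lam hL).hasFDerivAt p
  have hline : HasDerivAt (fun t : ℝ => p.1 + t • ω) ω 0 := by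
    simpa using ((hasDerivAt_id (0 : ℝ)).smul_const ω).const_add p.1
  have hF' : HasFDerivAt (fun x => charIntegral lam L g (x, p.2))
      (linOf fun i => pd i (charIntegral lam L g) p) (p.1 + (0 : ℝ) • ω) := by simpa using hF
  have hcomp := hF'.comp_hasDerivAt (0 : ℝ) hline
  have hd' : HasDerivAt (fun t : ℝ => charIntegral lam L g (p.1 + t • ω, p.2)) _ 0 :=
    hd.congr_of_eventuallyEq (.of_forall e)
  have key := hcomp.unique hd'
  have e0 := e 0
  have hst : streaming (charIntegral lam L g) p =
      (linOf fun i => pd i (charIntegral lam L g) p) ω := by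
    rw [streaming, fderiv_eq_linOf]
  rw [hst, key]
  have huL : u L = 0 := by simp [hu, h]
  have hu0 : u 0 = g p := by simp [hu]
  simp only [zero_smul, add_zero, sub_zero, mul_zero, Real.exp_zero, one_mul,
    intervalIntegral.integral_same, Prod.mk.eta] at e0 ⊢
  rw [huL, hu0, e0]
  simp

/-- The free transport equation `ω · ∇ₓψ + λψ = f` has a smooth solution vanishing near the inflow
boundary if `f` is smooth and vanishes there. -/
lemma exists_free_solution (f : C0 D) {lam : ℝ} :
    ∃ ψ : C0 D, EqOn (fun p => streaming ψ.1 p + lam * ψ.1 p) f.1 D.phase := by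
  set K := closure (Function.support f.1 ∩ D.phase) with hK
  have hKc : IsCompact K :=
    (isCompact_closure_phase D).of_isClosed_subset isClosed_closure (closure_mono inter_subset_right)
  -- `χ` is `1` on the support of `f` and `0` near the shadow, so `χ` times an extension of `f`
  -- acts, along backward characteristics from `G`, as the zero extension of `f`.
  obtain ⟨χ, hχ, -, hχ1⟩ := exists_test isClosed_closure.isOpen_compl hKc
    (disjoint_left.1 (disjoint_closure_shadow f) : K ⊆ (closure (shadow D))ᶜ)
  obtain ⟨R, hR0, hR⟩ := D.isBounded.exists_pos_norm_le
  -- Larger than the diameter of `G`: a backward characteristic of length `L` starting in `G` has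
  -- left it.
  set L := 2 * R + 1 with hLdef
  have hL : 0 < L := by positivity
  have hback : ∀ p ∈ D.phase, ∀ s : ℝ, 0 ≤ s → (p.1 - s • (p.2.1 : E3), p.2) ∉ D.phase →
      χ (p.1 - s • (p.2.1 : E3), p.2) = 0 := by
    intro p hp s hs hn
    refine hχ.eq_zero fun hU => hU (subset_closure ?_)
    have hnG : p.1 - s • (p.2.1 : E3) ∉ D.G := fun h => hn ⟨h, hp.2⟩
    rcases hs.eq_or_lt with h0 | h0
    · rw [← h0] at hnG
      exact absurd hp.1 (by simpa using hnG)
    · exact ⟨hnG, Ioo_subset_Icc_self hp.2.2, s, h0, by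
        simpa using subset_closure hp.1⟩
  choose F hF1 hF2 hF3 using exists_smooth_ext f
  have hχF : ∀ k, ∀ p ∈ D.phase, ∀ s : ℝ, 0 ≤ s → (χ * F k) (p.1 - s • (p.2.1 : E3), p.2) =
      χ (p.1 - s • (p.2.1 : E3), p.2) * f.1 (p.1 - s • (p.2.1 : E3), p.2) := by
    intro k p hp s hs
    rw [Pi.mul_apply]
    by_cases h : (p.1 - s • (p.2.1 : E3), p.2) ∈ D.phase
    · rw [hF3 k h]
    · rw [hback p hp s hs h, zero_mul, zero_mul]
  have hsm : ∀ k, SmoothX k (charIntegral lam L (χ * F k)) := fun k =>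
    ((hχ.smoothX k).mul (hF1 k)).charIntegral lam hL.le
  -- The extensions `F k` vary with the order of smoothness, but on the phase space they all define
  -- the same solution, which thus has extensions of every order.
  have heq : ∀ k, EqOn (charIntegral lam L (χ * F 1)) (charIntegral lam L (χ * F k)) D.phase := by
    intro k p hp
    refine intervalIntegral.integral_congr fun s hs => ?_
    rw [uIcc_of_le hL.le] at hs
    simp only [hχF _ p hp s hs.1]
  have hcomp : ∀ k, HasCompactSupport (charIntegral lam L (χ * F k)) := by
    intro k
    refine HasCompactSupport.intro (isCompact_flow hχ.compact.isCompact L) fun p hp => ?_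
    refine charIntegral_eq_zero hL.le fun s hs => ?_
    rw [Pi.mul_apply, image_eq_zero_of_notMem_tsupport fun h => hp ⟨s, hs, h⟩, zero_mul]
  -- The support is carried by the forward flow of the support of `f`. After positive time a flowed
  -- boundary point has `ω · ν > 0` by strict convexity; at time zero the hypothesis on `f` applies.
  have hav : AvoidsInflow D (charIntegral lam L (χ * F 1)) := by
    refine Disjoint.mono_left (closure_minimal (fun p hp => ?_) (isCompact_flow hKc L).isClosed)
      (disjoint_left.2 ?_)
    · by_contra hn
      refine hp.1 (charIntegral_eq_zero hL.le fun s hs => ?_)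
      rw [hχF 1 p hp.2 s hs.1]
      by_cases h : (p.1 - s • (p.2.1 : E3), p.2) ∈ D.phase
      · rw [eq_zero_of_notMem_closure_support h fun h' => hn ⟨s, hs, h'⟩, mul_zero]
      · rw [hback p hp.2 s hs.1 h, zero_mul]
    · rintro p ⟨s, hs, hpK⟩ hpin
      rcases hs.1.eq_or_lt with h0 | h0
      · rw [← h0] at hpK
        exact disjoint_left.1 f.2.2 (by simpa using hpK) hpin
      · have hpc : (p.1 - s • (p.2.1 : E3), p.2) ∈ closure D.phase :=
          closure_mono inter_subset_right hpK
        rw [closure_phase] at hpc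
        exact absurd hpin.2.2 (not_le.2 (inner_pos_of_mem (sphere_ne_zero _) hpin.1 h0 hpc.1))
  refine ⟨⟨_, mem_C0_of (fun k => ⟨_, hsm k, hcomp k, heq k⟩) hav⟩, fun p hp => ?_⟩
  have hpL : (p.1 - L • (p.2.1 : E3), p.2) ∉ D.phase := fun h => by
    have h1 := norm_sub_le p.1 (p.1 - L • (p.2.1 : E3))
    rw [sub_sub_cancel, norm_smul, mem_sphere_zero_iff_norm.1 p.2.1.2, mul_one, Real.norm_eq_abs,
      abs_of_pos hL] at h1
    have h2 := hR _ hp.1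
    have h3 := hR _ h.1
    simp only at h3
    linarith
  have h := streaming_charIntegral (lam := lam) hL.le ((hχ.smoothX 1).mul (hF1 1)) (p := p) (by
    rw [Pi.mul_apply, hback p hp L hL.le hpL, zero_mul])
  simp only
  rw [h, Pi.mul_apply, ← hF3 1 hp]
  by_cases hfp : f.1 p = 0
  · rw [hfp, mul_zero]
  · rw [hχ1 p (subset_closure ⟨hfp, hp⟩), one_mul]

end Characteristics

end Transport

end

noncomputable section

namespace Transport

/-! ### Bounded perturbations of maximal accretive relations -/

section Accretive

variable {H : Type*} [NormedAddCommGroup H] [InnerProductSpace ℝ H]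

/-- A closed accretive linear relation in a Hilbert space whose positive shifts have dense range. -/
structure IsMaximalAccretive (S : Submodule ℝ (H × H)) : Prop where
  isClosed : IsClosed (S : Set (H × H))
  inner_nonneg : ∀ w ∈ S, 0 ≤ inner ℝ w.1 w.2
  dense : ∀ C : ℝ, 0 < C → Dense {f : H | ∃ u, (u, f - C • u) ∈ S}

namespace IsMaximalAccretive

variable {S : Submodule ℝ (H × H)} (hS : IsMaximalAccretive S)

include hS

/-- Pair the right-hand side with `u`: accretivity drops the `v`-term, and `B` costs at most `‖B‖
‖u‖²`. -/
lemma norm_le {u v : H} (h : (u, v) ∈ S) (C : ℝ) (B : H →L[ℝ] H) :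
    (C - ‖B‖) * ‖u‖ ≤ ‖v + C • u + B u‖ := by
  rcases (norm_nonneg u).eq_or_lt with h0 | h0
  · rw [← h0, mul_zero]
    exact norm_nonneg _
  have h1 : 0 ≤ inner ℝ u v := hS.inner_nonneg _ h
  have h2 := real_inner_le_norm u (v + C • u + B u)
  have h3 := abs_le.1 (abs_real_inner_le_norm u (B u))
  have h4 := B.le_opNorm u
  rw [inner_add_right, inner_add_right, real_inner_smul_right, real_inner_self_eq_norm_sq] at h2
  have h5 : ‖u‖ * ‖B u‖ ≤ ‖u‖ * (‖B‖ * ‖u‖) := mul_le_mul_of_nonneg_left h4 h0.le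
  refine le_of_mul_le_mul_left ?_ h0
  nlinarith

lemma eq_of_mem {C : ℝ} {B : H →L[ℝ] H} (hB : ‖B‖ < C) {u u' f : H}
    (h : (u, f - C • u - B u) ∈ S) (h' : (u', f - C • u' - B u') ∈ S) : u = u' := by
  have hs := S.sub_mem h h'
  rw [Prod.mk_sub_mk] at hs
  have h1 := hS.norm_le hs C B
  have e : f - C • u - B u - (f - C • u' - B u') + C • (u - u') + B (u - u') = 0 := by
    rw [map_sub, smul_sub]
    abel
  rw [e, norm_zero] at h1
  by_contra hn
  exact absurd h1 (not_le.2 (mul_pos (sub_pos.2 hB) (norm_pos_iff.2 (sub_ne_zero.2 hn))))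

variable [CompleteSpace H]

/-- The lower bound makes `(u, v) ↦ v + Cu` antilipschitz on the complete graph, so its range is
closed; being dense, it is everything. -/
lemma exists_mem {C : ℝ} (hC : 0 < C) (f : H) : ∃ u : H, (u, f - C • u) ∈ S := by
  let T : S →L[ℝ] H :=
    (ContinuousLinearMap.snd ℝ H H + C • ContinuousLinearMap.fst ℝ H H).comp S.subtypeL
  have hT : ∀ w : S, T w = w.1.2 + C • w.1.1 := fun w => rfl
  have hlow : ∀ w : S, C * ‖w.1.1‖ ≤ ‖T w‖ := fun w => by
    simpa [hT] using hS.norm_le w.2 C 0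
  have hcs : CompleteSpace S := hS.isClosed.completeSpace_coe
  have hanti : AntilipschitzWith (Real.toNNReal (2 + 1 / C)) T := by
    refine T.antilipschitz_of_bound fun w => ?_
    have h1 := hlow w
    have h2 : ‖w.1.1‖ ≤ (1 / C) * ‖T w‖ := by
      rw [one_div, inv_mul_eq_div, le_div_iff₀ hC]
      linarith
    have h3 : ‖w.1.2‖ ≤ 2 * ‖T w‖ := by
      have := norm_sub_le (T w) (C • w.1.1)
      rw [norm_smul, Real.norm_eq_abs, abs_of_pos hC] at this
      rw [hT, add_sub_cancel_right, ← hT] at this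
      linarith
    rw [← Submodule.norm_coe, Prod.norm_def]
    have h4 := norm_nonneg (T w)
    have h5 : 0 ≤ 1 / C * ‖T w‖ := by positivity
    rw [Real.coe_toNNReal _ (by positivity), add_mul]
    exact max_le (by linarith) (by linarith)
  have hrange : IsClosed (range T) := hanti.isClosed_range T.uniformContinuous
  have hsub : {f : H | ∃ u, (u, f - C • u) ∈ S} ⊆ range T := by
    rintro f ⟨u, hu⟩
    exact ⟨⟨_, hu⟩, by rw [hT]; simp⟩
  obtain ⟨w, hw⟩ : f ∈ range T := by
    rw [← hrange.closure_eq]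
    exact (hS.dense C hC).mono hsub f
  refine ⟨w.1.1, ?_⟩
  rw [← hw, hT, add_sub_cancel_right]
  exact w.2

/-- The resolvent of a maximal accretive relation. -/
lemma exists_resolvent {C : ℝ} (hC : 0 < C) :
    ∃ R : H →L[ℝ] H, ‖R‖ ≤ 1 / C ∧ ∀ f, (R f, f - C • R f) ∈ S := by
  choose R hR using fun f : H => hS.exists_mem hC f
  have huniq : ∀ {u f : H}, (u, f - C • u) ∈ S → R f = u := fun {u f} h =>
    hS.eq_of_mem (B := 0) (C := C) (f := f) (by simpa using hC) (by simpa using hR f)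
      (by simpa using h)
  let R' : H →ₗ[ℝ] H :=
    { toFun := R
      map_add' := fun f g => huniq <| by
        convert S.add_mem (hR f) (hR g) using 1
        rw [Prod.mk_add_mk, smul_add]
        congr 1
        abel
      map_smul' := fun c f => huniq <| by
        convert S.smul_mem c (hR f) using 1
        rw [Prod.smul_mk, smul_sub, smul_comm c C]
        rfl }
  have hb : ∀ f, ‖R' f‖ ≤ 1 / C * ‖f‖ := fun f => by
    have h := hS.norm_le (hR f) C 0
    simp only [norm_zero, sub_zero, sub_add_cancel, zero_apply, add_zero] at h
    rw [one_div, inv_mul_eq_div, le_div_iff₀ hC, mul_comm]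
    exact h
  exact ⟨R'.mkContinuous _ hb, R'.mkContinuous_norm_le (by positivity) hb, hR⟩

/-- With `u = R g` the equation becomes `g + B R g = f`, solvable by a Neumann series since `‖BR‖ ≤
‖B‖ / C < 1`. -/
lemma exists_perturbed {C : ℝ} {B : H →L[ℝ] H} (hB : ‖B‖ < C) (f : H) :
    ∃ u : H, (u, f - C • u - B u) ∈ S := by
  have hC : 0 < C := (norm_nonneg B).trans_lt hB
  obtain ⟨R, hR, hRg⟩ := hS.exists_resolvent hC
  have hn : ‖-(B * R)‖ < 1 := by
    rw [norm_neg]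
    calc ‖B * R‖ ≤ ‖B‖ * ‖R‖ := norm_mul_le _ _
      _ ≤ ‖B‖ * (1 / C) := mul_le_mul_of_nonneg_left hR (norm_nonneg _)
      _ < 1 := by rw [mul_one_div, div_lt_one hC]; exact hB
  obtain ⟨T, hT⟩ := isUnit_one_sub_of_norm_lt_one hn
  set g := (T⁻¹ : (H →L[ℝ] H)ˣ).1 f with hg
  have e : g + B (R g) = f := by
    have : (T.1 * (T⁻¹).1) f = f := by rw [T.mul_inv]; rfl
    rw [hT] at this
    simpa using this
  refine ⟨R g, ?_⟩
  convert hRg g using 2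
  rw [← e]
  abel

end IsMaximalAccretive

end Accretive

/-! ### The closed streaming operator -/

section StreamGraph

variable {D : Domain} {m : ℕ}

/-- The graph of the closure of the streaming operator in `H₀`. -/
def streamGraph (D : Domain) (m : ℕ) : Submodule ℝ (H0 D m × H0 D m) :=
  (LinearMap.range ((incl D m).prod (streamH0 D m))).topologicalClosure

instance : CompleteSpace (H0 D m) :=
  (Submodule.isClosed_topologicalClosure _).completeSpace_coe

lemma mem_streamGraph (ψ : C0 D) : (incl D m ψ, streamH0 D m ψ) ∈ streamGraph D m :=
  Submodule.le_topologicalClosure _ ⟨ψ, rfl⟩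

lemma isMaximalAccretive_streamGraph (D : Domain) (m : ℕ) :
    IsMaximalAccretive (streamGraph D m) where
  isClosed := Submodule.isClosed_topologicalClosure _
  inner_nonneg w h := by
    have hcl : IsClosed {w : H0 D m × H0 D m | 0 ≤ inner ℝ w.1 w.2} :=
      isClosed_le continuous_const (continuous_fst.inner continuous_snd)
    refine closure_minimal ?_ hcl h
    rintro _ ⟨ψ, rfl⟩
    exact inner_streamH0_nonneg ψ
  dense C _ := (dense_range_incl D m).mono <| by
    rintro _ ⟨f, rfl⟩
    obtain ⟨ψ, hψ⟩ := exists_free_solution f (lam := C)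
    refine ⟨incl D m ψ, ?_⟩
    have e : incl D m f = streamH0 D m ψ + C • incl D m ψ := by
      rw [streamH0_apply, ← map_smul, ← map_add]
      refine incl_congr fun p hp => ?_
      rw [← hψ hp, ← coe_streamC0]
      rfl
    rw [e, add_sub_cancel_right]
    exact mem_streamGraph ψ

end StreamGraph

end Transport

end

noncomputable section

namespace Transport

/-! ### The transport operator and its closure -/

section TransportOperator

variable {D : Domain} {m : ℕ} {Sig : Phase → ℝ} {σ : KPhase → ℝ}

/-- The operator `ω · ∇ₓ + B` on smooth functions, with values in `H₀`. -/
def perturbed (B : H0 D m →L[ℝ] H0 D m) : C0 D →ₗ[ℝ] H0 D m :=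
  streamH0 D m + B.toLinearMap ∘ₗ incl D m

lemma perturbed_apply (B : H0 D m →L[ℝ] H0 D m) (ψ : C0 D) :
    perturbed B ψ = streamH0 D m ψ + B (incl D m ψ) := rfl

/-- The shear `(u, v) ↦ (u, v - Bu)` and its inverse are continuous and exchange the two graphs,
hence also their closures. -/
lemma mem_closure_perturbed_iff (B : H0 D m →L[ℝ] H0 D m) {u v : H0 D m} :
    (u, v) ∈ (LinearMap.range ((incl D m).prod (perturbed B))).topologicalClosure ↔
      (u, v - B u) ∈ streamGraph D m := by
  have hB : Continuous B := B.continuous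
  constructor
  · intro h
    refine map_mem_closure (f := fun w : H0 D m × H0 D m => (w.1, w.2 - B w.1)) (by fun_prop) h ?_
    rintro _ ⟨ψ, rfl⟩
    exact ⟨ψ, Prod.ext rfl (by simp [perturbed_apply])⟩
  · intro h
    have := map_mem_closure (f := fun w : H0 D m × H0 D m => (w.1, w.2 + B w.1))
      (t := LinearMap.range ((incl D m).prod (perturbed B))) (by fun_prop) h (by
        rintro _ ⟨ψ, rfl⟩
        exact ⟨ψ, Prod.ext rfl (by simp [perturbed_apply])⟩)
    rw [sub_add_cancel] at this
    exact this

lemma isWeakStreaming_of_mem {u v : H0 D m} (h : (u, v) ∈ streamGraph D m) :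
    IsWeakStreaming D (toFn u) (toFn v) :=
  isWeakStreaming_of_mem_closure h

lemma eq_zero_of_mem_closure_perturbed (B : H0 D m →L[ℝ] H0 D m) {w : H0 D m × H0 D m}
    (h : w ∈ (LinearMap.range ((incl D m).prod (perturbed B))).topologicalClosure)
    (h0 : w.1 = 0) : w.2 = 0 := by
  have h1 := eq_zero_of_isWeakStreaming h0
    (isWeakStreaming_of_mem ((mem_closure_perturbed_iff B (u := w.1) (v := w.2)).1 h))
  rw [h0, map_zero, sub_zero] at h1
  exact h1

variable {M K : H0 D m →L[ℝ] H0 D m}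
  (hM : ∀ u : H0 D m, toFn (M u) =ᵐ[D.μ] fun p => Sig p * toFn u p)
  (hK : IsCollisionOperator D m σ K)

include hM hK

lemma toFn_perturbed (ψ : C0 D) : toFn (perturbed (M - K) ψ) =ᵐ[D.μ]
    fun p => streaming ψ.1 p + Sig p * ψ.1 p - collision σ ψ.1 p := by
  filter_upwards [toFn_add (streamH0 D m ψ) ((M - K) (incl D m ψ)),
    toFn_sub (M (incl D m ψ)) (K (incl D m ψ)), toFn_streamH0 (m := m) ψ, hM (incl D m ψ),
    hK (incl D m ψ), toFn_incl (m := m) ψ,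
    collision_congr (D := D) (g := σ) (g' := σ) (ae_eq_refl _) (toFn_incl (m := m) ψ)]
    with p h1 h2 h3 h4 h5 h6 h7
  rw [perturbed_apply, h1, Pi.add_apply, h3]
  rw [sub_apply, h2, Pi.sub_apply, h4, h5, h6, h7]
  ring

lemma graph_eq_of_isTransportOperator {Q : H0 D m →ₗ.[ℝ] H0 D m}
    (hQ : IsTransportOperator D m Sig σ Q) :
    Q.graph = LinearMap.range ((incl D m).prod (perturbed (M - K))) := by
  have key : ∀ (ψ : C0 D) (u : Q.domain), (u : H0 D m) = incl D m ψ → Q u = perturbed (M - K) ψ :=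
    fun ψ u hu => toFn_injective ((hQ.2 ψ u hu).trans (toFn_perturbed hM hK ψ).symm)
  ext w
  rw [LinearPMap.mem_graph_iff]
  constructor
  · rintro ⟨u, h1, h2⟩
    obtain ⟨ψ, hψ⟩ : (u : H0 D m) ∈ LinearMap.range (incl D m) := hQ.1 ▸ u.2
    exact ⟨ψ, Prod.ext (hψ.trans h1) ((key ψ u hψ.symm).symm.trans h2)⟩
  · rintro ⟨ψ, rfl⟩
    have hd : incl D m ψ ∈ Q.domain := hQ.1 ▸ LinearMap.mem_range_self _ ψ
    exact ⟨⟨_, hd⟩, rfl, key ψ ⟨_, hd⟩ rfl⟩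

lemma exists_isTransportOperator : ∃ Q : H0 D m →ₗ.[ℝ] H0 D m, IsTransportOperator D m Sig σ Q := by
  set g := LinearMap.range ((incl D m).prod (perturbed (M - K))) with hg
  have h0 : ∀ x ∈ g, x.1 = 0 → x.2 = 0 := fun x hx =>
    eq_zero_of_mem_closure_perturbed (M - K) (Submodule.le_topologicalClosure _ hx)
  refine ⟨g.toLinearPMap, ?_, fun ψ u hu => ?_⟩
  · rw [Submodule.toLinearPMap_domain]
    ext u
    constructor
    · rintro ⟨_, ⟨ψ, rfl⟩, rfl⟩
      exact ⟨ψ, rfl⟩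
    · rintro ⟨ψ, rfl⟩
      exact ⟨_, ⟨ψ, rfl⟩, rfl⟩
  · obtain ⟨χ, hχ⟩ := Submodule.mem_graph_toLinearPMap h0 u
    have h1 : incl D m χ = incl D m ψ := (congrArg Prod.fst hχ).trans hu
    have h2 : perturbed (M - K) χ = g.toLinearPMap u := congrArg Prod.snd hχ
    -- `incl` identifies functions that agree on the phase space, so independence of the
    -- representative has to be checked; it follows from single-valuedness of the graph.
    have h3 : perturbed (M - K) (ψ - χ) = 0 := by
      refine h0 (incl D m (ψ - χ), _) ⟨ψ - χ, rfl⟩ ?_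
      simp only
      rw [map_sub, h1, sub_self]
    rw [map_sub, sub_eq_zero] at h3
    rw [← h2, ← h3]
    exact toFn_perturbed hM hK ψ

lemma existsUnique_isTransportOperator :
    ∃! Q : H0 D m →ₗ.[ℝ] H0 D m, IsTransportOperator D m Sig σ Q := by
  obtain ⟨Q, hQ⟩ := exists_isTransportOperator hM hK
  refine ⟨Q, hQ, fun Q' hQ' => LinearPMap.eq_of_eq_graph ?_⟩
  rw [graph_eq_of_isTransportOperator hM hK hQ, graph_eq_of_isTransportOperator hM hK hQ']

lemma IsTransportOperator.isClosable {Q : H0 D m →ₗ.[ℝ] H0 D m}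
    (hQ : IsTransportOperator D m Sig σ Q) : Q.IsClosable := by
  rw [LinearPMap.IsClosable, graph_eq_of_isTransportOperator hM hK hQ]
  exact ⟨_, (Submodule.toLinearPMap_graph_eq _ fun x hx =>
    eq_zero_of_mem_closure_perturbed (M - K) hx).symm⟩

lemma IsTransportOperator.mem_graph_closure_iff {Q : H0 D m →ₗ.[ℝ] H0 D m}
    (hQ : IsTransportOperator D m Sig σ Q) {u v : H0 D m} :
    (u, v) ∈ Q.closure.graph ↔ (u, v - (M - K) u) ∈ streamGraph D m := by
  rw [← (hQ.isClosable hM hK).graph_closure_eq_closure_graph,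
    graph_eq_of_isTransportOperator hM hK hQ, mem_closure_perturbed_iff]

lemma IsTransportOperator.isStrongSolution_iff {Q : H0 D m →ₗ.[ℝ] H0 D m}
    (hQ : IsTransportOperator D m Sig σ Q) {C : ℝ} {f ψ : H0 D m} :
    IsStrongSolution Q C f ψ ↔ (ψ, f - C • ψ - (M - K) ψ) ∈ streamGraph D m := by
  rw [← hQ.mem_graph_closure_iff hM hK, LinearPMap.mem_graph_iff]
  constructor
  · rintro ⟨h, e⟩
    exact ⟨⟨ψ, h⟩, rfl, eq_sub_of_add_eq e⟩
  · rintro ⟨⟨u, hu⟩, rfl, e⟩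
    exact ⟨hu, add_eq_of_eq_sub e⟩

end TransportOperator

/-! ### Strong solutions solve the inflow problem -/

section Inflow

variable {D : Domain} {m : ℕ} {Sig : Phase → ℝ} {σ : KPhase → ℝ}

lemma tendsto_eLpNorm_of_tendsto {a : ℕ → H0 D m} {u : H0 D m} (h : Tendsto a atTop (𝓝 u))
    {F : ℕ → Phase → ℝ} (hF : ∀ n, toFn (a n) =ᵐ[D.μ] F n) :
    Tendsto (fun n => eLpNorm (F n - toFn u) 2 D.μ) atTop (𝓝 0) := by
  have hc : Continuous fun u : H0 D m => (u.1 (zeroIdx m) : Lp ℝ 2 D.μ) :=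
    (continuous_component _).comp continuous_subtype_val
  have h1 := (Lp.tendsto_Lp_iff_tendsto_eLpNorm' _ _).1 ((hc.tendsto u).comp h)
  refine h1.congr fun n => eLpNorm_congr_ae ?_
  exact (hF n).sub (ae_eq_refl _)

lemma inflowNormSq_eq_zero {F : Phase → ℝ} (h : ∀ p ∈ D.inflowOrTangent, F p = 0) :
    inflowNormSq D F = 0 := by
  refine lintegral_eq_zero_of_ae_eq_zero ?_
  filter_upwards [ae_restrict_mem measurableSet_Icc] with E hE
  refine lintegral_eq_zero_of_ae_eq_zero (.of_forall fun ω => ?_)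
  refine lintegral_eq_zero_of_ae_eq_zero ?_
  filter_upwards [ae_restrict_mem isClosed_frontier.measurableSet] with y hy
  split_ifs with hn
  · rw [h (y, ω, E) ⟨hy, hE, hn.le⟩]
    simp
  · rfl

/-- The graph is approximated by smooth functions whose extensions vanish identically on `Γ₋`, so
the traces are exactly zero before the limit. -/
lemma hasZeroInflowTrace_of_mem {u v : H0 D m} (h : (u, v) ∈ streamGraph D m) :
    HasZeroInflowTrace D (toFn u) (toFn v) := by
  obtain ⟨w, hw, hwt⟩ := mem_closure_iff_seq_limit.1 h
  choose ψ hψ using hw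
  choose F hF1 hF2 hF3 using fun n => exists_smooth_ext (ψ n) 1
  refine ⟨F, fun n => isCx_iff.2 ⟨hF1 n, hF2 n⟩,
    tendsto_eLpNorm_of_tendsto (a := fun n => incl D m (ψ n)) ?_ fun n => ?_,
    tendsto_eLpNorm_of_tendsto (a := fun n => streamH0 D m (ψ n)) ?_ fun n => ?_, ?_⟩
  · exact ((continuous_fst.tendsto _).comp hwt).congr fun n => congrArg Prod.fst (hψ n).symm
  · filter_upwards [toFn_incl (m := m) (ψ n), ae_mem_phase D] with p h1 hp
    rw [h1, hF3 n hp]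
  · exact ((continuous_snd.tendsto _).comp hwt).congr fun n => congrArg Prod.snd (hψ n).symm
  · filter_upwards [toFn_streamH0 (m := m) (ψ n), ae_mem_phase D] with p h1 hp
    rw [h1, streaming_congr (hF3 n) hp]
  · have e : ∀ n, inflowNormSq D (F n) = 0 := fun n => inflowNormSq_eq_zero fun p hp =>
      dxw_eq_zero_of_inflow (ψ n) [] ((hF1 n).mono (by simp)) (hF3 n) hp
    simp only [e]
    exact tendsto_const_nhds

lemma solvesInflowProblem_of_mem {M K : H0 D m →L[ℝ] H0 D m}
    (hM : ∀ u : H0 D m, toFn (M u) =ᵐ[D.μ] fun p => Sig p * toFn u p)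
    (hK : IsCollisionOperator D m σ K) {C : ℝ} {f ψ : H0 D m}
    (h : (ψ, f - C • ψ - (M - K) ψ) ∈ streamGraph D m) :
    SolvesInflowProblem D Sig σ C (toFn f) (toFn ψ) := by
  refine ⟨toFn (f - C • ψ - (M - K) ψ), Lp.memLp _, isWeakStreaming_of_mem h,
    hasZeroInflowTrace_of_mem h, ?_⟩
  filter_upwards [toFn_sub (f - C • ψ) ((M - K) ψ), toFn_sub f (C • ψ), toFn_smul C ψ,
    toFn_sub (M ψ) (K ψ), hM ψ, hK ψ] with p h1 h2 h3 h4 h5 h6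
  rw [h1, Pi.sub_apply, h2, Pi.sub_apply, h3, Pi.smul_apply, smul_eq_mul]
  rw [sub_apply, h4, Pi.sub_apply, h5, h6]
  ring

end Inflow

end Transport

end
-- The theorem
open Transport in
theorem theorem3p10 (m : ℕ) :
    (∃ c : ℝ, ∀ D : Domain, IsMultiplierConstant D m c) ∧
    ∀ (D : Domain) (Sig : Phase → ℝ) (σ : KPhase → ℝ), MemW D m Sig → MemW0 D m σ →
      (∃! K : H0 D m →L[ℝ] H0 D m, IsCollisionOperator D m σ K) ∧
      (∃! Q : H0 D m →ₗ.[ℝ] H0 D m, IsTransportOperator D m Sig σ Q) ∧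
      ∀ (K : H0 D m →L[ℝ] H0 D m) (Q : H0 D m →ₗ.[ℝ] H0 D m),
        IsCollisionOperator D m σ K → IsTransportOperator D m Sig σ Q →
        Q.IsClosable ∧
        ∀ c : ℝ, IsMultiplierConstant D m c →
          ∀ C : ℝ, c * (wNorm D m Sig).toReal + ‖K‖ < C →
            (∀ f : H0 D m, ∃ u : Q.closure.domain, Q.closure u + C • (u : H0 D m) = f) ∧
            ∀ f : H0 D m,
              (∃! ψ : H0 D m, IsStrongSolution Q C f ψ) ∧
              ∀ ψ : H0 D m, IsStrongSolution Q C f ψ →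
                SolvesInflowProblem D Sig σ C (toFn f) (toFn ψ) := by
  refine ⟨⟨leibConst m, fun D => isMultiplierConstant_leibConst D m⟩, fun D Sig σ hSig hσ => ?_⟩
  -- The explicit bound on `M` is discarded: below, every admissible constant bounds `‖M‖`, which is
  -- what the threshold for `C` refers to.
  obtain ⟨M, -, hM⟩ := exists_multiplier hSig
  obtain ⟨K₀, hK₀⟩ := exists_collisionOperator hσ
  refine ⟨⟨K₀, hK₀, fun K hK => ContinuousLinearMap.ext fun u =>
    toFn_injective ((hK u).trans (hK₀ u).symm)⟩, existsUnique_isTransportOperator hM hK₀,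
    fun K Q hK hQ => ⟨hQ.isClosable hM hK, fun c hc C hC => ?_⟩⟩
  have hB : ‖M - K‖ < C :=
    ((norm_sub_le M K).trans (add_le_add (norm_multiplier_le hc hSig hM) le_rfl)).trans_lt hC
  have hS := isMaximalAccretive_streamGraph D m
  have hsol : ∀ f : H0 D m, ∃ ψ, IsStrongSolution Q C f ψ := fun f => by
    obtain ⟨u, hu⟩ := hS.exists_perturbed hB f
    exact ⟨u, (hQ.isStrongSolution_iff hM hK).2 hu⟩
  refine ⟨fun f => ?_, fun f => ⟨?_, fun ψ hψ => ?_⟩⟩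
  · obtain ⟨ψ, h, e⟩ := hsol f
    exact ⟨⟨ψ, h⟩, e⟩
  · obtain ⟨ψ, hψ⟩ := hsol f
    exact ⟨ψ, hψ, fun χ hχ => hS.eq_of_mem hB ((hQ.isStrongSolution_iff hM hK).1 hχ)
      ((hQ.isStrongSolution_iff hM hK).1 hψ)⟩
  · exact solvesInflowProblem_of_mem hM hK ((hQ.isStrongSolution_iff hM hK).1 hψ)
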